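/- Let $b:[0,1)\to[0,\infty)$ be a measurable angular cross section, regarded as $b(\cos\theta)$ with $0<\theta\le\pi/2$, and assume that for some $\alpha_0\in(0,2]$ $$\Big(\sin\frac\theta2\Big)^{\alpha_0} b(\cos\theta)\sin\theta\in L^1((0,\pi/2]).$$ Let $\mathcal K$ be the set of functions $\varphi:\mathbb R^3\to\mathbb C$ of the form $\varphi(\xi)=\int_{\mathbb R^3}e^{-iv\cdot\xi}\,d\Psi(v)$ with $\Psi$ a Borel probability measure on $\mathbb R^3$, let $\|\varphi-\tilde\varphi\|_\alpha=\sup_{\xi\ne0}|\varphi(\xi)-\tilde\varphi(\xi)|/|\xi|^\alpha$, and let $\mathcal K^\alpha=\{\varphi\in\mathcal K:\|\varphi-1\|_\alpha<\infty\}$, with the distance $\|\varphi-\tilde\varphi\|_\alpha$. Consider the Cauchy problem $$\partial_t\psi(t,\xi)=\int_{\mathbb S^2}b\Big(\frac{\xi\cdot\sigma}{|\xi|}\Big)\Big(\psi(t,\xi^+)\psi(t,\xi^-)-\psi(t,\xi)\psi(t,0)\Big)d\sigma,\qquad \psi(0,\xi)=\psi_0(\xi),\qquad \xi^\pm=\frac\xi2\pm\frac{|\xi|}2\sigma,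 \tag{1}$$ where $d\sigma$ is the surface measure of the unit sphere $\mathbb S^2$, the integral runs over the deviation angles $0\le\theta\le\pi/2$, $\cos\theta=\xi\cdot\sigma/|\xi|$, and is understood as the limit for $\varepsilon\downarrow0$ of the absolutely convergent integrals over $\varepsilon\le\theta\le\pi/2$ (for $\xi=0$ the integrand, and so the right-hand side, is $0$). A classical solution is a function $\psi$ on $[0,\infty)\times\mathbb R^3$ with $\psi(0,\cdot)=\psi_0$ such that, for all $t\ge0$ and $\xi\in\mathbb R^3$, the derivative $\partial_t\psi(t,\xi)$ (one-sided at $t=0$) and the integral exist and the equation holds. Then for every $\alpha\in[\alpha_0,2]$: 1. For every $\psi_0\in\mathcal K^\alpha$ there is a classical solution $\psi\in C([0,\infty),\mathcal K^\alpha)$ of (1). It also belongs to $C([0,\infty),\mathcal K^{\alpha_0})$, and it is the only classical solution of (1) with initial datum $\psi_0$ in that space. Moreover, $\partial_t\psi(t,\xi)$ is continuous on $[0,\infty)\times\mathbb R^3$. 2. If $\psi,\varphi\in C([0,\infty),\mathcal K^\alpha)$ are two classical solutions of (1) with initial data $\psi_0,\varphi_0\in\mathcal K^\alpha$, respectively,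 then for every $t>0$ $$\|\psi(t)-\varphi(t)\|_\alpha\le e^{\lambda_\alpha t}\|\psi_0-\varphi_0\|_\alpha,$$ where the integral in $$\lambda_\alpha=2\pi\int_0^{\pi/2}b(\cos\theta)\Big\{\cos^\alpha\frac\theta2+\sin^\alpha\frac\theta2-1\Big\}\sin\theta\,d\theta$$ converges absolutely. -/

import Mathlib

open MeasureTheory Set Filter Topology

noncomputable section

namespace FourierBoltzmann

/-- The space `ℝ³` with its Euclidean norm. -/
abbrev E3 : Type := EuclideanSpace ℝ (Fin 3)

/-- `φ` is a characteristic function: the Fourier transform `ξ ↦ ∫ exp(-i v·ξ) dΨ(v)` of a Borel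
probability measure `Ψ` on `ℝ³`. -/
def IsCharacteristic (φ : E3 → ℂ) : Prop :=
  ∃ Ψ : Measure E3, IsProbabilityMeasure Ψ ∧
    ∀ ξ : E3, φ ξ = ∫ v, Complex.exp (-(Complex.I * ((inner ℝ v ξ : ℝ) : ℂ))) ∂Ψ

/-- The distance `‖φ - χ‖_α = sup_ξ |φ(ξ) - χ(ξ)| / |ξ|^α`, with values in `[0, ∞]`.
The quotient makes sense for `ξ ≠ 0` only; characteristic functions agree at `ξ = 0`. -/
def distK (α : ℝ) (φ χ : E3 → ℂ) : ENNReal :=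
  ⨆ (ξ : E3) (_ : ξ ≠ 0), ENNReal.ofReal (‖φ ξ - χ ξ‖ / ‖ξ‖ ^ α)

/-- The space `𝒦^α` of the characteristic functions `φ` with `‖φ - 1‖_α < ∞`. -/
def K (α : ℝ) : Set (E3 → ℂ) :=
  {φ | IsCharacteristic φ ∧ distK α φ (fun _ => 1) < ⊤}

/-- `ψ ∈ C([0, ∞), 𝒦^α)`: a curve in `𝒦^α`, continuous for the distance `‖· - ·‖_α`.
Only the values `ψ t` with `0 ≤ t` matter. -/
def ContinuousInK (α : ℝ) (ψ : ℝ → E3 → ℂ) : Prop :=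
  (∀ t, 0 ≤ t → ψ t ∈ K α) ∧
    ∀ t₀, 0 ≤ t₀ → Tendsto (fun t => distK α (ψ t) (ψ t₀)) (𝓝[Ici 0] t₀) (𝓝 0)

/-- The surface measure `dσ` of the unit sphere `𝕊²` in `ℝ³` (of total mass `4π`). -/
def surfaceMeasure : Measure (Metric.sphere (0 : E3) 1) := (volume : Measure E3).toSphere

/-- `ξ⁺ = ξ/2 + |ξ|σ/2` -/
def xiPlus (ξ : E3) (σ : Metric.sphere (0 : E3) 1) : E3 :=
  (1 / 2 : ℝ) • ξ + (‖ξ‖ / 2) • (σ : E3)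

/-- `ξ⁻ = ξ/2 - |ξ|σ/2` -/
def xiMinus (ξ : E3) (σ : Metric.sphere (0 : E3) 1) : E3 :=
  (1 / 2 : ℝ) • ξ - (‖ξ‖ / 2) • (σ : E3)

/-- `cos θ = (ξ/|ξ|)·σ`. -/
def cosDeviation (ξ : E3) (σ : Metric.sphere (0 : E3) 1) : ℝ :=
  inner ℝ ξ (σ : E3) / ‖ξ‖

/-- The integrand `b(ξ·σ/|ξ|) (φ(ξ⁺) φ(ξ⁻) - φ(ξ) φ(0))`. -/
def collisionIntegrand (b : ℝ → ℝ) (φ : E3 → ℂ) (ξ : E3) (σ : Metric.sphere (0 : E3) 1) : ℂ :=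
  (b (cosDeviation ξ σ) : ℂ) * (φ (xiPlus ξ σ) * φ (xiMinus ξ σ) - φ ξ * φ 0)

/-- The `σ` whose deviation angle `θ` satisfies `ε ≤ θ ≤ π/2`. -/
def angularRegion (ξ : E3) (ε : ℝ) : Set (Metric.sphere (0 : E3) 1) :=
  {σ | 0 ≤ cosDeviation ξ σ ∧ cosDeviation ξ σ ≤ Real.cos ε}

/-- The Fourier-side collision integral
`∫_{𝕊²} b(ξ·σ/|ξ|) (φ(ξ⁺) φ(ξ⁻) - φ(ξ) φ(0)) dσ`, over deviation angles `0 ≤ θ ≤ π/2`,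
has the value `z`. For a strongly singular `b` it need not converge absolutely at `θ = 0`, so it is
the limit, as `ε ↓ 0`, of the absolutely convergent integrals over `ε ≤ θ ≤ π/2`. It is the usual
integral whenever the integrand is integrable. -/
def HasCollisionIntegral (b : ℝ → ℝ) (φ : E3 → ℂ) (ξ : E3) (z : ℂ) : Prop :=
  (∀ ε ∈ Ioo 0 (Real.pi / 2),
      IntegrableOn (collisionIntegrand b φ ξ) (angularRegion ξ ε) surfaceMeasure) ∧
    Tendsto (fun ε : ℝ => ∫ σ in angularRegion ξ ε, collisionIntegrand b φ ξ σ ∂surfaceMeasure)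
      (𝓝[>] 0) (𝓝 z)

/-- The time derivative `∂_t ψ(t, ξ)` on `[0, ∞)` (one-sided at `t = 0`). -/
def timeDeriv (ψ : ℝ → E3 → ℂ) (t : ℝ) (ξ : E3) : ℂ :=
  derivWithin (fun s => ψ s ξ) (Ici 0) t

/-- `ψ` is a classical solution on `[0, ∞) × ℝ³` of the Cauchy problem
`∂_t ψ(t, ξ) = ∫_{𝕊²} b(ξ·σ/|ξ|) (ψ(t, ξ⁺) ψ(t, ξ⁻) - ψ(t, ξ) ψ(t, 0)) dσ`, `ψ(0, ·) = ψ₀`: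
at each `t ≥ 0` and each `ξ` the time derivative exists, the integral exists, and they agree. -/
def IsClassicalSolution (b : ℝ → ℝ) (ψ₀ : E3 → ℂ) (ψ : ℝ → E3 → ℂ) : Prop :=
  ψ 0 = ψ₀ ∧ ∀ t, 0 ≤ t → ∀ ξ : E3,
    DifferentiableWithinAt ℝ (fun s => ψ s ξ) (Ici 0) t ∧
      HasCollisionIntegral b (ψ t) ξ (timeDeriv ψ t ξ)

/-- The integrand of `λ_α`. -/
def rateIntegrand (b : ℝ → ℝ) (α θ : ℝ) : ℝ :=
  b (Real.cos θ) * (Real.cos (θ / 2) ^ α + Real.sin (θ / 2) ^ α - 1) * Real.sin θ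

/-- `λ_α = 2π ∫_0^{π/2} b(cos θ) (cos^α(θ/2) + sin^α(θ/2) - 1) sin θ dθ`. -/
def rate (b : ℝ → ℝ) (α : ℝ) : ℝ :=
  2 * Real.pi * ∫ θ in Ioc 0 (Real.pi / 2), rateIntegrand b α θ

end FourierBoltzmann

end

open FourierBoltzmann

/-! The total mass of `b` may be infinite, so gain and loss need not make sense separately. Every
estimate that survives the removal of a cutoff may involve `b` only through its moment of order `α`,
that is, the integral of `b(cos θ) sin^α(θ/2) sin θ`.

The source of such estimates is a cancellation. Pair `σ` with its mirror image `σ'` in the axis of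
`ξ`. The two points `ξ⁺` are `ζ ± η` with `ζ = cos²(θ/2) ξ`, and a symmetric second difference of a
characteristic function is controlled by `|φ(η) - 1|` alone. The paired integrand is therefore
`O(|ξ|^α sin^α(θ/2))` (`IsCharacteristic.norm_symmetrized_le`). Hence the cutoff operators are
bounded by the moment (`AngularKernel.norm_coll_le`) and form a Cauchy family as `ε ↓ 0`, with error
given by the tail of the moment (`CrossSection.norm_coll_cut_sub_le`). This makes the collision
integral exist on `𝒦^α`.

With cutoff, Bobylev's identity (`AngularKernel.gain_charFun`) shows that the normalised gain of two
characteristic functions is a characteristic function, and the Wild sum solves the equation inside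
`𝒦^α`.

For stability, `|ξ⁺|^α + |ξ⁻|^α = |ξ|^α (cos^α(θ/2) + sin^α(θ/2))` bounds the gain difference by
mass plus `λ_α`. The integrating factor `exp(mass · t)` cancels the mass, and only `λ_α` remains.
`AngularKernel.distR_le_of_deriv` proves this for curves that solve the cutoff equation up to an
error `δ|ξ|^α`. It yields the uniform bounds on the cutoff solutions, their convergence as the
cutoff is removed, and the stability of true solutions. Uniqueness in the larger space is stability
with exponent `α₀` and equal data. -/

namespace FourierBoltzmann

/-! ### Characteristic functions: closure properties and increments -/

open Complex in
-- The two sign conventions of the Fourier transform differ by the reflection `v ↦ -v` of the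
-- measure.
theorem isCharacteristic_iff_charFun {φ : E3 → ℂ} :
    IsCharacteristic φ ↔ ∃ μ : Measure E3, IsProbabilityMeasure μ ∧ φ = charFun μ := by
  constructor
  · rintro ⟨Ψ, hΨ, h⟩
    refine ⟨Ψ.map (fun v => (-1 : ℝ) • v), Measure.isProbabilityMeasure_map (by fun_prop), ?_⟩
    ext ξ
    rw [h ξ, charFun_map_smul, charFun_apply]
    refine integral_congr_ae (.of_forall fun v => ?_)
    simp [inner_neg_right, mul_comm]
  · rintro ⟨μ, hμ, rfl⟩
    refine ⟨μ.map (fun v => (-1 : ℝ) • v), Measure.isProbabilityMeasure_map (by fun_prop), ?_⟩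
    intro ξ
    have := charFun_map_smul (μ := μ) (-1 : ℝ) (-ξ)
    simp only [smul_neg, neg_smul, one_smul, neg_neg] at this
    rw [← this, charFun_apply]
    simp only [neg_smul, one_smul]
    refine integral_congr_ae (.of_forall fun v => ?_)
    simp [inner_neg_right, mul_comm]

namespace IsCharacteristic

variable {φ : E3 → ℂ}

theorem continuous (h : IsCharacteristic φ) : Continuous φ := by
  obtain ⟨μ, hμ, rfl⟩ := isCharacteristic_iff_charFun.1 h
  exact continuous_charFun

theorem norm_le_one (h : IsCharacteristic φ) (ξ : E3) : ‖φ ξ‖ ≤ 1 := by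
  obtain ⟨μ, hμ, rfl⟩ := isCharacteristic_iff_charFun.1 h
  exact norm_charFun_le_one ξ

theorem apply_zero (h : IsCharacteristic φ) : φ 0 = 1 := by
  obtain ⟨μ, hμ, rfl⟩ := isCharacteristic_iff_charFun.1 h
  simp

theorem one : IsCharacteristic (fun _ => 1) :=
  isCharacteristic_iff_charFun.2 ⟨Measure.dirac 0, inferInstance, by ext; simp [charFun_dirac]⟩

/-- Countable convex combinations of characteristic functions are characteristic functions. -/
theorem tsum {ι : Type*} [Countable ι] {p : ι → ℝ} {f : ι → E3 → ℂ} (hp : ∀ i, 0 ≤ p i)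
    (hsum : HasSum p 1) (hf : ∀ i, IsCharacteristic (f i)) :
    IsCharacteristic (fun ξ => ∑' i, (p i : ℂ) * f i ξ) := by
  choose μ hμ hfμ using fun i => isCharacteristic_iff_charFun.1 (hf i)
  have hprob : IsProbabilityMeasure (Measure.sum fun i => ENNReal.ofReal (p i) • μ i) := by
    constructor
    rw [Measure.sum_apply _ MeasurableSet.univ]
    simp only [Measure.smul_apply, measure_univ, smul_eq_mul, mul_one]
    rw [← ENNReal.ofReal_tsum_of_nonneg hp hsum.summable, hsum.tsum_eq, ENNReal.ofReal_one]
  refine isCharacteristic_iff_charFun.2 ⟨_, hprob, ?_⟩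
  ext ξ
  have hint : Integrable (fun v : E3 => Complex.exp ((inner ℝ v ξ : ℝ) * Complex.I))
      (Measure.sum fun i => ENNReal.ofReal (p i) • μ i) := by
    refine Integrable.of_bound (C := 1) (by fun_prop) (.of_forall fun v => ?_)
    rw [Complex.norm_exp_ofReal_mul_I]
  rw [charFun_apply, integral_sum_measure hint]
  refine tsum_congr fun i => ?_
  rw [integral_smul_measure, ENNReal.toReal_ofReal (hp i), hfμ i, charFun_apply, Complex.real_smul]

theorem sum {ι : Type*} {s : Finset ι} {p : ι → ℝ} {f : ι → E3 → ℂ} (hp : ∀ i ∈ s, 0 ≤ p i)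
    (hsum : ∑ i ∈ s, p i = 1) (hf : ∀ i ∈ s, IsCharacteristic (f i)) :
    IsCharacteristic (fun ξ => ∑ i ∈ s, (p i : ℂ) * f i ξ) := by
  have := tsum (ι := s) (p := fun i => p i) (f := fun i => f i) (fun i => hp i i.2)
    (by rw [← hsum, ← Finset.sum_coe_sort]; exact hasSum_fintype _) (fun i => hf i i.2)
  convert this using 2 with ξ
  rw [tsum_fintype, Finset.sum_coe_sort s fun i => (p i : ℂ) * f i ξ]

/-- A pointwise limit of characteristic functions that is continuous at the origin is a
characteristic function. -/
theorem of_tendsto {f : ℕ → E3 → ℂ} (hf : ∀ n, IsCharacteristic (f n))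
    (hlim : ∀ ξ, Tendsto (fun n => f n ξ) atTop (𝓝 (φ ξ))) (hφ : ContinuousAt φ 0) :
    IsCharacteristic φ := by
  choose μ hμ hfμ using fun n => isCharacteristic_iff_charFun.1 (hf n)
  have hlim' : ∀ t, Tendsto (fun n => charFun (μ n) t) atTop (𝓝 (φ t)) := fun t => by
    simpa only [hfμ] using hlim t
  -- Lévy's argument: continuity of the limit at the origin prevents mass from escaping to infinity.
  -- Prokhorov's theorem then gives a weak limit along a subsequence, whose transform must be `φ`.
  have htight := isTightMeasureSet_of_tendsto_charFun hφ hlim'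
  let ν : ℕ → ProbabilityMeasure E3 := fun n => ⟨μ n, hμ n⟩
  have hcomp : IsCompact (closure (range ν)) := by
    refine isCompact_closure_of_isTightMeasureSet (htight.subset ?_)
    rintro _ ⟨_, ⟨n, rfl⟩, rfl⟩
    exact ⟨n, rfl⟩
  obtain ⟨ν', -, k, hk, hkν⟩ := hcomp.tendsto_subseq (x := ν) fun n => subset_closure ⟨n, rfl⟩
  refine isCharacteristic_iff_charFun.2 ⟨ν', inferInstance, funext fun ξ => ?_⟩
  exact tendsto_nhds_unique ((hlim' ξ).comp hk.tendsto_atTop)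
    (ProbabilityMeasure.tendsto_iff_tendsto_charFun.1 hkν ξ)

theorem norm_exp_sub_one_sq (x : ℝ) :
    ‖Complex.exp (x * Complex.I) - 1‖ ^ 2 = 2 * (1 - (Complex.exp (x * Complex.I)).re) := by
  rw [← Complex.normSq_eq_norm_sq, Complex.normSq_apply]
  simp only [Complex.sub_re, Complex.sub_im, Complex.one_re, Complex.one_im,
    Complex.exp_ofReal_mul_I_re, Complex.exp_ofReal_mul_I_im]
  nlinarith [Real.sin_sq_add_cos_sq x]

theorem integrable_exp_inner (μ : Measure E3) [IsProbabilityMeasure μ] (ξ : E3) :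
    Integrable (fun v : E3 => Complex.exp ((inner ℝ v ξ : ℝ) * Complex.I)) μ := by
  refine Integrable.of_bound (C := 1) (by fun_prop) (.of_forall fun v => ?_)
  rw [Complex.norm_exp_ofReal_mul_I]

/-- Since `|e^{ix} - 1|² = 2(1 - cos x)`, quadratic quantities in the exponentials become linear in
`1 - φ`. Both difference estimates below rest on this. -/
theorem integral_norm_exp_sub_one_sq (μ : Measure E3) [IsProbabilityMeasure μ] (ξ : E3) :
    ∫ v : E3, ‖Complex.exp ((inner ℝ v ξ : ℝ) * Complex.I) - 1‖ ^ 2 ∂μ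
      = 2 * (1 - charFun μ ξ).re := by
  simp_rw [norm_exp_sub_one_sq]
  have hi := integrable_exp_inner μ ξ
  have hre : Integrable (fun v : E3 => (Complex.exp ((inner ℝ v ξ : ℝ) * Complex.I)).re) μ := hi.re
  have := integral_re hi
  simp only [RCLike.re_to_complex] at this
  rw [integral_const_mul, integral_sub (integrable_const _) hre, Complex.sub_re, charFun_apply,
    this]
  simp

/-- Increments of a characteristic function are controlled by its values near the origin. -/
theorem norm_apply_add_sub_le (h : IsCharacteristic φ) (x y : E3) {l : ℝ} (hl : 0 < l) :
    ‖φ (x + y) - φ x‖ ≤ ‖φ y - 1‖ + l * ‖φ x - 1‖ + l⁻¹ * ‖φ y - 1‖ := by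
  obtain ⟨μ, hμ, rfl⟩ := isCharacteristic_iff_charFun.1 h
  set e : E3 → E3 → ℂ := fun ξ v => Complex.exp ((inner ℝ v ξ : ℝ) * Complex.I) with he
  have hi : ∀ ξ, Integrable (e ξ) μ := integrable_exp_inner μ
  have hadd : ∀ v, e (x + y) v = e x v * e y v := fun v => by
    simp only [he, inner_add_right, Complex.ofReal_add, add_mul, Complex.exp_add]
  have hsq : ∀ ξ, Integrable (fun v => ‖e ξ v - 1‖ ^ 2) μ := fun ξ => by
    simp_rw [he, norm_exp_sub_one_sq]
    exact ((integrable_const _).sub (hi ξ).re).const_mul _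
  have hprod : Integrable (fun v => (e x v - 1) * (e y v - 1)) μ := by
    have : (fun v => (e x v - 1) * (e y v - 1)) = fun v => e (x + y) v - e x v - e y v + 1 := by
      ext v; rw [hadd]; ring
    rw [this]
    exact (((hi _).sub (hi _)).sub (hi _)).add (integrable_const _)
  have hdecomp : charFun μ (x + y) - charFun μ x
      = (charFun μ y - 1) + ∫ v, (e x v - 1) * (e y v - 1) ∂μ := by
    have : ∫ v, (e x v - 1) * (e y v - 1) ∂μ = ∫ v, (e (x + y) v - e x v - e y v + 1) ∂μ := by
      congr 1; ext v; rw [hadd]; ring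
    have h1 : Integrable (fun v => e (x + y) v - e x v) μ := (hi _).sub (hi _)
    have h2 : Integrable (fun v => e (x + y) v - e x v - e y v) μ := h1.sub (hi _)
    rw [this, integral_add h2 (integrable_const _), integral_sub h1 (hi _),
      integral_sub (hi _) (hi _)]
    simp only [charFun_apply, he, integral_const, probReal_univ, one_smul]
    ring
  -- Young's inequality with a free weight `l`, to be balanced by the caller.
  have hnorm : ‖∫ v, (e x v - 1) * (e y v - 1) ∂μ‖
      ≤ ∫ v, (l * ‖e x v - 1‖ ^ 2 / 2 + l⁻¹ * ‖e y v - 1‖ ^ 2 / 2) ∂μ := by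
    refine (norm_integral_le_integral_norm _).trans (integral_mono hprod.norm ?_ fun v => ?_)
    · exact (((hsq x).const_mul l).div_const 2).add (((hsq y).const_mul _).div_const 2)
    · simp only [norm_mul]
      set a := ‖e x v - 1‖
      set b := ‖e y v - 1‖
      have h1 : l * a ^ 2 / 2 + l⁻¹ * b ^ 2 / 2 - a * b = l⁻¹ * (l * a - b) ^ 2 / 2 := by
        field_simp; ring
      have h2 : 0 ≤ l⁻¹ * (l * a - b) ^ 2 / 2 := by positivity
      linarith
  rw [integral_add (((hsq x).const_mul l).div_const 2) (((hsq y).const_mul _).div_const 2),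
    integral_div, integral_div, integral_const_mul, integral_const_mul,
    integral_norm_exp_sub_one_sq, integral_norm_exp_sub_one_sq] at hnorm
  have hre : ∀ ξ, (1 - charFun μ ξ).re ≤ ‖charFun μ ξ - 1‖ := fun ξ => by
    rw [norm_sub_rev]; exact Complex.re_le_norm _
  have hx := mul_le_mul_of_nonneg_left (hre x) hl.le
  have hy := mul_le_mul_of_nonneg_left (hre y) (inv_pos.2 hl).le
  rw [hdecomp]
  refine (norm_add_le _ _).trans ?_
  linarith

/-- Pointwise, `e_{x+y} + e_{x-y} - 2e_x = -e_x |e_y - 1|²`: the first-order terms cancel, so the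
base point `x` does not enter the bound. -/
theorem norm_second_difference_le (h : IsCharacteristic φ) (x y : E3) :
    ‖φ (x + y) + φ (x - y) - 2 * φ x‖ ≤ 2 * ‖φ y - 1‖ := by
  obtain ⟨μ, hμ, rfl⟩ := isCharacteristic_iff_charFun.1 h
  set e : E3 → E3 → ℂ := fun ξ v => Complex.exp ((inner ℝ v ξ : ℝ) * Complex.I) with he
  have hi : ∀ ξ, Integrable (e ξ) μ := integrable_exp_inner μ
  have hpt : ∀ v, e (x + y) v + e (x - y) v - 2 * e x v
      = -(e x v * (2 * (1 - (e y v).re) : ℝ)) := fun v => by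
    simp only [he, inner_add_right, inner_sub_right, Complex.ofReal_add, Complex.ofReal_sub,
      add_mul, sub_mul, Complex.exp_add, Complex.exp_sub, Complex.exp_ofReal_mul_I_re]
    rw [div_eq_mul_inv, ← Complex.exp_neg]
    push_cast
    rw [Complex.cos]
    ring_nf
  have heq : charFun μ (x + y) + charFun μ (x - y) - 2 * charFun μ x
      = ∫ v, (e (x + y) v + e (x - y) v - 2 * e x v) ∂μ := by
    have h1 : Integrable (fun v => e (x + y) v + e (x - y) v) μ := (hi _).add (hi _)
    rw [integral_sub h1 ((hi _).const_mul _), integral_add (hi _) (hi _), integral_const_mul]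
    rfl
  rw [heq]
  refine (norm_integral_le_integral_norm _).trans ?_
  have : ∀ v, ‖e (x + y) v + e (x - y) v - 2 * e x v‖ = ‖e y v - 1‖ ^ 2 := fun v => by
    rw [hpt, norm_neg, norm_mul, he]
    simp only []
    rw [Complex.norm_exp_ofReal_mul_I, one_mul, ← norm_exp_sub_one_sq, Complex.norm_real]
    simp
  simp_rw [this]
  rw [integral_norm_exp_sub_one_sq, norm_sub_rev]
  exact mul_le_mul_of_nonneg_left (Complex.re_le_norm _) zero_le_two

end IsCharacteristic

/-! ### The surface measure and the law of the deviation angle -/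

/-- The unit sphere. -/
abbrev S2 : Type := Metric.sphere (0 : E3) 1

/-- The action of a linear isometry on the unit sphere. -/
noncomputable def sphereMap (R : E3 ≃ₗᵢ[ℝ] E3) (σ : S2) : S2 :=
  ⟨R σ, by simp⟩

@[simp] theorem coe_sphereMap (R : E3 ≃ₗᵢ[ℝ] E3) (σ : S2) :
    (sphereMap R σ : E3) = R σ := rfl

theorem continuous_sphereMap (R : E3 ≃ₗᵢ[ℝ] E3) : Continuous (sphereMap R) :=
  (R.continuous.comp continuous_subtype_val).subtype_mk _

instance : IsFiniteMeasure surfaceMeasure := by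
  unfold surfaceMeasure; infer_instance

open scoped Pointwise in
-- The surface measure of a set is a multiple of the volume of the cone over it, and isometries
-- carry cones to cones of equal volume.
theorem measurePreserving_sphereMap (R : E3 ≃ₗᵢ[ℝ] E3) :
    MeasurePreserving (sphereMap R) surfaceMeasure surfaceMeasure := by
  have hm := (continuous_sphereMap R).measurable
  refine ⟨hm, Measure.ext fun s hs => ?_⟩
  rw [Measure.map_apply hm hs, surfaceMeasure, Measure.toSphere_apply' _ (hm hs),
    Measure.toSphere_apply' _ hs]
  congr 1
  have : (Ioo (0 : ℝ) 1 • ((↑) '' (sphereMap R ⁻¹' s)) : Set E3)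
      = R ⁻¹' (Ioo (0 : ℝ) 1 • ((↑) '' s)) := by
    ext x
    simp only [Set.mem_smul, Set.mem_image, Set.mem_preimage]
    constructor
    · rintro ⟨r, hr, _, ⟨σ, hσ, rfl⟩, rfl⟩
      exact ⟨r, hr, _, ⟨sphereMap R σ, hσ, rfl⟩, by simp⟩
    · rintro ⟨r, hr, _, ⟨σ, hσ, rfl⟩, h⟩
      refine ⟨r, hr, _, ⟨sphereMap R.symm σ, ?_, rfl⟩, ?_⟩
      · convert hσ
        ext1
        simp
      · apply R.injective
        simp [← h]
  rw [this]
  exact R.measurePreserving.measure_preimage_equiv (f := R.toMeasurableEquiv) _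

theorem integral_sphereMap {F : Type*} [NormedAddCommGroup F] [NormedSpace ℝ F]
    (R : E3 ≃ₗᵢ[ℝ] E3) (f : S2 → F) :
    ∫ σ, f (sphereMap R σ) ∂surfaceMeasure = ∫ σ, f σ ∂surfaceMeasure := by
  refine (measurePreserving_sphereMap R).integral_comp
    (MeasurableEquiv.measurableEmbedding ⟨⟨sphereMap R, sphereMap R.symm, ?_, ?_⟩, ?_, ?_⟩) f
  · intro σ; ext1; simp
  · intro σ; ext1; simp
  · exact (continuous_sphereMap R).measurable
  · exact (continuous_sphereMap R.symm).measurable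

/-- Cylindrical coordinates for functions that are symmetric about the first axis. -/
theorem lintegral_cylindrical {F : ℝ → ℝ → ENNReal} (hF : Measurable (fun p : ℝ × ℝ => F p.1 p.2)) :
    ∫⁻ x : E3, F (x 0) (x 1 ^ 2 + x 2 ^ 2)
      = ENNReal.ofReal (2 * Real.pi) * ∫⁻ p : ℝ × ℝ, ENNReal.ofReal p.2 * F p.1 (p.2 ^ 2) := by
  have h1 : ∫⁻ x : E3, F (x 0) (x 1 ^ 2 + x 2 ^ 2)
      = ∫⁻ x : Fin 3 → ℝ, F (x 0) (x 1 ^ 2 + x 2 ^ 2) := by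
    rw [← (PiLp.volume_preserving_ofLp (Fin 3)).lintegral_comp]
    fun_prop
  have h2 : ∫⁻ x : Fin 3 → ℝ, F (x 0) (x 1 ^ 2 + x 2 ^ 2)
      = ∫⁻ y : ℝ × (Fin 2 → ℝ), F y.1 (y.2 0 ^ 2 + y.2 1 ^ 2) := by
    rw [← (volume_preserving_piFinSuccAbove (fun _ : Fin 3 => ℝ) 0).lintegral_comp]
    · rfl
    · fun_prop
  have h3 : ∀ z, ∫⁻ w : Fin 2 → ℝ, F z (w 0 ^ 2 + w 1 ^ 2)
      = ∫⁻ w : ℝ × ℝ, F z (w.1 ^ 2 + w.2 ^ 2) := fun z => by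
    rw [← (volume_preserving_finTwoArrow ℝ).lintegral_comp]
    · rfl
    · fun_prop
  have h4 : ∀ z, ∫⁻ w : ℝ × ℝ, F z (w.1 ^ 2 + w.2 ^ 2)
      = ENNReal.ofReal (2 * Real.pi) * ∫⁻ r : ℝ, ENNReal.ofReal r * F z (r ^ 2) := fun z => by
    rw [← lintegral_comp_polarCoord_symm]
    have : ∀ p : ℝ × ℝ, ENNReal.ofReal p.1 • F z ((polarCoord.symm p).1 ^ 2 +
        (polarCoord.symm p).2 ^ 2) = ENNReal.ofReal p.1 * F z (p.1 ^ 2) := fun p => by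
      rw [polarCoord_symm_apply, smul_eq_mul]
      congr 2
      simp only []
      nlinarith [Real.sin_sq_add_cos_sq p.2]
    simp_rw [this]
    -- `ENNReal.ofReal r` vanishes for `r ≤ 0`, so the integral may run over the whole line. That
    -- makes a second use of polar coordinates possible.
    have hr : ∫⁻ r in Ioi (0 : ℝ), ENNReal.ofReal r * F z (r ^ 2)
        = ∫⁻ r : ℝ, ENNReal.ofReal r * F z (r ^ 2) := by
      refine setLIntegral_eq_of_support_subset fun r hr => ?_
      by_contra h
      exact hr (by simp [ENNReal.ofReal_of_nonpos (not_lt.1 h)])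
    rw [polarCoord_target, Measure.volume_eq_prod, setLIntegral_prod _ (by fun_prop)]
    simp only [lintegral_const, Measure.restrict_apply_univ, Real.volume_Ioo]
    rw [lintegral_mul_const _ (by fun_prop), hr, mul_comm]
    ring_nf
  rw [h1, h2, Measure.volume_eq_prod, lintegral_prod _ (by fun_prop)]
  simp_rw [h3, h4]
  rw [lintegral_const_mul _ ?_, Measure.volume_eq_prod, lintegral_prod _ (by fun_prop)]
  exact Measurable.lintegral_prod_right' (f := fun p : ℝ × ℝ => ENNReal.ofReal p.2 * F p.1 (p.2 ^ 2)) (by fun_prop)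

theorem lintegral_Ioo_sq : ∫⁻ r in Ioo (0 : ℝ) 1, ENNReal.ofReal (r ^ 2) = ENNReal.ofReal (1 / 3) := by
  rw [← ofReal_integral_eq_lintegral_ofReal, ← integral_Ioc_eq_integral_Ioo,
    ← intervalIntegral.integral_of_le zero_le_one, integral_pow]
  · norm_num
  · exact ((continuous_pow 2).integrableOn_Icc (a := 0) (b := 1)).mono_set Ioo_subset_Icc_self
  · exact .of_forall fun r => by positivity

/-- Volume of a truncated cone about the first axis. -/
theorem volume_cone {A : Set ℝ} (hA : MeasurableSet A) :
    volume {x : E3 | 0 < ‖x‖ ∧ ‖x‖ < 1 ∧ x 0 / ‖x‖ ∈ A}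
      = ENNReal.ofReal (1 / 3) * (ENNReal.ofReal (2 * Real.pi) *
        ∫⁻ θ in Ioo 0 Real.pi, ENNReal.ofReal (Real.sin θ) * A.indicator 1 (Real.cos θ)) := by
  set G : ℝ → ℝ → ENNReal := fun r c => (Ioo (0 : ℝ) 1).indicator 1 r * A.indicator 1 c with hG
  have hGm : Measurable (fun p : ℝ × ℝ => G p.1 p.2) := by
    have h1 : Measurable ((Ioo (0 : ℝ) 1).indicator (1 : ℝ → ENNReal)) :=
      measurable_one.indicator measurableSet_Ioo
    have h2 : Measurable (A.indicator (1 : ℝ → ENNReal)) := measurable_one.indicator hA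
    exact (h1.comp measurable_fst).mul (h2.comp measurable_snd)
  set F : ℝ → ℝ → ENNReal := fun z q => G (√(z ^ 2 + q)) (z / √(z ^ 2 + q)) with hF
  have hFm : Measurable (fun p : ℝ × ℝ => F p.1 p.2) := by
    have : Measurable fun p : ℝ × ℝ => (√(p.1 ^ 2 + p.2), p.1 / √(p.1 ^ 2 + p.2)) := by fun_prop
    exact hGm.comp this
  have hnorm : ∀ x : E3, √(x 0 ^ 2 + (x 1 ^ 2 + x 2 ^ 2)) = ‖x‖ := fun x => by
    rw [EuclideanSpace.norm_eq, Fin.sum_univ_three]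
    simp [add_assoc]
  have hS : MeasurableSet {x : E3 | 0 < ‖x‖ ∧ ‖x‖ < 1 ∧ x 0 / ‖x‖ ∈ A} := by
    have h1 : Measurable fun x : E3 => ‖x‖ := measurable_norm
    have h2 : Measurable fun x : E3 => x 0 / ‖x‖ := by fun_prop
    exact (measurableSet_lt measurable_const h1).inter
      ((measurableSet_lt h1 measurable_const).inter (h2 hA))
  have h1 : volume {x : E3 | 0 < ‖x‖ ∧ ‖x‖ < 1 ∧ x 0 / ‖x‖ ∈ A}
      = ∫⁻ x : E3, F (x 0) (x 1 ^ 2 + x 2 ^ 2) := by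
    rw [← lintegral_indicator_one hS]
    refine lintegral_congr fun x => ?_
    simp only [hF, hG, hnorm]
    by_cases ha : ‖x‖ ∈ Ioo (0 : ℝ) 1
    · by_cases hb : x 0 / ‖x‖ ∈ A
      · rw [indicator_of_mem ha, indicator_of_mem hb, indicator_of_mem (by exact ⟨ha.1, ha.2, hb⟩)]
        simp
      · rw [indicator_of_notMem hb, indicator_of_notMem (fun h => hb h.2.2), mul_zero]
    · rw [indicator_of_notMem ha, indicator_of_notMem (fun h => ha ⟨h.1, h.2.1⟩), zero_mul]
  -- Polar coordinates in the meridian half-plane complete the passage to spherical coordinates. The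
  -- density `r² sin θ` then splits, and the radial factor integrates to `1/3`.
  rw [h1, lintegral_cylindrical hFm, ← lintegral_comp_polarCoord_symm, polarCoord_target]
  have h2 : ∀ p ∈ Ioi (0 : ℝ) ×ˢ Ioo (-Real.pi) Real.pi,
      ENNReal.ofReal p.1 • (ENNReal.ofReal (polarCoord.symm p).2 *
        F (polarCoord.symm p).1 ((polarCoord.symm p).2 ^ 2))
      = ((Ioo (0 : ℝ) 1).indicator (fun r => ENNReal.ofReal (r ^ 2)) p.1) *
        (ENNReal.ofReal (Real.sin p.2) * A.indicator 1 (Real.cos p.2)) := by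
    rintro ⟨r, θ⟩ ⟨hr, -⟩
    have hr : 0 < r := hr
    simp only [polarCoord_symm_apply, hF, hG, smul_eq_mul]
    have : √((r * Real.cos θ) ^ 2 + (r * Real.sin θ) ^ 2) = r := by
      rw [show (r * Real.cos θ) ^ 2 + (r * Real.sin θ) ^ 2 = r ^ 2 by
        nlinarith [Real.sin_sq_add_cos_sq θ], Real.sqrt_sq hr.le]
    rw [this, mul_div_cancel_left₀ _ hr.ne', ENNReal.ofReal_mul hr.le]
    by_cases ha : r ∈ Ioo (0 : ℝ) 1
    · rw [indicator_of_mem ha, indicator_of_mem ha, sq, ENNReal.ofReal_mul hr.le]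
      simp only [Pi.one_apply, one_mul]
      ring
    · rw [indicator_of_notMem ha, indicator_of_notMem ha]
      simp
  have hm1 : Measurable ((Ioo (0 : ℝ) 1).indicator (fun r => ENNReal.ofReal (r ^ 2))) :=
    Measurable.indicator (by fun_prop) measurableSet_Ioo
  have hm2 : Measurable fun θ => ENNReal.ofReal (Real.sin θ) * A.indicator 1 (Real.cos θ) := by
    have h2 : Measurable (A.indicator (1 : ℝ → ENNReal)) := measurable_one.indicator hA
    exact (by fun_prop : Measurable fun θ => ENNReal.ofReal (Real.sin θ)).mul
      (h2.comp Real.measurable_cos)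
  rw [setLIntegral_congr_fun (measurableSet_Ioi.prod measurableSet_Ioo) h2,
    Measure.volume_eq_prod, ← Measure.prod_restrict, lintegral_prod_mul hm1.aemeasurable
    hm2.aemeasurable]
  have h3 : ∫⁻ r in Ioi (0 : ℝ), (Ioo (0 : ℝ) 1).indicator (fun r => ENNReal.ofReal (r ^ 2)) r
      = ENNReal.ofReal (1 / 3) := by
    rw [lintegral_indicator measurableSet_Ioo, Measure.restrict_restrict measurableSet_Ioo,
      inter_eq_left.2 Ioo_subset_Ioi_self, lintegral_Ioo_sq]
  have h4 : ∫⁻ θ in Ioo (-Real.pi) Real.pi, ENNReal.ofReal (Real.sin θ) *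
        A.indicator 1 (Real.cos θ)
      = ∫⁻ θ in Ioo 0 Real.pi, ENNReal.ofReal (Real.sin θ) * A.indicator 1 (Real.cos θ) := by
    rw [← Ioc_union_Ioo_eq_Ioo (neg_nonpos.2 Real.pi_pos.le) Real.pi_pos,
      lintegral_union measurableSet_Ioo]
    · rw [setLIntegral_congr_fun (g := fun _ => 0) measurableSet_Ioc fun θ hθ => ?_]
      · simp
      · simp [ENNReal.ofReal_of_nonpos (Real.sin_nonpos_of_nonpos_of_neg_pi_le hθ.2 hθ.1.le)]
    · exact Set.disjoint_left.2 fun θ h h' => h.2.not_gt h'.1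
  rw [h3, h4]
  ring

/-- The law of `cos θ = e·σ` under the surface measure has density `2π sin θ` in the angle `θ`. -/
noncomputable def angleMeasure : Measure ℝ :=
  (volume.restrict (Ioo 0 Real.pi)).withDensity fun θ => ENNReal.ofReal (2 * Real.pi * Real.sin θ)

open scoped Pointwise in
-- The dimension factor `3` in `Measure.toSphere` cancels the `1/3` from the radial integral of the
-- cone.
theorem map_inner_single_surfaceMeasure :
    surfaceMeasure.map (fun σ : S2 => (σ : E3) 0) = angleMeasure.map Real.cos := by
  have hm : Measurable fun σ : S2 => (σ : E3) 0 := by fun_prop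
  refine Measure.ext fun A hA => ?_
  rw [Measure.map_apply hm hA, Measure.map_apply Real.measurable_cos hA, surfaceMeasure,
    Measure.toSphere_apply' _ (hm hA), angleMeasure,
    withDensity_apply _ (Real.measurable_cos hA)]
  have hset : (Ioo (0 : ℝ) 1 • ((↑) '' ((fun σ : S2 => (σ : E3) 0) ⁻¹' A))
      : Set E3) = {x : E3 | 0 < ‖x‖ ∧ ‖x‖ < 1 ∧ x 0 / ‖x‖ ∈ A} := by
    ext x
    simp only [Set.mem_smul, Set.mem_image, Set.mem_preimage, mem_ofPred_eq]
    constructor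
    · rintro ⟨r, hr, _, ⟨σ, hσ, rfl⟩, rfl⟩
      have : ‖r • (σ : E3)‖ = r := by rw [norm_smul]; simp [abs_of_pos hr.1]
      rw [this]
      refine ⟨hr.1, hr.2, ?_⟩
      simpa [mul_div_cancel_left₀ _ hr.1.ne'] using hσ
    · rintro ⟨h0, h1, h2⟩
      refine ⟨‖x‖, ⟨h0, h1⟩, ‖x‖⁻¹ • x, ⟨⟨‖x‖⁻¹ • x, ?_⟩, ?_, rfl⟩, ?_⟩
      · simp [norm_smul, h0.ne']
      · simpa [div_eq_inv_mul] using h2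
      · rw [smul_smul, mul_inv_cancel₀ h0.ne', one_smul]
  rw [hset, volume_cone hA, ← mul_assoc, finrank_euclideanSpace_fin]
  have h3 : ((3 : ℕ) : ENNReal) * ENNReal.ofReal (1 / 3) = 1 := by
    rw [← ENNReal.ofReal_natCast, ← ENNReal.ofReal_mul (by norm_num)]
    norm_num
  have hm2 : Measurable fun θ => ENNReal.ofReal (Real.sin θ) * A.indicator 1 (Real.cos θ) := by
    have h2 : Measurable (A.indicator (1 : ℝ → ENNReal)) := measurable_one.indicator hA
    exact (by fun_prop : Measurable fun θ => ENNReal.ofReal (Real.sin θ)).mul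
      (h2.comp Real.measurable_cos)
  rw [h3, one_mul, ← lintegral_const_mul _ hm2, ← lintegral_indicator (Real.measurable_cos hA)]
  refine lintegral_congr fun θ => ?_
  by_cases h : Real.cos θ ∈ A
  · rw [indicator_of_mem h, indicator_of_mem (by exact h),
      ENNReal.ofReal_mul (p := 2 * Real.pi) (by positivity), Pi.one_apply, mul_one]
  · rw [indicator_of_notMem h, indicator_of_notMem (by exact h)]
    simp

/-- A linear isometry exchanging two unit vectors. -/
theorem exists_isometry_swap {e f : E3} (h : ‖e‖ = ‖f‖) :
    ∃ R : E3 ≃ₗᵢ[ℝ] E3, R e = f ∧ R f = e ∧ ∀ x, R (R x) = x := by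
  refine ⟨(ℝ ∙ (e - f))ᗮ.reflection, Submodule.reflection_sub h, ?_,
    fun x => Submodule.reflection_reflection _ x⟩
  have := Submodule.reflection_reflection (ℝ ∙ (e - f))ᗮ e
  rwa [Submodule.reflection_sub h] at this

theorem map_inner_surfaceMeasure {e : E3} (he : ‖e‖ = 1) :
    surfaceMeasure.map (fun σ : S2 => inner ℝ e (σ : E3)) = angleMeasure.map Real.cos := by
  obtain ⟨R, hR, -, -⟩ := exists_isometry_swap (e := e) (f := EuclideanSpace.single 0 1)
    (by simp [he])
  rw [← map_inner_single_surfaceMeasure]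
  have : (fun σ : S2 => inner ℝ e (σ : E3))
      = (fun σ : S2 => (σ : E3) 0) ∘ sphereMap R := by
    ext σ
    rw [← R.inner_map_map, hR]
    simp [EuclideanSpace.inner_single_left]
  rw [this, ← Measure.map_map (by fun_prop) (continuous_sphereMap R).measurable,
    (measurePreserving_sphereMap R).map_eq]

theorem integrable_comp_inner_iff {e : E3} (he : ‖e‖ = 1) {g : ℝ → ℝ} (hg : Measurable g) :
    Integrable (fun σ : S2 => g (inner ℝ e (σ : E3))) surfaceMeasure ↔
      IntegrableOn (fun θ => g (Real.cos θ) * Real.sin θ) (Ioo 0 Real.pi) := by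
  have h1 : Integrable (fun σ : S2 => g (inner ℝ e (σ : E3))) surfaceMeasure ↔
      Integrable g (surfaceMeasure.map (fun σ : S2 => inner ℝ e (σ : E3))) :=
    (integrable_map_measure hg.aestronglyMeasurable (by fun_prop)).symm
  rw [h1, map_inner_surfaceMeasure he, integrable_map_measure hg.aestronglyMeasurable
    Real.measurable_cos.aemeasurable, angleMeasure,
    integrable_withDensity_iff_integrable_smul' (by fun_prop) (by simp), IntegrableOn,
    ← integrable_const_mul_iff (c := 2 * Real.pi) (by simp [Real.pi_pos.ne'])
    (fun θ => g (Real.cos θ) * Real.sin θ)]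
  refine integrable_congr ?_
  filter_upwards [ae_restrict_mem measurableSet_Ioo] with θ hθ
  have := Real.sin_pos_of_mem_Ioo hθ
  rw [ENNReal.toReal_ofReal (by positivity), smul_eq_mul, Function.comp_apply]
  ring

theorem integral_comp_inner {e : E3} (he : ‖e‖ = 1) {g : ℝ → ℝ} (hg : Measurable g) :
    ∫ σ : S2, g (inner ℝ e (σ : E3)) ∂surfaceMeasure
      = 2 * Real.pi * ∫ θ in Ioo 0 Real.pi, g (Real.cos θ) * Real.sin θ := by
  rw [← integral_map (φ := fun σ : S2 => inner ℝ e (σ : E3)) (f := g)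
    (by fun_prop) hg.aestronglyMeasurable,
    map_inner_surfaceMeasure he, integral_map Real.measurable_cos.aemeasurable
    hg.aestronglyMeasurable, angleMeasure, integral_withDensity_eq_integral_toReal_smul
    (by fun_prop) (by simp), ← integral_const_mul]
  refine setIntegral_congr_fun measurableSet_Ioo fun θ hθ => ?_
  have := Real.sin_pos_of_mem_Ioo hθ
  simp only [ENNReal.toReal_ofReal (by positivity : 0 ≤ 2 * Real.pi * Real.sin θ), smul_eq_mul]
  ring

/-! ### Angular kernels with cutoff -/

/-- An angular kernel with cutoff: nonnegative, supported in `[0, ∞)`, of finite total mass. -/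
structure AngularKernel (c : ℝ → ℝ) : Prop where
  measurable : Measurable c
  nonneg : ∀ τ, 0 ≤ c τ
  support : ∀ τ < 0, c τ = 0
  integrable : IntegrableOn (fun θ => c (Real.cos θ) * Real.sin θ) (Ioc 0 (Real.pi / 2))

/-- The total mass of an angular kernel. -/
noncomputable def mass (c : ℝ → ℝ) : ℝ :=
  2 * Real.pi * ∫ θ in Ioc 0 (Real.pi / 2), c (Real.cos θ) * Real.sin θ

/-- The moment of order `α` of an angular kernel. -/
noncomputable def moment (c : ℝ → ℝ) (α : ℝ) : ℝ :=
  2 * Real.pi * ∫ θ in Ioc 0 (Real.pi / 2),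
    c (Real.cos θ) * (Real.sin (θ / 2) ^ α) * Real.sin θ

open Classical in
/-- The direction of `ξ`, with a fixed choice at the origin. -/
noncomputable def axis (ξ : E3) : E3 :=
  if ξ = 0 then EuclideanSpace.single 0 1 else ‖ξ‖⁻¹ • ξ

theorem norm_axis (ξ : E3) : ‖axis ξ‖ = 1 := by
  unfold axis
  split_ifs with h
  · simp
  · simp [norm_smul, h]

theorem norm_smul_axis (ξ : E3) : ‖ξ‖ • axis ξ = ξ := by
  unfold axis
  split_ifs with h
  · simp [h]
  · rw [smul_smul, mul_inv_cancel₀ (norm_ne_zero_iff.2 h), one_smul]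

theorem measurable_axis : Measurable axis :=
  Measurable.ite (measurableSet_singleton (0 : E3)) measurable_const (by fun_prop)

theorem abs_inner_axis_le_one {e : E3} (he : ‖e‖ = 1) (σ : S2) : |inner ℝ e (σ : E3)| ≤ 1 := by
  have := abs_real_inner_le_norm e (σ : E3)
  simpa [he] using this

theorem continuous_xiPlus (ξ : E3) : Continuous (xiPlus ξ) := by
  unfold xiPlus; fun_prop

theorem continuous_xiMinus (ξ : E3) : Continuous (xiMinus ξ) := by
  unfold xiMinus; fun_prop

theorem norm_half_add_half {e x : E3} (he : ‖e‖ = 1) (hx : ‖x‖ = 1) :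
    ‖(1 / 2 : ℝ) • e + (1 / 2 : ℝ) • x‖ = √((1 + inner ℝ e x) / 2) := by
  symm
  rw [Real.sqrt_eq_iff_eq_sq _ (norm_nonneg _), norm_add_sq_real]
  · simp only [norm_smul, inner_smul_left, inner_smul_right, he, hx]
    norm_num
    ring
  · have := abs_real_inner_le_norm e x
    rw [he, hx, abs_le] at this
    linarith

/-- This is `|ξ⁺| = |ξ| cos(θ/2)`, written in `τ = cos θ` so that it can enter integrals over the
sphere as a function of the inner product. Together with its companion for `ξ⁻` it is the only
geometry behind `λ_α`. -/
theorem norm_xiPlus (ξ : E3) (σ : S2) :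
    ‖xiPlus ξ σ‖ = ‖ξ‖ * √((1 + inner ℝ (axis ξ) (σ : E3)) / 2) := by
  have h : xiPlus ξ σ = ‖ξ‖ • ((1 / 2 : ℝ) • axis ξ + (1 / 2 : ℝ) • (σ : E3)) := by
    rw [smul_add, smul_comm, norm_smul_axis, smul_smul, xiPlus]
    ring_nf
  rw [h, norm_smul, norm_half_add_half (norm_axis ξ) (by simp), norm_norm]

theorem norm_xiMinus (ξ : E3) (σ : S2) :
    ‖xiMinus ξ σ‖ = ‖ξ‖ * √((1 - inner ℝ (axis ξ) (σ : E3)) / 2) := by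
  have h : xiMinus ξ σ = ‖ξ‖ • ((1 / 2 : ℝ) • axis ξ + (1 / 2 : ℝ) • (-(σ : E3))) := by
    rw [smul_add, smul_comm, norm_smul_axis, smul_smul, xiMinus, sub_eq_add_neg, smul_neg]
    ring_nf
  rw [h, norm_smul, norm_half_add_half (norm_axis ξ) (by simp), norm_norm, inner_neg_right,
    sub_eq_add_neg]

theorem sqrt_half_add_le_one {τ : ℝ} (h : |τ| ≤ 1) : √((1 + τ) / 2) ≤ 1 := by
  refine Real.sqrt_le_one.2 ?_; linarith [(abs_le.1 h).2]

theorem sqrt_half_sub_le_one {τ : ℝ} (h : |τ| ≤ 1) : √((1 - τ) / 2) ≤ 1 := by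
  refine Real.sqrt_le_one.2 ?_; linarith [(abs_le.1 h).1]

theorem norm_xiPlus_le (ξ : E3) (σ : S2) : ‖xiPlus ξ σ‖ ≤ ‖ξ‖ := by
  rw [norm_xiPlus]
  exact mul_le_of_le_one_right (norm_nonneg _)
    (sqrt_half_add_le_one (abs_inner_axis_le_one (norm_axis ξ) σ))

theorem norm_xiMinus_le (ξ : E3) (σ : S2) : ‖xiMinus ξ σ‖ ≤ ‖ξ‖ := by
  rw [norm_xiMinus]
  exact mul_le_of_le_one_right (norm_nonneg _)
    (sqrt_half_sub_le_one (abs_inner_axis_le_one (norm_axis ξ) σ))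

theorem sqrt_half_add_cos {θ : ℝ} (h : θ ∈ Ioc 0 (Real.pi / 2)) :
    √((1 + Real.cos θ) / 2) = Real.cos (θ / 2) := by
  rw [Real.cos_half] <;> linarith [h.1, h.2, Real.pi_pos]

theorem sqrt_half_sub_cos {θ : ℝ} (h : θ ∈ Ioc 0 (Real.pi / 2)) :
    √((1 - Real.cos θ) / 2) = Real.sin (θ / 2) := by
  rw [Real.sin_half_eq_sqrt] <;> linarith [h.1, h.2, Real.pi_pos]

theorem setIntegral_Ioo_pi {c : ℝ → ℝ} (h0 : ∀ τ < 0, c τ = 0) (g : ℝ → ℝ) :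
    ∫ θ in Ioo 0 Real.pi, c (Real.cos θ) * g θ = ∫ θ in Ioc 0 (Real.pi / 2), c (Real.cos θ) * g θ := by
  refine setIntegral_eq_of_subset_of_forall_sdiff_eq_zero measurableSet_Ioo ?_ ?_
  · exact fun θ h => ⟨h.1, h.2.trans_lt (half_lt_self Real.pi_pos)⟩
  · intro θ h
    have : Real.pi / 2 < θ := by
      by_contra h'
      exact h.2 ⟨h.1.1, not_lt.1 h'⟩
    rw [h0 _ (Real.cos_neg_of_pi_div_two_lt_of_lt this (by linarith [h.1.2, Real.pi_pos])), zero_mul]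

namespace AngularKernel

variable {c : ℝ → ℝ}

theorem mass_nonneg (hc : AngularKernel c) : 0 ≤ mass c := by
  refine mul_nonneg (by positivity) (setIntegral_nonneg measurableSet_Ioc fun θ hθ => ?_)
  exact mul_nonneg (hc.nonneg _)
    (Real.sin_nonneg_of_nonneg_of_le_pi hθ.1.le (by linarith [hθ.2, Real.pi_pos]))

theorem integrableOn_Ioo (hc : AngularKernel c) :
    IntegrableOn (fun θ => c (Real.cos θ) * Real.sin θ) (Ioo 0 Real.pi) := by
  refine hc.integrable.of_forall_sdiff_eq_zero measurableSet_Ioo fun θ h => ?_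
  have : Real.pi / 2 < θ := by
    by_contra h'
    exact h.2 ⟨h.1.1, not_lt.1 h'⟩
  rw [hc.support _ (Real.cos_neg_of_pi_div_two_lt_of_lt this (by linarith [h.1.2, Real.pi_pos])),
    zero_mul]

theorem integrable_inner (hc : AngularKernel c) {e : E3} (he : ‖e‖ = 1) :
    Integrable (fun σ : S2 => c (inner ℝ e (σ : E3))) surfaceMeasure :=
  (integrable_comp_inner_iff he hc.measurable).2 hc.integrableOn_Ioo

theorem integral_inner_mul (hc : AngularKernel c) {e : E3} (he : ‖e‖ = 1) {g : ℝ → ℝ}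
    (hg : Measurable g) :
    ∫ σ : S2, c (inner ℝ e (σ : E3)) * g (inner ℝ e (σ : E3)) ∂surfaceMeasure
      = 2 * Real.pi * ∫ θ in Ioc 0 (Real.pi / 2),
          c (Real.cos θ) * g (Real.cos θ) * Real.sin θ := by
  rw [integral_comp_inner (g := fun τ => c τ * g τ) he (hc.measurable.mul hg)]
  simp only [mul_assoc]
  rw [setIntegral_Ioo_pi hc.support]

theorem integral_inner (hc : AngularKernel c) {e : E3} (he : ‖e‖ = 1) :
    ∫ σ : S2, c (inner ℝ e (σ : E3)) ∂surfaceMeasure = mass c := by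
  have := hc.integral_inner_mul he (g := fun _ => 1) measurable_const
  simpa [mass] using this

theorem integrable_mul_bounded {X : Type*} [MeasurableSpace X] {μ : Measure X} {f : X → ℝ}
    (hf : Integrable f μ) {F : X → ℂ} (hF : AEStronglyMeasurable F μ) {C : ℝ}
    (hb : ∀ x, ‖F x‖ ≤ C) : Integrable (fun x => (f x : ℂ) * F x) μ :=
  (hf.ofReal (𝕜 := ℂ)).mul_bdd hF (.of_forall hb)

theorem integrable_mul (hc : AngularKernel c) {e : E3} (he : ‖e‖ = 1) {F : S2 → ℂ}
    (hF : AEStronglyMeasurable F surfaceMeasure) {C : ℝ} (hb : ∀ σ, ‖F σ‖ ≤ C) :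
    Integrable (fun σ : S2 => (c (inner ℝ e (σ : E3)) : ℂ) * F σ) surfaceMeasure :=
  integrable_mul_bounded (hc.integrable_inner he) hF hb

/-- All operator bounds pass through this reduction: a majorant depending on the deviation angle
alone turns the sphere integral into a one-dimensional one. -/
theorem norm_integral_mul_le (hc : AngularKernel c) {e : E3} (he : ‖e‖ = 1) {F : S2 → ℂ}
    {g : ℝ → ℝ} (hg : Measurable g) {C : ℝ} (hgC : ∀ τ, |τ| ≤ 1 → |g τ| ≤ C)
    (hF : ∀ σ : S2, ‖F σ‖ ≤ g (inner ℝ e (σ : E3))) :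
    ‖∫ σ : S2, (c (inner ℝ e (σ : E3)) : ℂ) * F σ ∂surfaceMeasure‖
      ≤ 2 * Real.pi * ∫ θ in Ioc 0 (Real.pi / 2),
          c (Real.cos θ) * g (Real.cos θ) * Real.sin θ := by
  rw [← hc.integral_inner_mul he hg]
  refine norm_integral_le_of_norm_le ?_ (.of_forall fun σ => ?_)
  · refine (hc.integrable_inner he).mul_bdd (c := C) ?_ (.of_forall fun σ => ?_)
    · exact (hg.comp (by fun_prop)).aestronglyMeasurable
    · exact hgC _ (abs_inner_axis_le_one he σ)
  · rw [norm_mul, Complex.norm_real, Real.norm_of_nonneg (hc.nonneg _)]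
    exact mul_le_mul_of_nonneg_left (hF σ) (hc.nonneg _)

end AngularKernel

/-! ### The gain operator and its Lipschitz bounds -/

/-- The gain part of the Fourier-side collision operator. -/
noncomputable def gain (c : ℝ → ℝ) (φ χ : E3 → ℂ) (ξ : E3) : ℂ :=
  ∫ σ : S2, (c (inner ℝ (axis ξ) (σ : E3)) : ℂ) * (φ (xiPlus ξ σ) * χ (xiMinus ξ σ)) ∂surfaceMeasure

/-- The Fourier-side collision operator of an angular kernel with cutoff. -/
noncomputable def coll (c : ℝ → ℝ) (φ : E3 → ℂ) (ξ : E3) : ℂ :=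
  gain c φ φ ξ - mass c * φ ξ

theorem norm_mul_sub_mul_le {a b a' b' : ℂ} (ha' : ‖a'‖ ≤ 1) (hb : ‖b‖ ≤ 1) :
    ‖a * b - a' * b'‖ ≤ ‖a - a'‖ + ‖b - b'‖ := by
  have : a * b - a' * b' = (a - a') * b + a' * (b - b') := by ring
  rw [this]
  refine (norm_add_le _ _).trans ?_
  rw [norm_mul, norm_mul]
  have h1 := mul_le_of_le_one_right (norm_nonneg (a - a')) hb
  have h2 := mul_le_of_le_one_left (norm_nonneg (b - b')) ha'
  linarith

namespace AngularKernel

variable {c : ℝ → ℝ} {φ χ φ' χ' : E3 → ℂ}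

theorem integrable_gain (hc : AngularKernel c) (hφ : IsCharacteristic φ)
    (hχ : IsCharacteristic χ) (ξ : E3) :
    Integrable (fun σ : S2 => (c (inner ℝ (axis ξ) (σ : E3)) : ℂ) *
      (φ (xiPlus ξ σ) * χ (xiMinus ξ σ))) surfaceMeasure := by
  refine hc.integrable_mul (norm_axis ξ) (C := 1) ?_ fun σ => ?_
  · exact ((hφ.continuous.comp (continuous_xiPlus ξ)).mul
      (hχ.continuous.comp (continuous_xiMinus ξ))).aestronglyMeasurable
  · rw [norm_mul]
    exact mul_le_one₀ (hφ.norm_le_one _) (norm_nonneg _) (hχ.norm_le_one _)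

theorem gain_sub_gain (hc : AngularKernel c) (hφ : IsCharacteristic φ)
    (hχ : IsCharacteristic χ) (hφ' : IsCharacteristic φ') (hχ' : IsCharacteristic χ') (ξ : E3) :
    gain c φ χ ξ - gain c φ' χ' ξ = ∫ σ : S2, (c (inner ℝ (axis ξ) (σ : E3)) : ℂ) *
      (φ (xiPlus ξ σ) * χ (xiMinus ξ σ) - φ' (xiPlus ξ σ) * χ' (xiMinus ξ σ)) ∂surfaceMeasure := by
  unfold gain
  rw [← integral_sub (hc.integrable_gain hφ hχ ξ) (hc.integrable_gain hφ' hχ' ξ)]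
  congr 1; ext σ; ring

/-- A crude bound using only `|ξ^±| ≤ |ξ|`. It keeps the constants of the two arguments apart, as
the induction over the Wild terms requires. -/
theorem norm_gain_sub_le (hc : AngularKernel c) (hφ : IsCharacteristic φ)
    (hχ : IsCharacteristic χ) (hφ' : IsCharacteristic φ') (hχ' : IsCharacteristic χ')
    {α W W' : ℝ} (hα : 0 < α) (hW : 0 ≤ W) (hW' : 0 ≤ W') (h : ∀ ξ, ‖φ ξ - φ' ξ‖ ≤ W * ‖ξ‖ ^ α)
    (h' : ∀ ξ, ‖χ ξ - χ' ξ‖ ≤ W' * ‖ξ‖ ^ α) (ξ : E3) :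
    ‖gain c φ χ ξ - gain c φ' χ' ξ‖ ≤ mass c * (W + W') * ‖ξ‖ ^ α := by
  rw [hc.gain_sub_gain hφ hχ hφ' hχ']
  refine (hc.norm_integral_mul_le (norm_axis ξ) (g := fun _ => (W + W') * ‖ξ‖ ^ α)
    measurable_const (fun _ _ => le_rfl) fun σ => ?_).trans (le_of_eq ?_)
  · refine (norm_mul_sub_mul_le (hφ'.norm_le_one _) (hχ.norm_le_one _)).trans ?_
    rw [add_mul]
    refine add_le_add ((h _).trans ?_) ((h' _).trans ?_)
    · gcongr; exact norm_xiPlus_le ξ σ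
    · gcongr; exact norm_xiMinus_le ξ σ
  · rw [mass, mul_assoc _ (W + W'), mul_assoc (2 * Real.pi), ← integral_mul_const]
    congr 1
    refine integral_congr_ae (.of_forall fun θ => ?_)
    ring

end AngularKernel

theorem cos_half_mem {θ : ℝ} (h : θ ∈ Ioc 0 (Real.pi / 2)) : Real.cos (θ / 2) ∈ Ioc (0 : ℝ) 1 :=
  ⟨Real.cos_pos_of_mem_Ioo ⟨by linarith [h.1, Real.pi_pos], by linarith [h.2, Real.pi_pos]⟩,
    Real.cos_le_one _⟩

theorem sin_half_mem {θ : ℝ} (h : θ ∈ Ioc 0 (Real.pi / 2)) : Real.sin (θ / 2) ∈ Ioc (0 : ℝ) 1 :=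
  ⟨Real.sin_pos_of_pos_of_lt_pi (by linarith [h.1]) (by linarith [h.2, Real.pi_pos]),
    Real.sin_le_one _⟩

theorem sin_pos_of_mem {θ : ℝ} (h : θ ∈ Ioc 0 (Real.pi / 2)) : 0 < Real.sin θ :=
  Real.sin_pos_of_pos_of_lt_pi h.1 (by linarith [h.2, Real.pi_pos])

/-- Lowering the exponent from `2` to `α` increases powers of numbers in `(0, 1]`, and at exponent
`2` the expression is `0`. -/
theorem rate_factor_nonneg {α θ : ℝ} (hα : α ≤ 2) (h : θ ∈ Ioc 0 (Real.pi / 2)) :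
    0 ≤ Real.cos (θ / 2) ^ α + Real.sin (θ / 2) ^ α - 1 := by
  have h1 := Real.rpow_le_rpow_of_exponent_ge (cos_half_mem h).1 (cos_half_mem h).2 hα
  have h2 := Real.rpow_le_rpow_of_exponent_ge (sin_half_mem h).1 (sin_half_mem h).2 hα
  rw [Real.rpow_two] at h1 h2
  linarith [Real.sin_sq_add_cos_sq (θ / 2)]

/-- The `-1` absorbs the cosine term, which is why a finite moment of order `α` makes `λ_α` finite.
-/
theorem rate_factor_le {α θ : ℝ} (hα : 0 ≤ α) (h : θ ∈ Ioc 0 (Real.pi / 2)) :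
    Real.cos (θ / 2) ^ α + Real.sin (θ / 2) ^ α - 1 ≤ Real.sin (θ / 2) ^ α := by
  have := Real.rpow_le_one (cos_half_mem h).1.le (cos_half_mem h).2 hα
  linarith

theorem integrableOn_moment_mono {b : ℝ → ℝ} (hb : Measurable b) {α₀ α : ℝ} (h : α₀ ≤ α)
    (hint : IntegrableOn (fun θ => b (Real.cos θ) * Real.sin (θ / 2) ^ α₀ * Real.sin θ)
      (Ioc 0 (Real.pi / 2))) :
    IntegrableOn (fun θ => b (Real.cos θ) * Real.sin (θ / 2) ^ α * Real.sin θ)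
      (Ioc 0 (Real.pi / 2)) := by
  refine Integrable.mono hint (by fun_prop) ?_
  filter_upwards [ae_restrict_mem measurableSet_Ioc] with θ hθ
  have h1 := Real.rpow_le_rpow_of_exponent_ge (sin_half_mem hθ).1 (sin_half_mem hθ).2 h
  have h2 := Real.rpow_nonneg (sin_half_mem hθ).1.le α
  simp only [norm_mul]
  rw [Real.norm_of_nonneg h2, Real.norm_of_nonneg (h2.trans h1)]
  gcongr

theorem integrableOn_rateIntegrand {b : ℝ → ℝ} (hb : Measurable b) {α : ℝ} (hα : α ∈ Icc 0 2)
    (hint : IntegrableOn (fun θ => b (Real.cos θ) * Real.sin (θ / 2) ^ α * Real.sin θ)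
      (Ioc 0 (Real.pi / 2))) :
    IntegrableOn (rateIntegrand b α) (Ioc 0 (Real.pi / 2)) := by
  refine Integrable.mono hint (by unfold rateIntegrand; fun_prop) ?_
  filter_upwards [ae_restrict_mem measurableSet_Ioc] with θ hθ
  have h1 := rate_factor_nonneg hα.2 hθ
  have h2 := rate_factor_le hα.1 hθ
  simp only [rateIntegrand, norm_mul]
  rw [Real.norm_of_nonneg h1, Real.norm_of_nonneg (h1.trans h2)]
  gcongr

namespace AngularKernel

variable {c : ℝ → ℝ} {φ χ φ' χ' : E3 → ℂ}

theorem integrableOn_moment (hc : AngularKernel c) {α : ℝ} (hα : 0 ≤ α) :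
    IntegrableOn (fun θ => c (Real.cos θ) * Real.sin (θ / 2) ^ α * Real.sin θ)
      (Ioc 0 (Real.pi / 2)) :=
  integrableOn_moment_mono hc.measurable hα (by simpa using hc.integrable)

theorem rate_nonneg (hc : AngularKernel c) {α : ℝ} (hα : α ≤ 2) : 0 ≤ rate c α := by
  refine mul_nonneg (by positivity) (setIntegral_nonneg measurableSet_Ioc fun θ hθ => ?_)
  exact mul_nonneg (mul_nonneg (hc.nonneg _) (rate_factor_nonneg hα hθ)) (sin_pos_of_mem hθ).le

/-- The sharp bound: with the exact values of `|ξ^±|` the angular factor is `cos^α(θ/2) +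
sin^α(θ/2)`, which is `1` (contributing the mass) plus the factor in `λ_α`. -/
theorem norm_gain_sub_le_rate (hc : AngularKernel c) (hφ : IsCharacteristic φ)
    (hχ : IsCharacteristic χ) (hφ' : IsCharacteristic φ') (hχ' : IsCharacteristic χ')
    {α W : ℝ} (hα : α ∈ Ioc 0 2) (hW : 0 ≤ W) (h : ∀ ξ, ‖φ ξ - φ' ξ‖ ≤ W * ‖ξ‖ ^ α)
    (h' : ∀ ξ, ‖χ ξ - χ' ξ‖ ≤ W * ‖ξ‖ ^ α) (ξ : E3) :
    ‖gain c φ χ ξ - gain c φ' χ' ξ‖ ≤ (mass c + rate c α) * (W * ‖ξ‖ ^ α) := by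
  rw [hc.gain_sub_gain hφ hχ hφ' hχ']
  refine (hc.norm_integral_mul_le (norm_axis ξ) (C := (2 : ℝ) * (W * ‖ξ‖ ^ α))
    (g := fun τ => (√((1 + τ) / 2) ^ α + √((1 - τ) / 2) ^ α) * (W * ‖ξ‖ ^ α)) (by fun_prop)
    (fun τ hτ => ?_) fun σ => ?_).trans (le_of_eq ?_)
  · have h1 := Real.rpow_le_one (Real.sqrt_nonneg _) (sqrt_half_add_le_one hτ) hα.1.le
    have h2 := Real.rpow_le_one (Real.sqrt_nonneg _) (sqrt_half_sub_le_one hτ) hα.1.le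
    rw [abs_of_nonneg (by positivity)]
    gcongr
    linarith
  · refine (norm_mul_sub_mul_le (hφ'.norm_le_one _) (hχ.norm_le_one _)).trans ?_
    refine (add_le_add (h _) (h' _)).trans (le_of_eq ?_)
    rw [norm_xiPlus, norm_xiMinus, Real.mul_rpow (norm_nonneg _) (Real.sqrt_nonneg _),
      Real.mul_rpow (norm_nonneg _) (Real.sqrt_nonneg _)]
    ring
  · rw [mass, rate, ← mul_add, mul_assoc (2 * Real.pi), ← integral_add hc.integrable
      (integrableOn_rateIntegrand hc.measurable ⟨hα.1.le, hα.2⟩ (hc.integrableOn_moment hα.1.le)),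
      ← integral_mul_const]
    congr 1
    refine setIntegral_congr_fun measurableSet_Ioc fun θ hθ => ?_
    simp only [rateIntegrand, sqrt_half_add_cos hθ, sqrt_half_sub_cos hθ]
    ring

end AngularKernel

/-! ### Bobylev's identity -/

theorem integral_inner_swap {F : Type*} [NormedAddCommGroup F] [NormedSpace ℝ F] {e f : E3}
    (h : ‖e‖ = ‖f‖) (g : ℝ → ℝ → F) :
    ∫ σ : S2, g (inner ℝ e (σ : E3)) (inner ℝ f (σ : E3)) ∂surfaceMeasure
      = ∫ σ : S2, g (inner ℝ f (σ : E3)) (inner ℝ e (σ : E3)) ∂surfaceMeasure := by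
  obtain ⟨R, h1, h2, -⟩ := exists_isometry_swap h
  rw [← integral_sphereMap R]
  congr 1; ext σ
  have e1 : inner ℝ e (R (σ : E3)) = inner ℝ f (σ : E3) := by
    rw [← R.inner_map_map f, h2]
  have e2 : inner ℝ f (R (σ : E3)) = inner ℝ e (σ : E3) := by
    rw [← R.inner_map_map e, h1]
  rw [coe_sphereMap, e1, e2]

namespace AngularKernel

variable {c : ℝ → ℝ} {φ χ : E3 → ℂ}

/-- The post-collisional velocity, as a function of the two velocities and the unit vector. -/
noncomputable def postVelocity (x : (E3 × E3) × S2) : E3 :=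
  (1 / 2 : ℝ) • (x.1.1 + x.1.2) + (‖x.1.1 - x.1.2‖ / 2) • (x.2 : E3)

theorem measurable_postVelocity : Measurable postVelocity := by
  unfold postVelocity
  exact Continuous.measurable (by fun_prop)

theorem measurable_kernel_relative (hc : AngularKernel c) :
    Measurable fun x : (E3 × E3) × S2 => c (inner ℝ (axis (x.1.1 - x.1.2)) (x.2 : E3)) := by
  have h1 : Measurable fun x : (E3 × E3) × S2 => axis (x.1.1 - x.1.2) :=
    measurable_axis.comp ((measurable_fst.comp measurable_fst).sub
      (measurable_snd.comp measurable_fst))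
  have h2 : Measurable fun x : (E3 × E3) × S2 => (x.2 : E3) :=
    measurable_subtype_coe.comp measurable_snd
  have h3 : Measurable fun x : (E3 × E3) × S2 => inner ℝ (axis (x.1.1 - x.1.2)) (x.2 : E3) :=
    Measurable.inner h1 h2
  exact hc.measurable.comp h3

theorem integrable_kernel_relative (hc : AngularKernel c) (μ : Measure (E3 × E3))
    [IsProbabilityMeasure μ] :
    Integrable (fun x : (E3 × E3) × S2 => c (inner ℝ (axis (x.1.1 - x.1.2)) (x.2 : E3)))
      (μ.prod surfaceMeasure) := by
  have hm : AEStronglyMeasurable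
      (fun x : (E3 × E3) × S2 => c (inner ℝ (axis (x.1.1 - x.1.2)) (x.2 : E3)))
      (μ.prod surfaceMeasure) := hc.measurable_kernel_relative.aestronglyMeasurable
  rw [integrable_prod_iff hm]
  have hi : ∀ v : E3 × E3, Integrable
      (fun σ : S2 => c (inner ℝ (axis (v.1 - v.2)) (σ : E3))) surfaceMeasure :=
    fun _ => hc.integrable_inner (norm_axis _)
  refine ⟨.of_forall hi, ?_⟩
  have : ∀ v : E3 × E3, ∫ σ : S2, ‖c (inner ℝ (axis (v.1 - v.2)) (σ : E3))‖ ∂surfaceMeasure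
      = mass c := fun v => by
    simp_rw [Real.norm_of_nonneg (hc.nonneg _)]
    exact hc.integral_inner (norm_axis _)
  simp only [this]
  exact integrable_const _

theorem integral_kernel_relative (hc : AngularKernel c) (μ : Measure (E3 × E3))
    [IsProbabilityMeasure μ] :
    ∫ x : (E3 × E3) × S2, c (inner ℝ (axis (x.1.1 - x.1.2)) (x.2 : E3)) ∂(μ.prod surfaceMeasure)
      = mass c := by
  rw [integral_prod _ (hc.integrable_kernel_relative μ)]
  simp [hc.integral_inner (norm_axis _)]

/-- The phase depends on `σ` only through its component along `v - w`. In `exp_inner_postVelocity`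
the same formula appears with the axis of `ξ` instead, so exchanging the two axes matches the
Fourier side with the velocity side. -/
theorem exp_inner_mul (v w ξ : E3) (σ : S2) :
    Complex.exp ((inner ℝ v (xiPlus ξ σ) : ℝ) * Complex.I) *
      Complex.exp ((inner ℝ w (xiMinus ξ σ) : ℝ) * Complex.I)
    = Complex.exp ((inner ℝ ((1 / 2 : ℝ) • (v + w)) ξ : ℝ) * Complex.I) *
      Complex.exp ((‖ξ‖ * ‖v - w‖ / 2 * inner ℝ (axis (v - w)) (σ : E3) : ℝ) * Complex.I) := by
  rw [← Complex.exp_add, ← Complex.exp_add, ← add_mul, ← add_mul, ← Complex.ofReal_add,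
    ← Complex.ofReal_add]
  have h : ‖v - w‖ * inner ℝ (axis (v - w)) (σ : E3) = inner ℝ v (σ : E3) - inner ℝ w (σ : E3) := by
    rw [← real_inner_smul_left, norm_smul_axis, inner_sub_left]
  congr 3
  rw [show ‖ξ‖ * ‖v - w‖ / 2 * inner ℝ (axis (v - w)) (σ : E3)
    = ‖ξ‖ / 2 * (‖v - w‖ * inner ℝ (axis (v - w)) (σ : E3)) by ring, h]
  simp only [xiPlus, xiMinus, inner_add_right, inner_sub_right, real_inner_smul_right,
    real_inner_smul_left, inner_add_left]
  ring

theorem exp_inner_postVelocity (v w ξ : E3) (σ : S2) :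
    Complex.exp ((inner ℝ (postVelocity ((v, w), σ)) ξ : ℝ) * Complex.I)
    = Complex.exp ((inner ℝ ((1 / 2 : ℝ) • (v + w)) ξ : ℝ) * Complex.I) *
      Complex.exp ((‖ξ‖ * ‖v - w‖ / 2 * inner ℝ (axis ξ) (σ : E3) : ℝ) * Complex.I) := by
  rw [← Complex.exp_add, ← add_mul, ← Complex.ofReal_add]
  congr 3
  have h : ‖ξ‖ * inner ℝ (axis ξ) (σ : E3) = inner ℝ (σ : E3) ξ := by
    rw [← real_inner_smul_left, norm_smul_axis, real_inner_comm]
  rw [show ‖ξ‖ * ‖v - w‖ / 2 * inner ℝ (axis ξ) (σ : E3)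
    = ‖v - w‖ / 2 * (‖ξ‖ * inner ℝ (axis ξ) (σ : E3)) by ring, h, postVelocity, inner_add_left,
    real_inner_smul_left _ _ (‖v - w‖ / 2)]

/-- Bobylev's identity: the gain operator is the Fourier transform of a collision process. -/
theorem gain_charFun (hc : AngularKernel c) (μ ν : Measure E3) [IsProbabilityMeasure μ]
    [IsProbabilityMeasure ν] (ξ : E3) :
    gain c (charFun μ) (charFun ν) ξ
      = ∫ x : (E3 × E3) × S2, (c (inner ℝ (axis (x.1.1 - x.1.2)) (x.2 : E3)) : ℂ) *
          Complex.exp ((inner ℝ (postVelocity x) ξ : ℝ) * Complex.I)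
          ∂((μ.prod ν).prod surfaceMeasure) := by
  set E : E3 → E3 → ℂ := fun v ζ => Complex.exp ((inner ℝ v ζ : ℝ) * Complex.I) with hE
  have hnorm : ∀ v ζ, ‖E v ζ‖ = 1 := fun v ζ => Complex.norm_exp_ofReal_mul_I _
  have hmeas : Measurable fun x : (E3 × E3) × S2 => E x.1.1 (xiPlus ξ x.2) * E x.1.2 (xiMinus ξ x.2) := by
    simp only [hE, xiPlus, xiMinus]
    exact Continuous.measurable (by fun_prop)
  have hint : Integrable (fun x : (E3 × E3) × S2 => (c (inner ℝ (axis ξ) (x.2 : E3)) : ℂ) *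
      (E x.1.1 (xiPlus ξ x.2) * E x.1.2 (xiMinus ξ x.2))) ((μ.prod ν).prod surfaceMeasure) := by
    refine integrable_mul_bounded ?_ hmeas.aestronglyMeasurable (C := 1) fun x => ?_
    · exact (hc.integrable_inner (norm_axis ξ)).comp_snd _
    · rw [norm_mul, hnorm, hnorm, one_mul]
  have h1 : ∀ σ : S2, (c (inner ℝ (axis ξ) (σ : E3)) : ℂ) *
      (charFun μ (xiPlus ξ σ) * charFun ν (xiMinus ξ σ))
      = ∫ v : E3 × E3, (c (inner ℝ (axis ξ) (σ : E3)) : ℂ) *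
        (E v.1 (xiPlus ξ σ) * E v.2 (xiMinus ξ σ)) ∂(μ.prod ν) := fun σ => by
    rw [integral_const_mul]
    congr 1
    exact (integral_prod_mul (fun v => E v (xiPlus ξ σ)) (fun w => E w (xiMinus ξ σ))).symm
  -- For fixed velocities, an isometry exchanging the axes of `ξ` and `v - w` moves the kernel from
  -- one axis to the other.
  have h2 : ∀ v : E3 × E3, ∫ σ : S2, (c (inner ℝ (axis ξ) (σ : E3)) : ℂ) *
      (E v.1 (xiPlus ξ σ) * E v.2 (xiMinus ξ σ)) ∂surfaceMeasure
      = ∫ σ : S2, (c (inner ℝ (axis (v.1 - v.2)) (σ : E3)) : ℂ) *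
          E (postVelocity (v, σ)) ξ ∂surfaceMeasure := fun v => by
    obtain ⟨v, w⟩ := v
    simp only [hE, exp_inner_mul, exp_inner_postVelocity]
    exact integral_inner_swap ((norm_axis _).trans (norm_axis _).symm) fun a b => (c a : ℂ) *
      (Complex.exp ((inner ℝ ((1 / 2 : ℝ) • (v + w)) ξ : ℝ) * Complex.I) *
      Complex.exp ((‖ξ‖ * ‖v - w‖ / 2 * b : ℝ) * Complex.I))
  have hint' : Integrable (fun x : (E3 × E3) × S2 =>
      (c (inner ℝ (axis (x.1.1 - x.1.2)) (x.2 : E3)) : ℂ) * E (postVelocity x) ξ)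
      ((μ.prod ν).prod surfaceMeasure) := by
    refine integrable_mul_bounded (hc.integrable_kernel_relative _) ?_ (C := 1) fun x => (hnorm _ _).le
    have := measurable_postVelocity
    exact Measurable.aestronglyMeasurable (by fun_prop)
  rw [integral_prod _ hint']
  simp only [← h2]
  rw [integral_integral_swap hint]
  exact integral_congr_ae (.of_forall h1)

/-- By Bobylev's identity this is the transform of the law of the post-collisional velocity, when
the two velocities and the unit vector are drawn with density `c / mass c` relative to the product
measure. -/
theorem isCharacteristic_gain (hc : AngularKernel c) (hm : 0 < mass c) (hφ : IsCharacteristic φ)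
    (hχ : IsCharacteristic χ) :
    IsCharacteristic (fun ξ => ((mass c)⁻¹ : ℝ) * gain c φ χ ξ) := by
  obtain ⟨μ, hμ, rfl⟩ := isCharacteristic_iff_charFun.1 hφ
  obtain ⟨ν, hν, rfl⟩ := isCharacteristic_iff_charFun.1 hχ
  set d : (E3 × E3) × S2 → ℝ :=
    fun x => (mass c)⁻¹ * c (inner ℝ (axis (x.1.1 - x.1.2)) (x.2 : E3)) with hd
  have hdm : Measurable d := hc.measurable_kernel_relative.const_mul _
  have hd0 : ∀ x, 0 ≤ d x := fun x => mul_nonneg (inv_nonneg.2 hm.le) (hc.nonneg _)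
  have hdi : Integrable d ((μ.prod ν).prod surfaceMeasure) :=
    (hc.integrable_kernel_relative _).const_mul _
  set P := ((μ.prod ν).prod surfaceMeasure).withDensity fun x => ENNReal.ofReal (d x) with hP
  have hprob : IsProbabilityMeasure P := by
    constructor
    rw [hP, withDensity_apply _ MeasurableSet.univ, Measure.restrict_univ,
      ← ofReal_integral_eq_lintegral_ofReal hdi (.of_forall hd0), integral_const_mul,
      hc.integral_kernel_relative, inv_mul_cancel₀ hm.ne', ENNReal.ofReal_one]
  refine isCharacteristic_iff_charFun.2 ⟨P.map postVelocity,
    Measure.isProbabilityMeasure_map measurable_postVelocity.aemeasurable, funext fun ξ => ?_⟩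
  rw [charFun_apply, integral_map measurable_postVelocity.aemeasurable
    (Continuous.aestronglyMeasurable (by fun_prop)), hP,
    integral_withDensity_eq_integral_toReal_smul (by fun_prop) (by simp), hc.gain_charFun,
    ← integral_const_mul]
  refine integral_congr_ae (.of_forall fun x => ?_)
  simp only [ENNReal.toReal_ofReal (hd0 x)]
  simp only [hd, Complex.real_smul]
  push_cast
  ring

theorem gain_eq_zero (hc : AngularKernel c) (hm : mass c = 0) (ξ : E3) : gain c φ χ ξ = 0 := by
  have h0 : ∫ σ : S2, c (inner ℝ (axis ξ) (σ : E3)) ∂surfaceMeasure = 0 := by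
    rw [hc.integral_inner (norm_axis ξ), hm]
  rw [integral_eq_zero_iff_of_nonneg (fun σ => hc.nonneg _)
    (hc.integrable_inner (norm_axis ξ))] at h0
  refine integral_eq_zero_of_ae ?_
  filter_upwards [h0] with σ hσ
  simp only [Pi.zero_apply] at hσ ⊢
  rw [hσ]
  simp

/-- Although `axis` is discontinuous at the origin, continuity comes for free: the gain is a
multiple of a characteristic function. -/
theorem continuous_gain (hc : AngularKernel c) (hφ : IsCharacteristic φ)
    (hχ : IsCharacteristic χ) : Continuous (gain c φ χ) := by
  rcases hc.mass_nonneg.eq_or_lt with hm | hm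
  · exact continuous_const.congr fun ξ => (hc.gain_eq_zero hm.symm ξ).symm
  · have h := (hc.isCharacteristic_gain hm hφ hχ).continuous.const_smul (mass c)
    refine h.congr fun ξ => ?_
    rw [Pi.smul_apply, Complex.real_smul, ← mul_assoc, ← Complex.ofReal_mul, mul_inv_cancel₀ hm.ne']
    simp

theorem continuous_coll (hc : AngularKernel c) (hφ : IsCharacteristic φ) :
    Continuous (coll c φ) :=
  (hc.continuous_gain hφ hφ).sub (continuous_const.mul hφ.continuous)

/-- The collision operator as an absolutely convergent integral. -/
theorem coll_eq_integral (hc : AngularKernel c) (hφ : IsCharacteristic φ) (ξ : E3) :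
    coll c φ ξ = ∫ σ : S2, (c (inner ℝ (axis ξ) (σ : E3)) : ℂ) *
      (φ (xiPlus ξ σ) * φ (xiMinus ξ σ) - φ ξ) ∂surfaceMeasure := by
  have h : (mass c : ℂ) * φ ξ
      = ∫ σ : S2, (c (inner ℝ (axis ξ) (σ : E3)) : ℂ) * φ ξ ∂surfaceMeasure := by
    rw [integral_mul_const, ← hc.integral_inner (norm_axis ξ)]
    congr 1
    exact (integral_ofReal (𝕜 := ℂ)).symm
  have hi : Integrable (fun σ : S2 => (c (inner ℝ (axis ξ) (σ : E3)) : ℂ) * φ ξ) surfaceMeasure :=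
    ((hc.integrable_inner (norm_axis ξ)).ofReal (𝕜 := ℂ)).mul_const _
  rw [coll, h, gain, ← integral_sub (hc.integrable_gain hφ hφ ξ) hi]
  congr 1; ext σ; ring

end AngularKernel

/-! ### The cancellation estimate -/

/-- The pointwise cancellation behind the convergence of the collision integral: averaging over a
pair of unit vectors symmetric about the axis of `ξ` gains the full factor `sin^α (θ / 2)`. -/
theorem IsCharacteristic.norm_symmetrized_le {φ : E3 → ℂ} (hφ : IsCharacteristic φ) {α M : ℝ}
    (hα : 0 < α) (hM : ∀ ξ, ‖φ ξ - 1‖ ≤ M * ‖ξ‖ ^ α) {ξ : E3} {σ σ' : S2}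
    (h : (σ : E3) + σ' = (2 * inner ℝ (axis ξ) (σ : E3)) • axis ξ) :
    ‖(φ (xiPlus ξ σ) * φ (xiMinus ξ σ) - φ ξ) + (φ (xiPlus ξ σ') * φ (xiMinus ξ σ') - φ ξ)‖
      ≤ 10 * (M * ‖ξ‖ ^ α) * √((1 - inner ℝ (axis ξ) (σ : E3)) / 2) ^ α := by
  set τ := inner ℝ (axis ξ) (σ : E3) with hτ
  set s := √((1 - τ) / 2) with hs
  have hM0 : 0 ≤ M := by
    have := (norm_nonneg _).trans (hM (axis ξ))
    simpa [norm_axis] using this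
  have hτ1 : |τ| ≤ 1 := abs_inner_axis_le_one (norm_axis ξ) σ
  have hs0 : 0 ≤ s := Real.sqrt_nonneg _
  have hs1 : s ≤ 1 := sqrt_half_sub_le_one hτ1
  have hs2 : s ^ 2 = (1 - τ) / 2 := Real.sq_sqrt (by linarith [(abs_le.1 hτ1).2])
  have hτ' : inner ℝ (axis ξ) (σ' : E3) = τ := by
    have : inner ℝ (axis ξ) ((σ : E3) + σ') = 2 * τ := by
      rw [h, real_inner_smul_right, real_inner_self_eq_norm_sq, norm_axis]; ring
    rw [inner_add_right, ← hτ] at this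
    linarith
  set B := M * ‖ξ‖ ^ α * s ^ α with hB
  have hB0 : 0 ≤ B := by positivity
  have hminus : ∀ σ'' : S2, inner ℝ (axis ξ) (σ'' : E3) = τ → ‖φ (xiMinus ξ σ'') - 1‖ ≤ B := by
    intro σ'' h''
    refine (hM _).trans (le_of_eq ?_)
    rw [norm_xiMinus, h'', Real.mul_rpow (norm_nonneg _) hs0, hB]
    ring
  have hprod : ∀ σ'' : S2, inner ℝ (axis ξ) (σ'' : E3) = τ →
      ‖φ (xiPlus ξ σ'') * φ (xiMinus ξ σ'') - φ (xiPlus ξ σ'')‖ ≤ B := by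
    intro σ'' h''
    rw [show φ (xiPlus ξ σ'') * φ (xiMinus ξ σ'') - φ (xiPlus ξ σ'')
      = φ (xiPlus ξ σ'') * (φ (xiMinus ξ σ'') - 1) by ring, norm_mul]
    exact (mul_le_of_le_one_left (norm_nonneg _) (hφ.norm_le_one _)).trans (hminus σ'' h'')
  -- Here `s = sin(θ/2)`. The points `ξ⁺` for `σ` and `σ'` share the component `ζ` along the axis
  -- and have opposite components `±η` orthogonal to it.
  set ζ : E3 := (1 - s ^ 2) • ξ with hζ
  set η : E3 := (‖ξ‖ / 2) • ((σ : E3) - τ • axis ξ) with hη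
  have hξ : ∀ r : ℝ, r • ξ = (r * ‖ξ‖) • axis ξ := fun r => by
    rw [mul_smul, norm_smul_axis]
  have hσ' : (σ' : E3) = (2 * τ) • axis ξ - σ := by rw [← h]; abel
  have hplus : xiPlus ξ σ = ζ + η := by
    rw [xiPlus, hζ, hη, hs2, hξ, hξ (1 - (1 - τ) / 2)]
    module
  have hplus' : xiPlus ξ σ' = ζ - η := by
    rw [xiPlus, hζ, hη, hs2, hξ, hξ (1 - (1 - τ) / 2), hσ']
    module
  have hηn : ‖η‖ ≤ ‖ξ‖ * s := by
    refine abs_le_of_sq_le_sq' ?_ (by positivity) |>.2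
    rw [hη, norm_smul, mul_pow, norm_sub_sq_real, real_inner_smul_right, real_inner_comm, ← hτ,
      norm_smul, norm_axis, mul_pow, mul_pow ‖ξ‖ s, hs2]
    simp only [norm_div, Real.norm_ofNat, Real.norm_eq_abs, sq_abs, abs_norm]
    rw [show ‖(σ : E3)‖ = 1 by simp]
    have := (abs_le.1 hτ1).1
    have := (abs_le.1 hτ1).2
    have h3 : 0 ≤ ‖ξ‖ ^ 2 := by positivity
    have h4 : 0 ≤ (1 - τ) ^ 2 := by positivity
    nlinarith [mul_nonneg h3 h4]
  have hsecond : ‖φ (ζ + η) + φ (ζ - η) - 2 * φ ζ‖ ≤ 2 * B := by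
    refine (hφ.norm_second_difference_le ζ η).trans ?_
    gcongr
    refine (hM _).trans ?_
    rw [hB, mul_assoc, ← Real.mul_rpow (norm_nonneg _) hs0]
    gcongr
  have hdiff : ‖φ ξ - φ ζ‖ ≤ 3 * B := by
    rcases hs0.eq_or_lt with h0 | h0
    · have : ζ = ξ := by rw [hζ, ← h0]; simp
      rw [this, sub_self, norm_zero]
      positivity
    · have hsum : ζ + s ^ 2 • ξ = ξ := by rw [hζ]; module
      -- The increment `s²ξ` costs `M|ξ|^α s^{2α}`, so the weight `l = s^α` makes both Young terms
      -- at most `B`. The case `s = 0` is separate because `l` must be positive.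
      have key := hφ.norm_apply_add_sub_le ζ (s ^ 2 • ξ) (l := s ^ α) (by positivity)
      rw [hsum] at key
      have hy : ‖φ (s ^ 2 • ξ) - 1‖ ≤ B * s ^ α := by
        refine (hM _).trans (le_of_eq ?_)
        rw [norm_smul, Real.norm_of_nonneg (by positivity), Real.mul_rpow (by positivity)
          (norm_nonneg _), sq, Real.mul_rpow hs0 hs0, hB]
        ring
      have hx : ‖φ ζ - 1‖ ≤ M * ‖ξ‖ ^ α := by
        refine (hM _).trans ?_
        gcongr
        rw [hζ, norm_smul]
        refine mul_le_of_le_one_left (norm_nonneg _) ?_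
        rw [Real.norm_of_nonneg] <;> nlinarith
      have hsα : s ^ α ≤ 1 := Real.rpow_le_one hs0 hs1 hα.le
      have e1 : B * s ^ α ≤ B := mul_le_of_le_one_right hB0 hsα
      have e2 : s ^ α * ‖φ ζ - 1‖ ≤ B := by
        rw [hB, mul_comm (M * ‖ξ‖ ^ α)]
        gcongr
      have e3 : (s ^ α)⁻¹ * ‖φ (s ^ 2 • ξ) - 1‖ ≤ B := by
        rw [inv_mul_le_iff₀ (by positivity), mul_comm]
        exact hy
      linarith
  rw [← hplus, ← hplus'] at hsecond
  -- The constant `10` is `1 + 1` from replacing `φ(ξ⁻)` by `1`, plus `2` from the second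
  -- difference, plus `2 · 3` from moving `ζ` to `ξ`.
  have hdecomp : (φ (xiPlus ξ σ) * φ (xiMinus ξ σ) - φ ξ) +
      (φ (xiPlus ξ σ') * φ (xiMinus ξ σ') - φ ξ)
      = (φ (xiPlus ξ σ) * φ (xiMinus ξ σ) - φ (xiPlus ξ σ)) +
        (φ (xiPlus ξ σ') * φ (xiMinus ξ σ') - φ (xiPlus ξ σ')) +
        (φ (xiPlus ξ σ) + φ (xiPlus ξ σ') - 2 * φ ζ) - 2 * (φ ξ - φ ζ) := by ring
  rw [hdecomp]
  refine (norm_sub_le _ _).trans ?_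
  have h1 := norm_add₃_le (a := φ (xiPlus ξ σ) * φ (xiMinus ξ σ) - φ (xiPlus ξ σ))
    (b := φ (xiPlus ξ σ') * φ (xiMinus ξ σ') - φ (xiPlus ξ σ'))
    (c := φ (xiPlus ξ σ) + φ (xiPlus ξ σ') - 2 * φ ζ)
  have h2 := hprod σ rfl
  have h3 := hprod σ' hτ'
  rw [norm_mul, Complex.norm_ofNat, show 10 * (M * ‖ξ‖ ^ α) * s ^ α = 10 * B by rw [hB]; ring]
  linarith

/-- The collision operator is controlled by the `α`-moment of the kernel alone. -/
theorem AngularKernel.norm_coll_le {c : ℝ → ℝ} (hc : AngularKernel c) {φ : E3 → ℂ}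
    (hφ : IsCharacteristic φ) {α M : ℝ} (hα : 0 < α) (hM : ∀ ξ, ‖φ ξ - 1‖ ≤ M * ‖ξ‖ ^ α) (ξ : E3) :
    ‖coll c φ ξ‖ ≤ 5 * M * ‖ξ‖ ^ α * moment c α := by
  have hM0 : 0 ≤ M := by
    have := (norm_nonneg _).trans (hM (axis ξ))
    simpa [norm_axis] using this
  set F : S2 → ℂ := fun σ => φ (xiPlus ξ σ) * φ (xiMinus ξ σ) - φ ξ with hF
  have hFm : Continuous F := ((hφ.continuous.comp (continuous_xiPlus ξ)).mul
    (hφ.continuous.comp (continuous_xiMinus ξ))).sub continuous_const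
  have hFb : ∀ σ, ‖F σ‖ ≤ 2 := fun σ => by
    refine (norm_sub_le _ _).trans ?_
    rw [norm_mul]
    have := mul_le_one₀ (hφ.norm_le_one (xiPlus ξ σ)) (norm_nonneg _) (hφ.norm_le_one (xiMinus ξ σ))
    linarith [hφ.norm_le_one ξ]
  -- Reflection in the line of `ξ` preserves the surface measure and the deviation angle, so the
  -- integral equals its symmetrised form. Halving turns `10` into `5`.
  set R := (ℝ ∙ axis ξ).reflection
  have hR : ∀ x, R x = (2 * inner ℝ (axis ξ) x) • axis ξ - x := fun x => by
    rw [Submodule.reflection_singleton_apply, norm_axis]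
    simp [two_smul, two_mul, add_smul]
  have hinner : ∀ σ : S2, inner ℝ (axis ξ) (sphereMap R σ : E3) = inner ℝ (axis ξ) (σ : E3) :=
    fun σ => by
      rw [coe_sphereMap, hR, inner_sub_right, real_inner_smul_right, real_inner_self_eq_norm_sq,
        norm_axis]
      ring
  have h1 := hc.coll_eq_integral hφ ξ
  have h2 := h1
  rw [← integral_sphereMap R] at h2
  simp only [hinner] at h2
  have hi1 := hc.integrable_mul (norm_axis ξ) hFm.aestronglyMeasurable hFb
  have hi2 := hc.integrable_mul (norm_axis ξ) (F := fun σ => F (sphereMap R σ))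
    (hFm.comp (continuous_sphereMap R)).aestronglyMeasurable fun σ => hFb _
  have h3 : 2 * coll c φ ξ = ∫ σ : S2, (c (inner ℝ (axis ξ) (σ : E3)) : ℂ) *
      (F σ + F (sphereMap R σ)) ∂surfaceMeasure := by
    simp_rw [mul_add]
    rw [integral_add hi1 hi2, two_mul]
    exact congrArg₂ _ h1 h2
  have h4 : ‖2 * coll c φ ξ‖ ≤ 2 * Real.pi * ∫ θ in Ioc 0 (Real.pi / 2), c (Real.cos θ) *
      (10 * (M * ‖ξ‖ ^ α) * √((1 - Real.cos θ) / 2) ^ α) * Real.sin θ := by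
    rw [h3]
    refine hc.norm_integral_mul_le (norm_axis ξ) (C := 10 * (M * ‖ξ‖ ^ α))
      (g := fun τ => 10 * (M * ‖ξ‖ ^ α) * √((1 - τ) / 2) ^ α) (by fun_prop) (fun τ hτ => ?_)
      fun σ => ?_
    · rw [abs_of_nonneg (by positivity)]
      exact mul_le_of_le_one_right (by positivity)
        (Real.rpow_le_one (Real.sqrt_nonneg _) (sqrt_half_sub_le_one hτ) hα.le)
    · refine hφ.norm_symmetrized_le hα hM ?_
      rw [coe_sphereMap, hR]
      abel
  have h5 : ∫ θ in Ioc 0 (Real.pi / 2), c (Real.cos θ) *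
      (10 * (M * ‖ξ‖ ^ α) * √((1 - Real.cos θ) / 2) ^ α) * Real.sin θ
      = 10 * (M * ‖ξ‖ ^ α) * ∫ θ in Ioc 0 (Real.pi / 2),
        c (Real.cos θ) * (Real.sin (θ / 2) ^ α) * Real.sin θ := by
    rw [← integral_const_mul]
    refine setIntegral_congr_fun measurableSet_Ioc fun θ hθ => ?_
    simp only [sqrt_half_sub_cos hθ]
    ring
  rw [h5, norm_mul, Complex.norm_ofNat] at h4
  rw [moment]
  linarith

/-! ### Singular cross sections and their cutoffs -/

/-- An angular cross section, possibly singular at grazing collisions, with finite moment of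
order `α`. -/
structure CrossSection (b : ℝ → ℝ) (α : ℝ) : Prop where
  measurable : Measurable b
  nonneg : ∀ τ ∈ Ico (0 : ℝ) 1, 0 ≤ b τ
  pos : 0 < α
  integrable : IntegrableOn (fun θ => b (Real.cos θ) * Real.sin (θ / 2) ^ α * Real.sin θ)
    (Ioc 0 (Real.pi / 2))

/-- The cross section restricted to deviation angles at least `ε`. -/
noncomputable def cut (b : ℝ → ℝ) (ε τ : ℝ) : ℝ :=
  (Icc 0 (Real.cos ε)).indicator b τ

/-- The contribution to the `α`-moment of deviation angles at most `ε`. -/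
noncomputable def tail (b : ℝ → ℝ) (α ε : ℝ) : ℝ :=
  2 * Real.pi * ∫ θ in Ioc 0 ε, b (Real.cos θ) * Real.sin (θ / 2) ^ α * Real.sin θ

theorem coll_add {c d : ℝ → ℝ} (hc : AngularKernel c) (hd : AngularKernel d)
    (hcd : AngularKernel (fun τ => c τ + d τ)) {φ : E3 → ℂ} (hφ : IsCharacteristic φ) (ξ : E3) :
    coll (fun τ => c τ + d τ) φ ξ = coll c φ ξ + coll d φ ξ := by
  have hi : ∀ {c : ℝ → ℝ}, AngularKernel c → Integrable (fun σ : S2 =>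
      (c (inner ℝ (axis ξ) (σ : E3)) : ℂ) * (φ (xiPlus ξ σ) * φ (xiMinus ξ σ) - φ ξ))
      surfaceMeasure := fun hc => by
    simp_rw [mul_sub]
    exact (hc.integrable_gain hφ hφ ξ).sub
      (((hc.integrable_inner (norm_axis ξ)).ofReal (𝕜 := ℂ)).mul_const _)
  rw [hcd.coll_eq_integral hφ, hc.coll_eq_integral hφ, hd.coll_eq_integral hφ,
    ← integral_add (hi hc) (hi hd)]
  congr 1; ext σ
  push_cast
  ring

theorem cos_mem_Ico {θ : ℝ} (h : θ ∈ Ioc 0 (Real.pi / 2)) : Real.cos θ ∈ Ico (0 : ℝ) 1 := by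
  refine ⟨Real.cos_nonneg_of_mem_Icc ⟨by linarith [h.1, Real.pi_pos], h.2⟩, ?_⟩
  rw [← Real.cos_zero]
  exact Real.cos_lt_cos_of_nonneg_of_le_pi_div_two le_rfl h.2 h.1

namespace CrossSection

variable {b : ℝ → ℝ} {α ε ε' : ℝ} {φ : E3 → ℂ}

theorem integrand_nonneg (hb : CrossSection b α) {θ : ℝ} (h : θ ∈ Ioc 0 (Real.pi / 2)) :
    0 ≤ b (Real.cos θ) * Real.sin (θ / 2) ^ α * Real.sin θ :=
  mul_nonneg (mul_nonneg (hb.nonneg _ (cos_mem_Ico h))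
    (Real.rpow_nonneg (sin_half_mem h).1.le _)) (sin_pos_of_mem h).le

theorem cut_nonneg (hb : CrossSection b α) (hε : ε ∈ Ioc 0 (Real.pi / 2)) (τ : ℝ) :
    0 ≤ cut b ε τ :=
  indicator_nonneg (fun τ hτ => hb.nonneg τ ⟨hτ.1, hτ.2.trans_lt (cos_mem_Ico hε).2⟩) τ

theorem measurable_cut (hb : CrossSection b α) : Measurable (cut b ε) :=
  hb.measurable.indicator measurableSet_Icc

theorem cut_cos_le (hb : CrossSection b α) {θ : ℝ} (hθ : θ ∈ Ioc 0 (Real.pi / 2)) :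
    cut b ε (Real.cos θ) ≤ b (Real.cos θ) :=
  indicator_apply_le' (fun _ => le_rfl) fun _ => hb.nonneg _ (cos_mem_Ico hθ)

/-- On `θ ≥ ε` the weight `sin^α(θ/2)` is at least `sin^α(ε/2)`, so the finite moment forces finite
mass. -/
theorem angularKernel_cut (hb : CrossSection b α) (hε : ε ∈ Ioc 0 (Real.pi / 2)) :
    AngularKernel (cut b ε) := by
  refine ⟨hb.measurable_cut, hb.cut_nonneg hε, fun τ hτ => ?_, ?_⟩
  · exact indicator_of_notMem (fun h => hτ.not_ge h.1) _
  · have hs : 0 < Real.sin (ε / 2) ^ α := Real.rpow_pos_of_pos (sin_half_mem hε).1 _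
    refine Integrable.mono (hb.integrable.const_mul (Real.sin (ε / 2) ^ α)⁻¹)
      ((hb.measurable_cut.comp Real.measurable_cos).mul Real.measurable_sin).aestronglyMeasurable ?_
    filter_upwards [ae_restrict_mem measurableSet_Ioc] with θ hθ
    rw [Real.norm_of_nonneg (mul_nonneg (hb.cut_nonneg hε _) (sin_pos_of_mem hθ).le),
      Real.norm_of_nonneg (mul_nonneg (inv_nonneg.2 hs.le) (hb.integrand_nonneg hθ)),
      ← div_eq_inv_mul, le_div_iff₀ hs]
    by_cases h : Real.cos θ ∈ Icc 0 (Real.cos ε)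
    · rw [cut, indicator_of_mem h, mul_right_comm]
      have hle : ε ≤ θ := by
        by_contra! h'
        exact h.2.not_gt (Real.cos_lt_cos_of_nonneg_of_le_pi_div_two hθ.1.le hε.2 h')
      have h1 : Real.sin (ε / 2) ≤ Real.sin (θ / 2) :=
        Real.sin_le_sin_of_le_of_le_pi_div_two (by linarith [hε.1, Real.pi_pos])
          (by linarith [hθ.2, Real.pi_pos]) (by linarith)
      have h2 := hb.nonneg _ (cos_mem_Ico hθ)
      have h3 := (sin_half_mem hε).1.le
      have h4 := hb.pos.le
      have h5 := (sin_pos_of_mem hθ).le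
      gcongr
    · rw [cut, indicator_of_notMem h, zero_mul, zero_mul]
      exact hb.integrand_nonneg hθ

theorem cut_le_cut (hb : CrossSection b α) (hε' : 0 < ε') (h : ε' ≤ ε) (hε : ε ≤ Real.pi / 2)
    (τ : ℝ) : cut b ε τ ≤ cut b ε' τ := by
  have hcos := Real.cos_le_cos_of_nonneg_of_le_pi hε'.le (by linarith [Real.pi_pos]) h
  refine indicator_apply_le' (fun hτ => ?_) fun _ => hb.cut_nonneg ⟨hε', h.trans hε⟩ τ
  rw [cut, indicator_of_mem (Icc_subset_Icc le_rfl hcos hτ)]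

theorem angularKernel_cut_sub (hb : CrossSection b α) (hε' : 0 < ε') (h : ε' ≤ ε)
    (hε : ε ≤ Real.pi / 2) : AngularKernel (fun τ => cut b ε' τ - cut b ε τ) := by
  have h1 := hb.angularKernel_cut ⟨hε', h.trans hε⟩
  have h2 := hb.angularKernel_cut ⟨hε'.trans_le h, hε⟩
  refine ⟨h1.measurable.sub h2.measurable, fun τ => sub_nonneg.2 (hb.cut_le_cut hε' h hε τ),
    fun τ hτ => by rw [h1.support τ hτ, h2.support τ hτ, sub_zero], ?_⟩
  simp_rw [sub_mul]
  exact h1.integrable.sub h2.integrable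

/-- The two cutoffs agree for `θ > ε`, so only grazing angles contribute. The bound does not depend
on `ε'`. -/
theorem moment_cut_sub_le (hb : CrossSection b α) (hε' : 0 < ε') (h : ε' ≤ ε)
    (hε : ε ≤ Real.pi / 2) : moment (fun τ => cut b ε' τ - cut b ε τ) α ≤ tail b α ε := by
  refine mul_le_mul_of_nonneg_left ?_ (by positivity)
  have hsub : Ioc 0 ε ⊆ Ioc 0 (Real.pi / 2) := Ioc_subset_Ioc_right hε
  rw [setIntegral_eq_of_subset_of_forall_sdiff_eq_zero measurableSet_Ioc hsub]
  · refine setIntegral_mono_on ?_ (hb.integrable.mono_set hsub) measurableSet_Ioc fun θ hθ => ?_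
    · exact ((hb.angularKernel_cut_sub hε' h hε).integrableOn_moment hb.pos.le).mono_set hsub
    · have h0 := hb.cut_nonneg ⟨hε'.trans_le h, hε⟩ (Real.cos θ)
      have h1 := hb.cut_cos_le (ε := ε') (hsub hθ)
      have h2 := Real.rpow_nonneg (sin_half_mem (hsub hθ)).1.le α
      have h3 := (sin_pos_of_mem (hsub hθ)).le
      gcongr
      linarith
  · intro θ hθ
    have hlt : ε < θ := by
      by_contra! h'
      exact hθ.2 ⟨hθ.1.1, h'⟩
    have hm : ∀ δ, 0 < δ → δ ≤ ε → Real.cos θ ∈ Icc 0 (Real.cos δ) := fun δ h0 hδ =>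
      ⟨(cos_mem_Ico hθ.1).1, Real.cos_le_cos_of_nonneg_of_le_pi h0.le
        (by linarith [hθ.1.2, Real.pi_pos]) (hδ.trans hlt.le)⟩
    simp only [cut]
    rw [indicator_of_mem (hm ε' hε' h), indicator_of_mem (hm ε (hε'.trans_le h) le_rfl)]
    simp

theorem moment_cut_le (hb : CrossSection b α) (hε : ε ∈ Ioc 0 (Real.pi / 2)) :
    moment (cut b ε) α ≤ moment b α := by
  refine mul_le_mul_of_nonneg_left ?_ (by positivity)
  refine setIntegral_mono_on ((hb.angularKernel_cut hε).integrableOn_moment hb.pos.le)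
    hb.integrable measurableSet_Ioc fun θ hθ => ?_
  have h1 := hb.cut_cos_le (ε := ε) hθ
  have h2 := Real.rpow_nonneg (sin_half_mem hθ).1.le α
  have h3 := (sin_pos_of_mem hθ).le
  gcongr

theorem rate_cut_le (hb : CrossSection b α) (hα : α ≤ 2) (hε : ε ∈ Ioc 0 (Real.pi / 2)) :
    rate (cut b ε) α ≤ rate b α := by
  refine mul_le_mul_of_nonneg_left ?_ (by positivity)
  have hc := hb.angularKernel_cut hε
  refine setIntegral_mono_on (integrableOn_rateIntegrand hc.measurable ⟨hb.pos.le, hα⟩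
    (hc.integrableOn_moment hb.pos.le)) (integrableOn_rateIntegrand hb.measurable ⟨hb.pos.le, hα⟩
    hb.integrable) measurableSet_Ioc fun θ hθ => ?_
  have h1 := hb.cut_cos_le (ε := ε) hθ
  have h2 := rate_factor_nonneg hα hθ
  have h3 := (sin_pos_of_mem hθ).le
  unfold rateIntegrand
  gcongr

theorem tail_nonneg (hb : CrossSection b α) (hε : ε ≤ Real.pi / 2) : 0 ≤ tail b α ε :=
  mul_nonneg (by positivity) (setIntegral_nonneg measurableSet_Ioc fun θ hθ =>
    hb.integrand_nonneg ⟨hθ.1, hθ.2.trans hε⟩)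

theorem tendsto_tail (hb : CrossSection b α) : Tendsto (tail b α) (𝓝[>] 0) (𝓝 0) := by
  have hpi : 0 ≤ Real.pi / 2 := by positivity
  -- The tail is a primitive of an integrable function, hence continuous at `0`.
  have h := intervalIntegral.continuousOn_primitive (μ := volume) (a := 0) (b := Real.pi / 2)
    (f := fun θ => b (Real.cos θ) * Real.sin (θ / 2) ^ α * Real.sin θ)
    ((integrableOn_Icc_iff_integrableOn_Ioc).2 hb.integrable)
  have h0 := (h 0 ⟨le_rfl, hpi⟩).tendsto
  simp only [Ioc_self, Measure.restrict_empty, integral_zero_measure] at h0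
  have h1 : 𝓝[>] (0 : ℝ) ≤ 𝓝[Icc 0 (Real.pi / 2)] 0 := by
    rw [← nhdsWithin_Ioo_eq_nhdsGT (show (0 : ℝ) < Real.pi / 2 by positivity)]
    exact nhdsWithin_mono _ Ioo_subset_Icc_self
  have h2 := (h0.mono_left h1).const_mul (2 * Real.pi)
  rw [mul_zero] at h2
  exact h2

/-- The difference is itself the collision operator of the difference kernel, to which the
cancellation estimate applies. This replaces any bound by the mass, which may blow up as `ε' ↓ 0`.
-/
theorem norm_coll_cut_sub_le (hb : CrossSection b α) (hφ : IsCharacteristic φ) {M : ℝ}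
    (hM0 : 0 ≤ M) (hM : ∀ ξ, ‖φ ξ - 1‖ ≤ M * ‖ξ‖ ^ α) (hε' : 0 < ε') (h : ε' ≤ ε)
    (hε : ε ≤ Real.pi / 2) (ξ : E3) :
    ‖coll (cut b ε') φ ξ - coll (cut b ε) φ ξ‖ ≤ 5 * M * ‖ξ‖ ^ α * tail b α ε := by
  have h1 := hb.angularKernel_cut ⟨hε', h.trans hε⟩
  have h2 := hb.angularKernel_cut ⟨hε'.trans_le h, hε⟩
  have h3 := hb.angularKernel_cut_sub hε' h hε
  have heq : cut b ε' = fun τ => cut b ε τ + (cut b ε' τ - cut b ε τ) := by ext; ring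
  have hadd := coll_add h2 h3 (heq ▸ h1) hφ ξ
  rw [← heq] at hadd
  rw [hadd, add_sub_cancel_left]
  refine (h3.norm_coll_le hφ hb.pos hM ξ).trans ?_
  gcongr
  exact hb.moment_cut_sub_le hε' h hε

theorem norm_coll_cut_le (hb : CrossSection b α) (hφ : IsCharacteristic φ) {M : ℝ}
    (hM0 : 0 ≤ M) (hM : ∀ ξ, ‖φ ξ - 1‖ ≤ M * ‖ξ‖ ^ α) (hε : ε ∈ Ioc 0 (Real.pi / 2)) (ξ : E3) :
    ‖coll (cut b ε) φ ξ‖ ≤ 5 * M * ‖ξ‖ ^ α * moment b α := by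
  refine ((hb.angularKernel_cut hε).norm_coll_le hφ hb.pos hM ξ).trans ?_
  gcongr
  exact hb.moment_cut_le hε

end CrossSection

/-! ### The collision integral as a limit of cutoff operators -/

theorem cosDeviation_eq {ξ : E3} (hξ : ξ ≠ 0) (σ : S2) :
    cosDeviation ξ σ = inner ℝ (axis ξ) (σ : E3) := by
  rw [cosDeviation, axis, if_neg hξ, real_inner_smul_left, div_eq_inv_mul]

theorem measurableSet_angularRegion (ξ : E3) (ε : ℝ) : MeasurableSet (angularRegion ξ ε) := by
  have : Continuous (cosDeviation ξ) := by unfold cosDeviation; fun_prop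
  exact (measurableSet_le measurable_const this.measurable).inter
    (measurableSet_le this.measurable measurable_const)

/-- At `ξ = 0` the conventions differ (division by zero against a fixed axis), but both sides vanish
there since `φ(0) = 1`. -/
theorem indicator_collisionIntegrand {φ : E3 → ℂ} (hφ : φ 0 = 1) (b : ℝ → ℝ) (ε : ℝ) (ξ : E3) :
    (angularRegion ξ ε).indicator (collisionIntegrand b φ ξ)
      = fun σ : S2 => (cut b ε (inner ℝ (axis ξ) (σ : E3)) : ℂ) *
          (φ (xiPlus ξ σ) * φ (xiMinus ξ σ) - φ ξ) := by
  ext σ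
  rcases eq_or_ne ξ 0 with rfl | hξ
  · have h0 : collisionIntegrand b φ 0 = 0 := by
      ext σ; simp [collisionIntegrand, xiPlus, xiMinus]
    simp [h0, xiPlus, xiMinus, hφ]
  · by_cases h : σ ∈ angularRegion ξ ε
    · have h' : inner ℝ (axis ξ) (σ : E3) ∈ Icc 0 (Real.cos ε) := by
        rw [← cosDeviation_eq hξ]; exact h
      rw [indicator_of_mem h, cut, indicator_of_mem h', collisionIntegrand, hφ, mul_one,
        cosDeviation_eq hξ]
    · have h' : inner ℝ (axis ξ) (σ : E3) ∉ Icc 0 (Real.cos ε) := by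
        rw [← cosDeviation_eq hξ]; exact h
      rw [indicator_of_notMem h, cut, indicator_of_notMem h', Complex.ofReal_zero, zero_mul]

namespace CrossSection

variable {b : ℝ → ℝ} {α ε : ℝ} {φ : E3 → ℂ}

theorem setIntegral_collisionIntegrand (hb : CrossSection b α) (hφ : IsCharacteristic φ)
    (hε : ε ∈ Ioc 0 (Real.pi / 2)) (ξ : E3) :
    ∫ σ in angularRegion ξ ε, collisionIntegrand b φ ξ σ ∂surfaceMeasure
      = coll (cut b ε) φ ξ := by
  rw [← integral_indicator (measurableSet_angularRegion ξ ε),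
    indicator_collisionIntegrand hφ.apply_zero, (hb.angularKernel_cut hε).coll_eq_integral hφ]

theorem integrableOn_collisionIntegrand (hb : CrossSection b α) (hφ : IsCharacteristic φ)
    (hε : ε ∈ Ioc 0 (Real.pi / 2)) (ξ : E3) :
    IntegrableOn (collisionIntegrand b φ ξ) (angularRegion ξ ε) surfaceMeasure := by
  rw [← integrable_indicator_iff (measurableSet_angularRegion ξ ε),
    indicator_collisionIntegrand hφ.apply_zero]
  have hc := hb.angularKernel_cut hε
  simp_rw [mul_sub]
  exact (hc.integrable_gain hφ hφ ξ).sub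
    (((hc.integrable_inner (norm_axis ξ)).ofReal (𝕜 := ℂ)).mul_const _)

theorem tendsto_coll_cut (hb : CrossSection b α) (hφ : IsCharacteristic φ) {ξ : E3} {z : ℂ}
    (h : HasCollisionIntegral b φ ξ z) :
    Tendsto (fun ε => coll (cut b ε) φ ξ) (𝓝[>] 0) (𝓝 z) := by
  refine h.2.congr' ?_
  filter_upwards [Ioo_mem_nhdsGT (show (0 : ℝ) < Real.pi / 2 by positivity)] with ε hε
  exact hb.setIntegral_collisionIntegrand hφ (Ioo_subset_Ioc_self hε) ξ

/-- Let `ε' ↓ 0` in the Cauchy estimate. A solution for `b` thus solves the cutoff equation up to an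
error `O(|ξ|^α)` that vanishes with `ε`. -/
theorem norm_sub_coll_cut_le (hb : CrossSection b α) (hφ : IsCharacteristic φ) {M : ℝ}
    (hM0 : 0 ≤ M) (hM : ∀ ξ, ‖φ ξ - 1‖ ≤ M * ‖ξ‖ ^ α) {ξ : E3} {z : ℂ}
    (hz : HasCollisionIntegral b φ ξ z) (hε : ε ∈ Ioc 0 (Real.pi / 2)) :
    ‖z - coll (cut b ε) φ ξ‖ ≤ 5 * M * ‖ξ‖ ^ α * tail b α ε := by
  refine le_of_tendsto ((hb.tendsto_coll_cut hφ hz).sub_const _).norm ?_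
  filter_upwards [Ioo_mem_nhdsGT hε.1] with ε' hε'
  exact hb.norm_coll_cut_sub_le hφ hM0 hM hε'.1 hε'.2.le hε.2 ξ

theorem exists_hasCollisionIntegral (hb : CrossSection b α) (hφ : IsCharacteristic φ) {M : ℝ}
    (hM0 : 0 ≤ M) (hM : ∀ ξ, ‖φ ξ - 1‖ ≤ M * ‖ξ‖ ^ α) (ξ : E3) :
    ∃ z, HasCollisionIntegral b φ ξ z := by
  have hpi : (0 : ℝ) < Real.pi / 2 := by positivity
  have hcau : Cauchy (map (fun ε => coll (cut b ε) φ ξ) (𝓝[>] 0)) := by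
    refine Metric.cauchy_iff.2 ⟨inferInstance, fun r hr => ?_⟩
    have ht := hb.tendsto_tail.const_mul (5 * M * ‖ξ‖ ^ α)
    rw [mul_zero] at ht
    obtain ⟨δ, hδt, hδ⟩ := ((ht.eventually (gt_mem_nhds (half_pos hr))).and
      (Ioo_mem_nhdsGT hpi)).exists
    refine ⟨_, image_mem_map (Ioo_mem_nhdsGT hδ.1), ?_⟩
    rintro _ ⟨x, hx, rfl⟩ _ ⟨y, hy, rfl⟩
    have h1 := hb.norm_coll_cut_sub_le hφ hM0 hM hx.1 hx.2.le hδ.2.le ξ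
    have h2 := hb.norm_coll_cut_sub_le hφ hM0 hM hy.1 hy.2.le hδ.2.le ξ
    have h3 := dist_triangle_right (coll (cut b x) φ ξ) (coll (cut b y) φ ξ) (coll (cut b δ) φ ξ)
    rw [dist_eq_norm, dist_eq_norm, dist_eq_norm] at h3
    rw [dist_eq_norm]
    linarith
  obtain ⟨z, hz⟩ := CompleteSpace.complete hcau
  refine ⟨z, fun ε hε => hb.integrableOn_collisionIntegrand hφ (Ioo_subset_Ioc_self hε) ξ, ?_⟩
  refine Tendsto.congr' ?_ (show Tendsto _ _ _ from hz)
  filter_upwards [Ioo_mem_nhdsGT hpi] with ε hε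
  exact (hb.setIntegral_collisionIntegrand hφ (Ioo_subset_Ioc_self hε) ξ).symm

end CrossSection

/-! ### The metric of `𝒦^α` and continuous curves -/

theorem distK_le_ofReal {α A : ℝ} {φ χ : E3 → ℂ} (h : ∀ ξ, ‖φ ξ - χ ξ‖ ≤ A * ‖ξ‖ ^ α) :
    distK α φ χ ≤ ENNReal.ofReal A := by
  refine iSup₂_le fun ξ hξ => ENNReal.ofReal_le_ofReal ?_
  rw [div_le_iff₀ (Real.rpow_pos_of_pos (norm_pos_iff.2 hξ) _)]
  exact h ξ

theorem norm_sub_le_toReal_distK {α : ℝ} {φ χ : E3 → ℂ} (h0 : φ 0 = χ 0)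
    (h : distK α φ χ < ⊤) (ξ : E3) : ‖φ ξ - χ ξ‖ ≤ (distK α φ χ).toReal * ‖ξ‖ ^ α := by
  rcases eq_or_ne ξ 0 with rfl | hξ
  · rw [h0, sub_self, norm_zero]
    positivity
  · rw [← div_le_iff₀ (Real.rpow_pos_of_pos (norm_pos_iff.2 hξ) _),
      ← ENNReal.ofReal_le_iff_le_toReal h.ne]
    exact le_iSup₂ (f := fun (ξ : E3) (_ : ξ ≠ 0) => ENNReal.ofReal (‖φ ξ - χ ξ‖ / ‖ξ‖ ^ α)) ξ hξ

theorem distK_comm (α : ℝ) (φ χ : E3 → ℂ) : distK α φ χ = distK α χ φ := by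
  simp only [distK, norm_sub_rev]

theorem distK_self (α : ℝ) (φ : E3 → ℂ) : distK α φ φ = 0 := by
  simp [distK]

theorem distK_triangle (α : ℝ) (φ χ ψ : E3 → ℂ) :
    distK α φ ψ ≤ distK α φ χ + distK α χ ψ := by
  refine iSup₂_le fun ξ hξ => ?_
  have h1 := le_iSup₂ (f := fun (ξ : E3) (_ : ξ ≠ 0) => ENNReal.ofReal (‖φ ξ - χ ξ‖ / ‖ξ‖ ^ α)) ξ hξ
  have h2 := le_iSup₂ (f := fun (ξ : E3) (_ : ξ ≠ 0) => ENNReal.ofReal (‖χ ξ - ψ ξ‖ / ‖ξ‖ ^ α)) ξ hξ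
  refine le_trans ?_ (add_le_add h1 h2)
  rw [← ENNReal.ofReal_add (by positivity) (by positivity), ← add_div]
  gcongr
  exact norm_sub_le_norm_sub_add_norm_sub _ _ _

theorem distK_lt_top {α : ℝ} {φ χ : E3 → ℂ} (hφ : φ ∈ K α) (hχ : χ ∈ K α) : distK α φ χ < ⊤ :=
  (distK_triangle α φ (fun _ => 1) χ).trans_lt
    (ENNReal.add_lt_top.2 ⟨hφ.2, distK_comm α χ _ ▸ hχ.2⟩)

theorem mem_K_of_le {α A : ℝ} {φ : E3 → ℂ} (hφ : IsCharacteristic φ)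
    (h : ∀ ξ, ‖φ ξ - 1‖ ≤ A * ‖ξ‖ ^ α) : φ ∈ K α :=
  ⟨hφ, (distK_le_ofReal h).trans_lt ENNReal.ofReal_lt_top⟩

theorem one_mem_K (α : ℝ) : (fun _ => 1 : E3 → ℂ) ∈ K α :=
  ⟨IsCharacteristic.one, by simp [distK_self]⟩

/-- The real-valued distance of `𝒦^α`. -/
noncomputable def distR (α : ℝ) (φ χ : E3 → ℂ) : ℝ := (distK α φ χ).toReal

theorem distR_nonneg (α : ℝ) (φ χ : E3 → ℂ) : 0 ≤ distR α φ χ := ENNReal.toReal_nonneg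

theorem distR_comm (α : ℝ) (φ χ : E3 → ℂ) : distR α φ χ = distR α χ φ := by
  rw [distR, distK_comm, distR]

theorem norm_sub_le_distR {α : ℝ} {φ χ : E3 → ℂ} (hφ : φ ∈ K α) (hχ : χ ∈ K α) (ξ : E3) :
    ‖φ ξ - χ ξ‖ ≤ distR α φ χ * ‖ξ‖ ^ α :=
  norm_sub_le_toReal_distK (by rw [hφ.1.apply_zero, hχ.1.apply_zero]) (distK_lt_top hφ hχ) ξ

theorem distR_le {α A : ℝ} {φ χ : E3 → ℂ} (hA : 0 ≤ A) (h : ∀ ξ, ‖φ ξ - χ ξ‖ ≤ A * ‖ξ‖ ^ α) :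
    distR α φ χ ≤ A :=
  ENNReal.toReal_le_of_le_ofReal hA (distK_le_ofReal h)

theorem distR_triangle {α : ℝ} {φ χ ψ : E3 → ℂ} (hφ : φ ∈ K α) (hχ : χ ∈ K α) (hψ : ψ ∈ K α) :
    distR α φ ψ ≤ distR α φ χ + distR α χ ψ := by
  rw [distR, distR, distR, ← ENNReal.toReal_add (distK_lt_top hφ hχ).ne (distK_lt_top hχ hψ).ne]
  exact ENNReal.toReal_mono (ENNReal.add_lt_top.2 ⟨distK_lt_top hφ hχ, distK_lt_top hχ hψ⟩).ne
    (distK_triangle _ _ _ _)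

theorem ContinuousInK.tendsto_distR {α : ℝ} {ψ : ℝ → E3 → ℂ} (h : ContinuousInK α ψ) {t₀ : ℝ}
    (ht₀ : 0 ≤ t₀) : Tendsto (fun t => distR α (ψ t) (ψ t₀)) (𝓝[Ici 0] t₀) (𝓝 0) := by
  exact (ENNReal.tendsto_toReal ENNReal.zero_ne_top).comp (h.2 t₀ ht₀)

theorem ContinuousInK.continuousOn_distR {α : ℝ} {ψ φ : ℝ → E3 → ℂ} (hψ : ContinuousInK α ψ)
    (hφ : ContinuousInK α φ) : ContinuousOn (fun t => distR α (ψ t) (φ t)) (Ici 0) := by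
  intro t₀ ht₀
  have hlim := (hψ.tendsto_distR ht₀).add (hφ.tendsto_distR ht₀)
  rw [add_zero] at hlim
  rw [ContinuousWithinAt, tendsto_iff_dist_tendsto_zero]
  refine squeeze_zero' (.of_forall fun _ => dist_nonneg) ?_ hlim
  filter_upwards [self_mem_nhdsWithin] with t ht
  have a := hψ.1 t ht
  have a₀ := hψ.1 t₀ ht₀
  have b := hφ.1 t ht
  have b₀ := hφ.1 t₀ ht₀
  have h1 := distR_triangle a a₀ b
  have h2 := distR_triangle a₀ b₀ b
  have h3 := distR_triangle a₀ a b₀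
  have h4 := distR_triangle a b b₀
  rw [distR_comm α (φ t₀) (φ t)] at h2
  rw [distR_comm α (ψ t₀) (ψ t)] at h3
  rw [Real.dist_eq, abs_le]
  constructor <;> linarith

theorem continuousInK_of_lipschitz {α : ℝ} {ψ : ℝ → E3 → ℂ} (hψ : ∀ t, 0 ≤ t → ψ t ∈ K α)
    (hlip : ∀ T, ∃ C, ∀ s ∈ Icc 0 T, ∀ t ∈ Icc 0 T, ∀ ξ,
      ‖ψ s ξ - ψ t ξ‖ ≤ C * |s - t| * ‖ξ‖ ^ α) : ContinuousInK α ψ := by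
  refine ⟨hψ, fun t₀ ht₀ => ?_⟩
  obtain ⟨C, hC⟩ := hlip (t₀ + 1)
  have hlim : Tendsto (fun t : ℝ => ENNReal.ofReal (C * |t - t₀|)) (𝓝[Ici 0] t₀) (𝓝 0) := by
    have : Continuous fun t : ℝ => ENNReal.ofReal (C * |t - t₀|) :=
      ENNReal.continuous_ofReal.comp (by fun_prop)
    simpa using (this.tendsto t₀).mono_left nhdsWithin_le_nhds
  refine tendsto_of_tendsto_of_tendsto_of_le_of_le' tendsto_const_nhds hlim
    (.of_forall fun _ => zero_le) ?_
  filter_upwards [self_mem_nhdsWithin, mem_nhdsWithin_of_mem_nhds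
    (Iio_mem_nhds (lt_add_one t₀))] with t ht ht'
  exact distK_le_ofReal fun ξ => hC t ⟨ht, ht'.le⟩ t₀ ⟨ht₀, by linarith⟩ ξ

theorem ContinuousInK.exists_bound {α : ℝ} {ψ : ℝ → E3 → ℂ} (hψ : ContinuousInK α ψ) (T : ℝ) :
    ∃ M, 0 ≤ M ∧ ∀ t ∈ Icc 0 T, ∀ ξ, ‖ψ t ξ - 1‖ ≤ M * ‖ξ‖ ^ α := by
  have hone : ContinuousInK α (fun _ _ => 1) :=
    ⟨fun _ _ => one_mem_K α, fun _ _ => by simp [distK_self, tendsto_const_nhds]⟩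
  obtain ⟨M, hM⟩ := isCompact_Icc.bddAbove_image
    ((hψ.continuousOn_distR hone).mono (show Icc 0 T ⊆ Ici 0 from Icc_subset_Ici_self))
  refine ⟨max M 0, le_max_right _ _, fun t ht ξ => ?_⟩
  refine (norm_sub_le_distR (hψ.1 t ht.1) (one_mem_K α) ξ).trans ?_
  gcongr
  exact (hM ⟨t, ht, rfl⟩).trans (le_max_left _ _)

/-- For `|ξ| ≤ R` the `α`-distance dominates; for `|ξ| ≥ R` the trivial bound `2` does, at cost
`2R^{-α₀}`. Choosing `R` large first and then the `α`-distance small gives continuity. -/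
theorem ContinuousInK.mono {α₀ α : ℝ} (h0 : 0 < α₀) (h : α₀ ≤ α) {ψ : ℝ → E3 → ℂ}
    (hψ : ContinuousInK α ψ) : ContinuousInK α₀ ψ := by
  have key : ∀ {A : ℝ}, 0 ≤ A → ∀ {φ χ : E3 → ℂ}, IsCharacteristic φ → IsCharacteristic χ →
      (∀ ξ, ‖φ ξ - χ ξ‖ ≤ A * ‖ξ‖ ^ α) → ∀ {R : ℝ}, 0 < R → ∀ ξ : E3,
      ‖φ ξ - χ ξ‖ ≤ (A * R ^ (α - α₀) + 2 * R⁻¹ ^ α₀) * ‖ξ‖ ^ α₀ := by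
    intro A hA φ χ hφ hχ hA' R hR ξ
    rcases le_total ‖ξ‖ R with hξ | hξ
    · rcases (norm_nonneg ξ).eq_or_lt with hz | hz
      · have h1 := hA' ξ
        rw [← hz, Real.zero_rpow (h0.trans_le h).ne', mul_zero] at h1
        exact h1.trans (by positivity)
      · refine (hA' ξ).trans ?_
        have : ‖ξ‖ ^ α = ‖ξ‖ ^ (α - α₀) * ‖ξ‖ ^ α₀ := by
          rw [← Real.rpow_add hz]; ring_nf
        rw [this, ← mul_assoc]
        have h2 : ‖ξ‖ ^ (α - α₀) ≤ R ^ (α - α₀) :=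
          Real.rpow_le_rpow hz.le hξ (sub_nonneg.2 h)
        gcongr
        exact le_add_of_le_of_nonneg (by gcongr) (by positivity)
    · have h1 : ‖φ ξ - χ ξ‖ ≤ 2 := (norm_sub_le _ _).trans
        (by linarith [hφ.norm_le_one ξ, hχ.norm_le_one ξ])
      have h2 : 1 ≤ R⁻¹ ^ α₀ * ‖ξ‖ ^ α₀ := by
        rw [← Real.mul_rpow (by positivity) (norm_nonneg _)]
        refine Real.one_le_rpow ?_ h0.le
        rw [← div_eq_inv_mul, one_le_div hR]
        exact hξ
      rw [add_mul]
      have h3 : 0 ≤ A * R ^ (α - α₀) * ‖ξ‖ ^ α₀ := by positivity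
      nlinarith
  refine ⟨fun t ht => ?_, fun t₀ ht₀ => ?_⟩
  · have hK := hψ.1 t ht
    exact mem_K_of_le hK.1 (key (distR_nonneg _ _ _) hK.1 IsCharacteristic.one
      (norm_sub_le_distR hK (one_mem_K α)) one_pos)
  · rw [ENNReal.tendsto_nhds_zero]
    intro r hr
    obtain ⟨r', hr'0, hr'⟩ := ENNReal.lt_iff_exists_nnreal_btwn.1 hr
    have hr0 : 0 < (r' : ℝ) := by exact_mod_cast hr'0
    obtain ⟨R, hR, hRr⟩ : ∃ R : ℝ, 0 < R ∧ 2 * R⁻¹ ^ α₀ ≤ r' / 2 := by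
      -- This `R` solves `2R^{-α₀} = r'/2`.
      refine ⟨((r' : ℝ) / 4) ^ (-α₀⁻¹), by positivity, ?_⟩
      rw [← Real.rpow_neg_one, ← Real.rpow_mul (by positivity), ← Real.rpow_mul (by positivity)]
      have : -α₀⁻¹ * (-1 * α₀) = 1 := by field_simp
      rw [this, Real.rpow_one]
      linarith
    have hlim := (hψ.tendsto_distR ht₀).mul_const (R ^ (α - α₀))
    rw [zero_mul] at hlim
    filter_upwards [hlim.eventually (gt_mem_nhds (half_pos hr0)), self_mem_nhdsWithin] with t h1 ht
    have a := hψ.1 t ht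
    have a₀ := hψ.1 t₀ ht₀
    refine (distK_le_ofReal (key (distR_nonneg _ _ _) a.1 a₀.1 (norm_sub_le_distR a a₀) hR)).trans ?_
    refine le_trans ?_ hr'.le
    rw [← ENNReal.ofReal_coe_nnreal]
    exact ENNReal.ofReal_le_ofReal (by linarith)

/-! ### The stability inequality -/

/-- Gronwall comparison of two curves whose velocities differ, up to an error `δ |ξ|^α`, as under
the collision operator of an angular kernel with cutoff. -/
theorem AngularKernel.distR_le_of_deriv {c : ℝ → ℝ} (hc : AngularKernel c) {α T δ : ℝ}
    (hα : α ∈ Ioc (0 : ℝ) 2) (hδ : 0 ≤ δ) {ψ φ p q : ℝ → E3 → ℂ}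
    (hψ : ∀ t ∈ Icc 0 T, ψ t ∈ K α) (hφ : ∀ t ∈ Icc 0 T, φ t ∈ K α)
    (hW : ContinuousOn (fun t => distR α (ψ t) (φ t)) (Icc 0 T))
    (hp : ∀ ξ, ∀ t ∈ Icc 0 T, HasDerivWithinAt (fun s => ψ s ξ) (p t ξ) (Ici 0) t)
    (hq : ∀ ξ, ∀ t ∈ Icc 0 T, HasDerivWithinAt (fun s => φ s ξ) (q t ξ) (Ici 0) t)
    (hpq : ∀ ξ, ∀ t ∈ Icc 0 T,
      ‖(p t ξ - q t ξ) - (coll c (ψ t) ξ - coll c (φ t) ξ)‖ ≤ δ * ‖ξ‖ ^ α) :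
    ∀ t ∈ Icc 0 T,
      distR α (ψ t) (φ t) ≤ Real.exp (rate c α * t) * (distR α (ψ 0) (φ 0) + δ * t) := by
  intro t₁ ht₁
  have hT : 0 ≤ T := ht₁.1.trans ht₁.2
  set m := mass c with hm
  set l := rate c α with hl
  have hm0 : 0 ≤ m := hc.mass_nonneg
  have hl0 : 0 ≤ l := hc.rate_nonneg hα.2
  -- Extending the distance by constants outside `[0, T]` makes `u` continuous on `ℝ`, so `U` is
  -- differentiable everywhere.
  set W : ℝ → ℝ := IccExtend hT ((Icc 0 T).domRestrict fun t => distR α (ψ t) (φ t)) with hWdef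
  have hWc : Continuous W := (continuousOn_iff_continuous_domRestrict.1 hW).Icc_extend'
  have hWeq : ∀ t ∈ Icc 0 T, W t = distR α (ψ t) (φ t) := fun t ht => by
    rw [hWdef, IccExtend_of_mem _ _ ht]; rfl
  set u : ℝ → ℝ := fun t => Real.exp (m * t) * ((m + l) * W t + δ) with hu
  have huc : Continuous u := by fun_prop
  set U : ℝ → ℝ := fun t => distR α (ψ 0) (φ 0) + ∫ s in (0 : ℝ)..t, u s with hU
  have hU' : ∀ t, HasDerivAt U (u t) t := fun t =>
    (intervalIntegral.integral_hasDerivAt_right (huc.intervalIntegrable _ _)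
      (huc.stronglyMeasurableAtFilter _ _) huc.continuousAt).const_add _
  have h0T : (0 : ℝ) ∈ Icc 0 T := ⟨le_rfl, hT⟩
  -- The factor `exp(mt)` removes the loss term. The remaining velocity is gain difference plus
  -- error, bounded by `|ξ|^α u(t)`, with `U` as a primitive of `u`.
  have hpt : ∀ ξ, ∀ t ∈ Icc 0 T, ‖Real.exp (m * t) • (ψ t ξ - φ t ξ)‖ ≤ ‖ξ‖ ^ α * U t := by
    intro ξ
    have hd : ∀ t ∈ Icc 0 T, HasDerivWithinAt (fun s => Real.exp (m * s) • (ψ s ξ - φ s ξ))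
        (Real.exp (m * t) • (m * (ψ t ξ - φ t ξ) + (p t ξ - q t ξ))) (Ici 0) t := by
      intro t ht
      have he : HasDerivWithinAt (fun s => Real.exp (m * s)) (Real.exp (m * t) * m) (Ici 0) t := by
        have := ((hasDerivAt_id t).const_mul m).exp
        simpa using this.hasDerivWithinAt
      have := he.smul ((hp ξ t ht).sub (hq ξ t ht))
      refine this.congr_deriv ?_
      simp only [Complex.real_smul, Pi.sub_apply]
      push_cast
      ring
    refine image_norm_le_of_norm_deriv_right_le_deriv_boundary (B := fun t => ‖ξ‖ ^ α * U t)
      (B' := fun t => ‖ξ‖ ^ α * u t)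
      (fun t ht => ((hd t ht).continuousWithinAt).mono Icc_subset_Ici_self)
      (fun t ht => (hd t (Ico_subset_Icc_self ht)).mono (Ici_subset_Ici.2 ht.1)) ?_
      (fun t => (hU' t).const_mul _) fun t ht => ?_
    · simpa [hU, mul_comm] using norm_sub_le_distR (hψ 0 h0T) (hφ 0 h0T) ξ
    · have ht := Ico_subset_Icc_self ht
      have hWn : 0 ≤ W t := by rw [hWeq t ht]; exact distR_nonneg _ _ _
      have hdist : ∀ ζ, ‖ψ t ζ - φ t ζ‖ ≤ W t * ‖ζ‖ ^ α := fun ζ => by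
        rw [hWeq t ht]; exact norm_sub_le_distR (hψ t ht) (hφ t ht) ζ
      have hg := hc.norm_gain_sub_le_rate (hψ t ht).1 (hψ t ht).1 (hφ t ht).1 (hφ t ht).1 hα hWn
        hdist hdist ξ
      have hdec : m * (ψ t ξ - φ t ξ) + (p t ξ - q t ξ)
          = (gain c (ψ t) (ψ t) ξ - gain c (φ t) (φ t) ξ) +
            ((p t ξ - q t ξ) - (coll c (ψ t) ξ - coll c (φ t) ξ)) := by
        rw [coll, coll]; ring
      rw [norm_smul, Real.norm_of_nonneg (Real.exp_pos _).le, hdec, hu]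
      have hn := (norm_add_le _ _).trans (add_le_add hg (hpq ξ t ht))
      calc _ ≤ Real.exp (m * t) * ((m + l) * (W t * ‖ξ‖ ^ α) + δ * ‖ξ‖ ^ α) := by gcongr
        _ = _ := by ring
  have hUn : ∀ t ∈ Icc 0 T, 0 ≤ U t := fun t ht => by
    have := (norm_nonneg _).trans (hpt (axis 0) t ht)
    simpa [norm_axis] using this
  -- The supremum over `ξ` closes the loop: `u` is built from `W`, so `U' ≤ (m + l)U + δ exp(mt)`.
  have hWU : ∀ t ∈ Icc 0 T, Real.exp (m * t) * W t ≤ U t := by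
    intro t ht
    rw [← le_div_iff₀' (Real.exp_pos _), hWeq t ht]
    refine distR_le (div_nonneg (hUn t ht) (Real.exp_pos _).le) fun ξ => ?_
    have := hpt ξ t ht
    rw [norm_smul, Real.norm_of_nonneg (Real.exp_pos _).le] at this
    rw [div_mul_eq_mul_div, le_div_iff₀' (Real.exp_pos _), mul_comm (U t)]
    exact this
  -- Gronwall's function. It decreases because `exp(-(m + l)t) exp(mt) ≤ 1`, which uses `l ≥ 0`.
  -- Undoing the factor `exp(mt)` then cancels `m` and leaves only the rate.
  set G : ℝ → ℝ := fun t => Real.exp (-(m + l) * t) * U t - δ * t with hG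
  have hG' : ∀ t, HasDerivAt G
      (Real.exp (-(m + l) * t) * (u t - (m + l) * U t) - δ) t := by
    intro t
    have he : HasDerivAt (fun s => Real.exp (-(m + l) * s))
        (Real.exp (-(m + l) * t) * -(m + l)) t := by
      simpa using ((hasDerivAt_id t).const_mul (-(m + l))).exp
    refine ((he.mul (hU' t)).sub ((hasDerivAt_id t).const_mul δ)).congr_deriv ?_
    ring
  have hanti : AntitoneOn G (Icc 0 T) := by
    refine antitoneOn_of_deriv_nonpos (convex_Icc 0 T)
      (fun t _ => (hG' t).continuousAt.continuousWithinAt)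
      (fun t _ => (hG' t).differentiableAt.differentiableWithinAt) fun t ht => ?_
    rw [interior_Icc] at ht
    rw [(hG' t).deriv]
    have h1 := hWU t (Ioo_subset_Icc_self ht)
    have h2 : u t - (m + l) * U t ≤ Real.exp (m * t) * δ := by
      rw [hu]
      nlinarith [mul_le_mul_of_nonneg_left h1 (add_nonneg hm0 hl0)]
    have h3 : Real.exp (-(m + l) * t) * (Real.exp (m * t) * δ) ≤ δ := by
      rw [← mul_assoc, ← Real.exp_add]
      refine mul_le_of_le_one_left hδ (Real.exp_le_one_iff.2 ?_)
      nlinarith [ht.1]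
    have h4 := mul_le_mul_of_nonneg_left h2 (Real.exp_pos (-(m + l) * t)).le
    linarith
  have h1 := hanti h0T ht₁ ht₁.1
  have h2 := hWU t₁ ht₁
  simp only [hG, hU, mul_zero, Real.exp_zero, one_mul, intervalIntegral.integral_same, add_zero,
    sub_zero] at h1
  have h3 : Real.exp (-(m + l) * t₁) * (Real.exp (m * t₁) * W t₁)
      ≤ distR α (ψ 0) (φ 0) + δ * t₁ := by
    have := mul_le_mul_of_nonneg_left h2 (Real.exp_pos (-(m + l) * t₁)).le
    simp only [hU] at this
    linarith
  rw [← mul_assoc, ← Real.exp_add, hWeq t₁ ht₁, show -(m + l) * t₁ + m * t₁ = -(l * t₁) by ring,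
    Real.exp_neg, inv_mul_le_iff₀ (Real.exp_pos _)] at h3
  exact h3

theorem continuousInK_of_deriv {α : ℝ} {ψ p : ℝ → E3 → ℂ} (hψ : ∀ t, 0 ≤ t → ψ t ∈ K α)
    (hp : ∀ ξ t, 0 ≤ t → HasDerivWithinAt (fun s => ψ s ξ) (p t ξ) (Ici 0) t)
    (hC : ∀ T, ∃ C, ∀ t ∈ Icc 0 T, ∀ ξ, ‖p t ξ‖ ≤ C * ‖ξ‖ ^ α) : ContinuousInK α ψ := by
  refine continuousInK_of_lipschitz hψ fun T => ?_
  obtain ⟨C, hC⟩ := hC T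
  refine ⟨C, fun s hs t ht ξ => ?_⟩
  have := (convex_Icc 0 T).norm_image_sub_le_of_norm_hasDerivWithin_le
    (f := fun s => ψ s ξ) (f' := fun s => p s ξ)
    (fun x hx => (hp ξ x hx.1).mono Icc_subset_Ici_self) (fun x hx => hC x hx ξ) ht hs
  rw [Real.norm_eq_abs] at this
  linarith

/-! ### The Wild sum -/

/-- The terms of the Wild sum of an angular kernel with cutoff. -/
noncomputable def wildTerm (c : ℝ → ℝ) (φ : E3 → ℂ) : ℕ → E3 → ℂ
  | 0 => φ
  | n + 1 => fun ξ => ∑ j : Fin (n + 1), (((n + 1 : ℝ)⁻¹ : ℝ) : ℂ) *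
      ((((mass c)⁻¹ : ℝ) : ℂ) * gain c (wildTerm c φ j) (wildTerm c φ (n - j)) ξ)
  decreasing_by all_goals omega

namespace AngularKernel

variable {c : ℝ → ℝ} {φ χ : E3 → ℂ}

theorem gain_one (hc : AngularKernel c) (ξ : E3) : gain c (fun _ => 1) (fun _ => 1) ξ = mass c := by
  rw [← hc.integral_inner (norm_axis ξ)]
  simp only [gain, mul_one]
  exact integral_ofReal (𝕜 := ℂ)

theorem coll_one (hc : AngularKernel c) (ξ : E3) : coll c (fun _ => 1) ξ = 0 := by
  rw [coll, hc.gain_one, mul_one, sub_self]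

theorem isCharacteristic_wildTerm (hc : AngularKernel c) (hm : 0 < mass c)
    (hφ : IsCharacteristic φ) (n : ℕ) : IsCharacteristic (wildTerm c φ n) := by
  induction n using Nat.strong_induction_on with
  | _ n ih =>
    cases n with
    | zero => simpa only [wildTerm] using hφ
    | succ n =>
      simp only [wildTerm]
      refine IsCharacteristic.sum (s := Finset.univ) (fun _ _ => by positivity) ?_ fun j _ => ?_
      · simp only [Finset.sum_const, Finset.card_univ, Fintype.card_fin, nsmul_eq_mul]
        push_cast
        exact mul_inv_cancel₀ (by positivity)
      · exact hc.isCharacteristic_gain hm (ih j (by omega)) (ih (n - j) (by omega))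

theorem sum_gain_wildTerm (hm : 0 < mass c) (n : ℕ) (ξ : E3) :
    ∑ j ∈ Finset.range (n + 1), gain c (wildTerm c φ j) (wildTerm c φ (n - j)) ξ
      = mass c * (n + 1) * wildTerm c φ (n + 1) ξ := by
  rw [wildTerm]
  beta_reduce
  rw [← Finset.mul_sum, ← Finset.mul_sum,
    Fin.sum_univ_eq_sum_range fun j => gain c (wildTerm c φ j) (wildTerm c φ (n - j)) ξ]
  have h1 : (mass c : ℂ) ≠ 0 := by exact_mod_cast hm.ne'
  have h2 : (n + 1 : ℂ) ≠ 0 := by exact_mod_cast Nat.succ_ne_zero n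
  push_cast
  field_simp

/-- Growth is linear because the bounds for indices `j` and `n - j` add up to `A(n + 2)` for every
`j`, so averaging over `j` loses nothing. -/
theorem norm_wildTerm_sub_one_le (hc : AngularKernel c) (hm : 0 < mass c)
    (hφ : IsCharacteristic φ) {α A : ℝ} (hα : 0 < α) (hA : 0 ≤ A)
    (h : ∀ ξ, ‖φ ξ - 1‖ ≤ A * ‖ξ‖ ^ α) (n : ℕ) :
    ∀ ξ, ‖wildTerm c φ n ξ - 1‖ ≤ A * (n + 1) * ‖ξ‖ ^ α := by
  induction n using Nat.strong_induction_on with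
  | _ n ih =>
    cases n with
    | zero => simpa [wildTerm] using h
    | succ n =>
      intro ξ
      have h1 : (mass c : ℂ) ≠ 0 := by exact_mod_cast hm.ne'
      have h2 : (n + 1 : ℂ) ≠ 0 := by exact_mod_cast Nat.succ_ne_zero n
      have hsum := sum_gain_wildTerm (φ := φ) hm n ξ
      have hdiff : (mass c * (n + 1) : ℂ) * (wildTerm c φ (n + 1) ξ - 1)
          = ∑ j ∈ Finset.range (n + 1), (gain c (wildTerm c φ j) (wildTerm c φ (n - j)) ξ -
            gain c (fun _ => 1) (fun _ => 1) ξ) := by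
        rw [Finset.sum_sub_distrib, hsum, hc.gain_one]
        simp only [Finset.sum_const, Finset.card_range, nsmul_eq_mul]
        push_cast
        ring
      have hterm : ∀ j ∈ Finset.range (n + 1),
          ‖gain c (wildTerm c φ j) (wildTerm c φ (n - j)) ξ - gain c (fun _ => 1) (fun _ => 1) ξ‖
            ≤ mass c * (A * (n + 2)) * ‖ξ‖ ^ α := by
        intro j hj
        have hj' : j ≤ n := Nat.lt_succ_iff.1 (Finset.mem_range.1 hj)
        refine (hc.norm_gain_sub_le (hc.isCharacteristic_wildTerm hm hφ j)
          (hc.isCharacteristic_wildTerm hm hφ (n - j)) IsCharacteristic.one IsCharacteristic.one hα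
          (by positivity) (by positivity) (ih j (by omega)) (ih (n - j) (by omega)) ξ).trans
          (le_of_eq ?_)
        rw [Nat.cast_sub hj']
        ring
      have hn := norm_sum_le_of_le _ hterm
      rw [← hdiff, norm_mul, Finset.sum_const, Finset.card_range, nsmul_eq_mul] at hn
      have hnorm : ‖(mass c * (n + 1) : ℂ)‖ = mass c * (n + 1) := by
        have : (mass c * (n + 1) : ℂ) = ((mass c * (n + 1) : ℝ) : ℂ) := by push_cast; ring
        rw [this, Complex.norm_real, Real.norm_of_nonneg (by positivity)]
      rw [hnorm] at hn
      have hpos : 0 < mass c * (n + 1) := by positivity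
      refine le_of_mul_le_mul_left (hn.trans (le_of_eq ?_)) hpos
      push_cast
      ring

end AngularKernel

/-- The generating function of the terms of the Wild sum. -/
noncomputable def wildSeries (c : ℝ → ℝ) (φ : E3 → ℂ) (τ : ℝ) (ξ : E3) : ℂ :=
  ∑' n, (τ : ℂ) ^ n * wildTerm c φ n ξ

namespace AngularKernel

variable {c : ℝ → ℝ} {φ : E3 → ℂ}

theorem summable_wildSeries (hc : AngularKernel c) (hm : 0 < mass c) (hφ : IsCharacteristic φ)
    {τ : ℝ} (hτ : |τ| < 1) (ξ : E3) : Summable fun n => ‖(τ : ℂ) ^ n * wildTerm c φ n ξ‖ := by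
  refine Summable.of_nonneg_of_le (fun _ => norm_nonneg _) (fun n => ?_)
    (summable_geometric_of_lt_one (abs_nonneg τ) hτ)
  rw [norm_mul, norm_pow, Complex.norm_real, Real.norm_eq_abs]
  exact mul_le_of_le_one_right (by positivity) ((hc.isCharacteristic_wildTerm hm hφ n).norm_le_one ξ)

theorem hasDerivAt_wildSeries (hc : AngularKernel c) (hm : 0 < mass c) (hφ : IsCharacteristic φ)
    {τ : ℝ} (hτ : |τ| < 1) (ξ : E3) :
    HasDerivAt (fun s => wildSeries c φ s ξ)
      (∑' n : ℕ, (τ : ℂ) ^ n * ((n + 1) * wildTerm c φ (n + 1) ξ)) τ := by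
  obtain ⟨r, hr, hr1⟩ := exists_between hτ
  have hr0 : 0 < r := (abs_nonneg τ).trans_lt hr
  have hsum : Summable fun n : ℕ => (n : ℝ) * r ^ (n - 1) := by
    have h := summable_pow_mul_geometric_of_norm_lt_one 1 (r := r)
      (by rwa [Real.norm_of_nonneg hr0.le])
    refine (h.mul_left r⁻¹).congr fun n => ?_
    cases n with
    | zero => simp
    | succ n => simp only [Nat.add_sub_cancel, pow_succ]; field_simp
  have hder : HasDerivAt (fun s => wildSeries c φ s ξ)
      (∑' n : ℕ, (n : ℂ) * (τ : ℂ) ^ (n - 1) * wildTerm c φ n ξ) τ := by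
    refine hasDerivAt_tsum_of_isPreconnected (t := Metric.ball (0 : ℝ) r) hsum Metric.isOpen_ball
      (convex_ball 0 r).isPreconnected
      (g := fun (n : ℕ) (s : ℝ) => (s : ℂ) ^ n * wildTerm c φ n ξ)
      (g' := fun (n : ℕ) (s : ℝ) => (n : ℂ) * (s : ℂ) ^ (n - 1) * wildTerm c φ n ξ)
      (y₀ := 0) (fun n s _ => ?_) (fun n s hs => ?_) (by simpa using hr0) ?_ (by simpa using hr)
    · exact (((hasDerivAt_pow n (s : ℂ)).comp_ofReal).mul_const _)
    · rw [norm_mul, norm_mul, norm_pow, Complex.norm_natCast, Complex.norm_real]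
      have hs' : ‖s‖ ≤ r := by simpa using (mem_ball_zero_iff.1 hs).le
      refine (mul_le_of_le_one_right (by positivity)
        ((hc.isCharacteristic_wildTerm hm hφ n).norm_le_one ξ)).trans ?_
      gcongr
    · exact (hc.summable_wildSeries hm hφ (τ := 0) (by simp) ξ).of_norm
  have hs : Summable fun n : ℕ => (n : ℂ) * (τ : ℂ) ^ (n - 1) * wildTerm c φ n ξ := by
    refine Summable.of_norm_bounded hsum fun n => ?_
    rw [norm_mul, norm_mul, norm_pow, Complex.norm_natCast, Complex.norm_real]
    refine (mul_le_of_le_one_right (by positivity)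
      ((hc.isCharacteristic_wildTerm hm hφ n).norm_le_one ξ)).trans ?_
    gcongr
    exact hr.le
  rw [hs.tsum_eq_zero_add] at hder
  refine hder.congr_deriv ?_
  simp only [Nat.cast_zero, zero_mul, zero_add, Nat.add_sub_cancel]
  refine tsum_congr fun n => ?_
  push_cast
  ring

/-- The recursion is the Cauchy product read coefficientwise: the series `Φ` satisfies `mass c · Φ'
= gain c Φ Φ`. -/
theorem gain_wildSeries (hc : AngularKernel c) (hm : 0 < mass c) (hφ : IsCharacteristic φ)
    {τ : ℝ} (hτ : |τ| < 1) (ξ : E3) :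
    gain c (wildSeries c φ τ) (wildSeries c φ τ) ξ
      = mass c * ∑' n : ℕ, (τ : ℂ) ^ n * ((n + 1) * wildTerm c φ (n + 1) ξ) := by
  have hw := hc.isCharacteristic_wildTerm hm hφ
  set f : ℕ → S2 → ℂ := fun n σ => (c (inner ℝ (axis ξ) (σ : E3)) : ℂ) *
    ∑ j ∈ Finset.range (n + 1), (τ : ℂ) ^ n *
      (wildTerm c φ j (xiPlus ξ σ) * wildTerm c φ (n - j) (xiMinus ξ σ)) with hf
  have hbound : ∀ n (σ : S2), ‖∑ j ∈ Finset.range (n + 1), (τ : ℂ) ^ n *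
      (wildTerm c φ j (xiPlus ξ σ) * wildTerm c φ (n - j) (xiMinus ξ σ))‖
        ≤ (n + 1) * |τ| ^ n := by
    intro n σ
    refine (norm_sum_le_of_le _ fun j _ => (?_ : _ ≤ |τ| ^ n)).trans ?_
    · rw [norm_mul, norm_mul, norm_pow, Complex.norm_real, Real.norm_eq_abs]
      exact mul_le_of_le_one_right (by positivity)
        (mul_le_one₀ ((hw _).norm_le_one _) (norm_nonneg _) ((hw _).norm_le_one _))
    · simp
  have hcont : ∀ n, Continuous fun σ : S2 => ∑ j ∈ Finset.range (n + 1), (τ : ℂ) ^ n *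
      (wildTerm c φ j (xiPlus ξ σ) * wildTerm c φ (n - j) (xiMinus ξ σ)) := fun n =>
    continuous_finsetSum _ fun j _ => continuous_const.mul
      (((hw j).continuous.comp (continuous_xiPlus ξ)).mul
        ((hw (n - j)).continuous.comp (continuous_xiMinus ξ)))
  have hfi : ∀ n, Integrable (f n) surfaceMeasure := fun n =>
    hc.integrable_mul (norm_axis ξ) (hcont n).aestronglyMeasurable (hbound n)
  have hfn : ∀ n, ∫ σ, ‖f n σ‖ ∂surfaceMeasure ≤ mass c * ((n + 1) * |τ| ^ n) := by
    intro n
    rw [← hc.integral_inner (norm_axis ξ), ← integral_mul_const]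
    refine integral_mono (hfi n).norm ((hc.integrable_inner (norm_axis ξ)).mul_const _) fun σ => ?_
    simp only [hf, norm_mul, Complex.norm_real]
    rw [Real.norm_of_nonneg (hc.nonneg _)]
    exact mul_le_mul_of_nonneg_left (hbound n σ) (hc.nonneg _)
  have hgeo : Summable fun n : ℕ => mass c * (((n : ℝ) + 1) * |τ| ^ n) := by
    refine Summable.mul_left _ ?_
    have h1 := summable_pow_mul_geometric_of_norm_lt_one 1 (r := |τ|) (by simpa using hτ)
    have h2 := summable_geometric_of_lt_one (abs_nonneg τ) hτ
    refine (h1.add h2).congr fun n => ?_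
    ring
  have hsum : Summable fun n => ∫ σ, ‖f n σ‖ ∂surfaceMeasure :=
    Summable.of_nonneg_of_le (fun n => integral_nonneg fun _ => norm_nonneg _) hfn hgeo
  have hpt : ∀ σ : S2, (c (inner ℝ (axis ξ) (σ : E3)) : ℂ) *
      (wildSeries c φ τ (xiPlus ξ σ) * wildSeries c φ τ (xiMinus ξ σ)) = ∑' n, f n σ := by
    intro σ
    rw [wildSeries, wildSeries, tsum_mul_tsum_eq_tsum_sum_range_of_summable_norm
      (hc.summable_wildSeries hm hφ hτ _) (hc.summable_wildSeries hm hφ hτ _), ← tsum_mul_left]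
    refine tsum_congr fun n => ?_
    simp only [hf]
    congr 1
    refine Finset.sum_congr rfl fun j hj => ?_
    have hj' : j ≤ n := Nat.lt_succ_iff.1 (Finset.mem_range.1 hj)
    rw [show (τ : ℂ) ^ n = (τ : ℂ) ^ j * (τ : ℂ) ^ (n - j) by
      rw [← pow_add, Nat.add_sub_cancel' hj']]
    ring
  rw [gain, integral_congr_ae (.of_forall hpt), ← integral_tsum_of_summable_integral_norm hfi hsum,
    ← tsum_mul_left]
  refine tsum_congr fun n => ?_
  have hn : ∫ σ, f n σ ∂surfaceMeasure = (τ : ℂ) ^ n * ∑ j ∈ Finset.range (n + 1),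
      gain c (wildTerm c φ j) (wildTerm c φ (n - j)) ξ := by
    simp only [gain]
    rw [← integral_finsetSum _ fun j _ => hc.integrable_gain (hw j) (hw (n - j)) ξ,
      ← integral_const_mul]
    refine integral_congr_ae (.of_forall fun σ => ?_)
    simp only [hf, Finset.mul_sum]
    refine Finset.sum_congr rfl fun j _ => ?_
    ring
  rw [hn, sum_gain_wildTerm hm]
  ring

/-- The Lipschitz constant contains the mass, so this serves only at a fixed cutoff. -/
theorem norm_coll_sub_le (hc : AngularKernel c) {χ : E3 → ℂ} {α : ℝ} (hα : α ∈ Ioc (0 : ℝ) 2)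
    (hφ : φ ∈ K α) (hχ : χ ∈ K α) (ξ : E3) :
    ‖coll c φ ξ - coll c χ ξ‖ ≤ (2 * mass c + rate c α) * (distR α φ χ * ‖ξ‖ ^ α) := by
  have hd := norm_sub_le_distR hφ hχ
  have h1 := hc.norm_gain_sub_le_rate hφ.1 hφ.1 hχ.1 hχ.1 hα (distR_nonneg _ _ _) hd hd ξ
  have h2 : coll c φ ξ - coll c χ ξ
      = (gain c φ φ ξ - gain c χ χ ξ) - mass c * (φ ξ - χ ξ) := by
    rw [coll, coll]; ring
  rw [h2]
  refine (norm_sub_le _ _).trans ?_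
  rw [norm_mul, Complex.norm_real, Real.norm_of_nonneg hc.mass_nonneg]
  have h3 := mul_le_mul_of_nonneg_left (hd ξ) hc.mass_nonneg
  linarith

/-- Well-posedness under angular cutoff, by the Wild sum. -/
theorem exists_solution (hc : AngularKernel c) {α : ℝ} (hα : 0 < α) (hφ : φ ∈ K α) :
    ∃ ψ : ℝ → E3 → ℂ, ψ 0 = φ ∧ ContinuousInK α ψ ∧
      ∀ ξ t, 0 ≤ t → HasDerivWithinAt (fun s => ψ s ξ) (coll c (ψ t) ξ) (Ici 0) t := by
  rcases hc.mass_nonneg.eq_or_lt with hm | hm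
  · refine ⟨fun _ => φ, rfl, ⟨fun _ _ => hφ, fun _ _ => ?_⟩, fun ξ t _ => ?_⟩
    · simp [distK_self, tendsto_const_nhds]
    · rw [coll, hc.gain_eq_zero hm.symm, ← hm]
      simpa using hasDerivWithinAt_const t (Ici 0) (φ ξ)
  set A := distR α φ (fun _ => 1) with hA
  have hA0 : 0 ≤ A := distR_nonneg _ _ _
  have hφA : ∀ ξ, ‖φ ξ - 1‖ ≤ A * ‖ξ‖ ^ α := norm_sub_le_distR hφ (one_mem_K α)
  -- In this time variable `τ' = mass c · (1 - τ)`, and `(1 - τ)Φ(τ)` solves the equation. It is a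
  -- convex combination of the Wild terms with geometric weights, hence a characteristic function.
  set τ : ℝ → ℝ := fun t => 1 - Real.exp (-(mass c * t)) with hτ
  have hτ0 : ∀ t, 0 ≤ t → 0 ≤ τ t := fun t ht => by
    have : Real.exp (-(mass c * t)) ≤ 1 := Real.exp_le_one_iff.2 (by nlinarith)
    simp only [hτ]; linarith
  have hτ1 : ∀ t, 0 ≤ t → |τ t| < 1 := fun t ht => by
    rw [abs_of_nonneg (hτ0 t ht)]
    linarith [Real.exp_pos (-(mass c * t))]
  have hτe : ∀ t, 1 - τ t = Real.exp (-(mass c * t)) := fun t => by simp [hτ]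
  set ψ : ℝ → E3 → ℂ := fun t ξ => (1 - τ t : ℝ) * wildSeries c φ (τ t) ξ with hψ
  have hweight : ∀ t, 0 ≤ t → HasSum (fun n => (1 - τ t) * τ t ^ n) 1 := fun t ht => by
    have h := (hasSum_geometric_of_lt_one (hτ0 t ht) ((le_abs_self _).trans_lt (hτ1 t ht))).mul_left
      (1 - τ t)
    rwa [mul_inv_cancel₀ (by rw [hτe]; positivity)] at h
  have hψsum : ∀ t ξ, ψ t ξ = ∑' n, (((1 - τ t) * τ t ^ n : ℝ) : ℂ) * wildTerm c φ n ξ := by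
    intro t ξ
    simp only [hψ, wildSeries]
    rw [← tsum_mul_left]
    refine tsum_congr fun n => ?_
    push_cast
    ring
  have hw0 : ∀ t, 0 ≤ t → ∀ n, 0 ≤ (1 - τ t) * τ t ^ n := fun t ht n =>
    mul_nonneg (by rw [hτe]; positivity) (pow_nonneg (hτ0 t ht) n)
  have hchar : ∀ t, 0 ≤ t → IsCharacteristic (ψ t) := by
    intro t ht
    have := IsCharacteristic.tsum (hw0 t ht) (hweight t ht)
      (fun n => hc.isCharacteristic_wildTerm hm hφ.1 n)
    convert this using 2 with ξ
    exact hψsum t ξ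
  have hbound : ∀ t, 0 ≤ t → ∀ ξ, ‖ψ t ξ - 1‖ ≤ A * Real.exp (mass c * t) * ‖ξ‖ ^ α := by
    intro t ht ξ
    have hone : (1 : ℂ) = ∑' n, (((1 - τ t) * τ t ^ n : ℝ) : ℂ) := by
      rw [← Complex.ofReal_tsum, (hweight t ht).tsum_eq, Complex.ofReal_one]
    have hs1 : Summable fun n => (((1 - τ t) * τ t ^ n : ℝ) : ℂ) :=
      Complex.summable_ofReal.2 (hweight t ht).summable
    have hs2 : Summable fun n => (((1 - τ t) * τ t ^ n : ℝ) : ℂ) * wildTerm c φ n ξ := by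
      refine Summable.of_norm_bounded (hweight t ht).summable fun n => ?_
      rw [norm_mul, Complex.norm_real, Real.norm_of_nonneg (hw0 t ht n)]
      exact mul_le_of_le_one_right (hw0 t ht n)
        ((hc.isCharacteristic_wildTerm hm hφ.1 n).norm_le_one ξ)
    -- The sum of `(1 - τ)τⁿ(n + 1)` is `1/(1 - τ) = exp(mass c · t)`.
    have hsum : HasSum (fun n : ℕ => (1 - τ t) * τ t ^ n * (A * (n + 1) * ‖ξ‖ ^ α))
        (A * Real.exp (mass c * t) * ‖ξ‖ ^ α) := by
      have hlt : ‖τ t‖ < 1 := hτ1 t ht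
      have h1 := hasSum_coe_mul_geometric_of_norm_lt_one hlt
      have h2 := hasSum_geometric_of_norm_lt_one hlt
      have h3 := (h1.add h2).mul_left ((1 - τ t) * A * ‖ξ‖ ^ α)
      have he : (1 - τ t) ≠ 0 := by rw [hτe]; positivity
      have hval : (1 - τ t) * A * ‖ξ‖ ^ α * (τ t / (1 - τ t) ^ 2 + (1 - τ t)⁻¹)
          = A * Real.exp (mass c * t) * ‖ξ‖ ^ α := by
        have : Real.exp (mass c * t) = (1 - τ t)⁻¹ := by rw [hτe, Real.exp_neg, inv_inv]
        rw [this]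
        field_simp
        ring
      rw [hval] at h3
      refine h3.congr_fun ?_
      intro n
      ring
    rw [hψsum, hone, ← hs2.tsum_sub hs1]
    refine tsum_of_norm_bounded hsum fun n => ?_
    rw [← mul_sub_one, norm_mul, Complex.norm_real, Real.norm_of_nonneg (hw0 t ht n)]
    exact mul_le_mul_of_nonneg_left (hc.norm_wildTerm_sub_one_le hm hφ.1 hα hA0 hφA n ξ)
      (hw0 t ht n)
  have hderiv : ∀ ξ t, 0 ≤ t → HasDerivWithinAt (fun s => ψ s ξ) (coll c (ψ t) ξ) (Ici 0) t := by
    intro ξ t ht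
    have hτ' : HasDerivAt τ (mass c * (1 - τ t)) t := by
      have h := ((((hasDerivAt_id t).const_mul (mass c)).neg).exp).const_sub 1
      refine h.congr_deriv ?_
      rw [hτe]
      simp
      ring
    have h1 := (hc.hasDerivAt_wildSeries hm hφ.1 (hτ1 t ht) ξ).scomp t hτ'
    have h2 := ((hτ'.const_sub 1).ofReal_comp).mul h1
    refine HasDerivAt.hasDerivWithinAt (h2.congr_deriv ?_)
    have hg : gain c (ψ t) (ψ t) ξ
        = (1 - τ t : ℝ) ^ 2 * gain c (wildSeries c φ (τ t)) (wildSeries c φ (τ t)) ξ := by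
      rw [gain, gain, ← integral_const_mul]
      refine integral_congr_ae (.of_forall fun σ => ?_)
      simp only [hψ]
      ring
    rw [coll, hg, hc.gain_wildSeries hm hφ.1 (hτ1 t ht)]
    simp only [hψ, Complex.real_smul, Function.comp_apply]
    push_cast
    ring
  refine ⟨ψ, ?_, ?_, hderiv⟩
  · ext ξ
    have : τ 0 = 0 := by simp [hτ]
    rw [hψsum, tsum_eq_single 0 fun n hn => by simp [this, hn]]
    simp [this, wildTerm]
  · refine continuousInK_of_deriv (fun t ht => mem_K_of_le (hchar t ht) (hbound t ht)) hderiv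
      fun T => ⟨5 * (A * Real.exp (mass c * T)) * moment c α, fun t ht ξ => ?_⟩
    have hb : ∀ ξ, ‖ψ t ξ - 1‖ ≤ A * Real.exp (mass c * T) * ‖ξ‖ ^ α := fun ξ => by
      refine (hbound t ht.1 ξ).trans ?_
      gcongr
      exact ht.2
    refine (hc.norm_coll_le (hchar t ht.1) hα hb ξ).trans (le_of_eq ?_)
    ring

end AngularKernel

/-! ### Removing the cutoff -/

theorem AngularKernel.continuousOn_coll {c : ℝ → ℝ} (hc : AngularKernel c) {α : ℝ}
    (hα : α ∈ Ioc (0 : ℝ) 2) {ψ : ℝ → E3 → ℂ} (hψ : ContinuousInK α ψ) :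
    ContinuousOn (fun p : ℝ × E3 => coll c (ψ p.1) p.2) (Ici 0 ×ˢ univ) := by
  rintro ⟨t₀, ξ₀⟩ ⟨ht₀, -⟩
  have ht₀ : 0 ≤ t₀ := ht₀
  have hfst : Tendsto (fun p : ℝ × E3 => p.1) (𝓝[Ici 0 ×ˢ univ] (t₀, ξ₀)) (𝓝[Ici 0] t₀) := by
    refine tendsto_nhdsWithin_of_tendsto_nhds_of_eventually_within _
      ((continuous_fst.tendsto (t₀, ξ₀)).mono_left nhdsWithin_le_nhds) ?_
    filter_upwards [self_mem_nhdsWithin] with p hp using hp.1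
  have hsnd : Tendsto (fun p : ℝ × E3 => p.2) (𝓝[Ici 0 ×ˢ univ] (t₀, ξ₀)) (𝓝 ξ₀) :=
    (continuous_snd.tendsto (t₀, ξ₀)).mono_left nhdsWithin_le_nhds
  have h1 : Tendsto (fun p : ℝ × E3 => coll c (ψ p.1) p.2 - coll c (ψ t₀) p.2)
      (𝓝[Ici 0 ×ˢ univ] (t₀, ξ₀)) (𝓝 0) := by
    have hlim : Tendsto (fun p : ℝ × E3 => (2 * mass c + rate c α) *
        (distR α (ψ p.1) (ψ t₀) * ‖p.2‖ ^ α)) (𝓝[Ici 0 ×ˢ univ] (t₀, ξ₀)) (𝓝 0) := by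
      have h := (((hψ.tendsto_distR ht₀).comp hfst).mul
        ((hsnd.norm).rpow_const (Or.inr hα.1.le))).const_mul (2 * mass c + rate c α)
      simpa using h
    refine squeeze_zero_norm' ?_ hlim
    filter_upwards [self_mem_nhdsWithin] with p hp
    exact hc.norm_coll_sub_le hα (hψ.1 _ hp.1) (hψ.1 _ ht₀) _
  have h2 := (((hc.continuous_coll (hψ.1 t₀ ht₀).1).tendsto ξ₀).comp hsnd).add h1
  rw [add_zero] at h2
  refine h2.congr fun p => ?_
  simp

namespace CrossSection

variable {b : ℝ → ℝ} {α : ℝ} {ψ : ℝ → E3 → ℂ}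

/-- The cutoff operators are jointly continuous and converge locally uniformly, with error
controlled by the tail. -/
theorem continuousOn_collision (hb : CrossSection b α) (hα : α ≤ 2) (hψ : ContinuousInK α ψ)
    {Q : ℝ → E3 → ℂ} (hQ : ∀ t, 0 ≤ t → ∀ ξ, HasCollisionIntegral b (ψ t) ξ (Q t ξ)) :
    ContinuousOn (fun p : ℝ × E3 => Q p.1 p.2) (Ici 0 ×ˢ univ) := by
  have hpi : (0 : ℝ) < Real.pi / 2 := by positivity
  have hloc : TendstoLocallyUniformlyOn (fun ε (p : ℝ × E3) => coll (cut b ε) (ψ p.1) p.2)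
      (fun p => Q p.1 p.2) (𝓝[>] 0) (Ici 0 ×ˢ univ) := by
    rw [Metric.tendstoLocallyUniformlyOn_iff]
    rintro r hr ⟨t₀, ξ₀⟩ -
    obtain ⟨M, hM0, hM⟩ := hψ.exists_bound (t₀ + 1)
    refine ⟨{p | p.1 < t₀ + 1 ∧ ‖p.2‖ < ‖ξ₀‖ + 1} ∩ Ici 0 ×ˢ univ,
      inter_mem (mem_nhdsWithin_of_mem_nhds ?_) self_mem_nhdsWithin, ?_⟩
    · exact ((isOpen_lt continuous_fst continuous_const).inter
        (isOpen_lt continuous_snd.norm continuous_const)).mem_nhds ⟨by simp, by simp⟩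
    · have ht := hb.tendsto_tail.const_mul (5 * M * (‖ξ₀‖ + 1) ^ α)
      rw [mul_zero] at ht
      filter_upwards [ht.eventually (gt_mem_nhds hr), Ioo_mem_nhdsGT hpi] with ε hε hε'
      rintro ⟨t, ξ⟩ ⟨⟨h1, h2⟩, h3, -⟩
      rw [dist_eq_norm]
      refine lt_of_le_of_lt ((hb.norm_sub_coll_cut_le (hψ.1 t h3).1 hM0 (hM t ⟨h3, h1.le⟩)
        (hQ t h3 ξ) (Ioo_subset_Ioc_self hε')).trans ?_) hε
      have := hb.tail_nonneg hε'.2.le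
      have := hb.pos.le
      have h2 : ‖ξ‖ < ‖ξ₀‖ + 1 := h2
      gcongr
  refine hloc.continuousOn (Eventually.frequently ?_)
  filter_upwards [Ioo_mem_nhdsGT hpi] with ε hε
  exact (hb.angularKernel_cut (Ioo_subset_Ioc_self hε)).continuousOn_coll ⟨hb.pos, hα⟩ hψ

/-- Both solutions satisfy the cutoff equation up to a tail error. The Gronwall comparison has a
rate at most `λ_α` for every `ε`, and the error disappears as `ε ↓ 0`. -/
theorem distR_le_of_isClassicalSolution (hb : CrossSection b α) (hα : α ≤ 2)
    {φ : ℝ → E3 → ℂ} {ψ₀ φ₀ : E3 → ℂ} (hψ : IsClassicalSolution b ψ₀ ψ)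
    (hψc : ContinuousInK α ψ) (hφ : IsClassicalSolution b φ₀ φ) (hφc : ContinuousInK α φ)
    {t : ℝ} (ht : 0 ≤ t) :
    distR α (ψ t) (φ t) ≤ Real.exp (rate b α * t) * distR α ψ₀ φ₀ := by
  have hpi : (0 : ℝ) < Real.pi / 2 := by positivity
  obtain ⟨M, hM0, hM⟩ := hψc.exists_bound t
  obtain ⟨N, hN0, hN⟩ := hφc.exists_bound t
  have hlim : Tendsto (fun ε => Real.exp (rate b α * t) *
      (distR α ψ₀ φ₀ + (5 * M + 5 * N) * tail b α ε * t)) (𝓝[>] 0)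
      (𝓝 (Real.exp (rate b α * t) * (distR α ψ₀ φ₀ + (5 * M + 5 * N) * 0 * t))) :=
    (((hb.tendsto_tail.const_mul _).mul_const t).const_add _).const_mul _
  rw [mul_zero, zero_mul, add_zero] at hlim
  refine ge_of_tendsto hlim ?_
  filter_upwards [Ioo_mem_nhdsGT hpi] with ε hε
  have hε := Ioo_subset_Ioc_self hε
  have ht0 := hb.tail_nonneg hε.2
  have hderiv : ∀ {ψ : ℝ → E3 → ℂ} {ψ₀ : E3 → ℂ}, IsClassicalSolution b ψ₀ ψ → ∀ ξ,
      ∀ s ∈ Icc 0 t, HasDerivWithinAt (fun s => ψ s ξ) (timeDeriv ψ s ξ) (Ici 0) s :=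
    fun h ξ s hs => (h.2 s hs.1 ξ).1.hasDerivWithinAt
  have key := (hb.angularKernel_cut hε).distR_le_of_deriv ⟨hb.pos, hα⟩
    (δ := (5 * M + 5 * N) * tail b α ε) (by positivity) (fun s hs => hψc.1 s hs.1)
    (fun s hs => hφc.1 s hs.1) ((hψc.continuousOn_distR hφc).mono Icc_subset_Ici_self)
    (hderiv hψ) (hderiv hφ) (fun ξ s hs => ?_) t ⟨ht, le_rfl⟩
  · rw [hψ.1, hφ.1] at key
    refine key.trans ?_
    have := hb.rate_cut_le hα hε
    have := distR_nonneg α ψ₀ φ₀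
    gcongr
  · have h1 := hb.norm_sub_coll_cut_le (hψc.1 s hs.1).1 hM0 (hM s hs) (hψ.2 s hs.1 ξ).2 hε
    have h2 := hb.norm_sub_coll_cut_le (hφc.1 s hs.1).1 hN0 (hN s hs) (hφ.2 s hs.1 ξ).2 hε
    have hdec : timeDeriv ψ s ξ - timeDeriv φ s ξ -
        (coll (cut b ε) (ψ s) ξ - coll (cut b ε) (φ s) ξ)
        = (timeDeriv ψ s ξ - coll (cut b ε) (ψ s) ξ) -
          (timeDeriv φ s ξ - coll (cut b ε) (φ s) ξ) := by ring
    rw [hdec]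
    refine (norm_sub_le _ _).trans ?_
    linarith

/-- Existence of a classical solution, as the limit of the solutions with angular cutoff. -/
theorem exists_isClassicalSolution (hb : CrossSection b α) (hα : α ≤ 2) {ψ₀ : E3 → ℂ}
    (hψ₀ : ψ₀ ∈ K α) : ∃ ψ, IsClassicalSolution b ψ₀ ψ ∧ ContinuousInK α ψ := by
  set ε : ℕ → ℝ := fun n => 1 / ((n : ℝ) + 1) with hεdef
  have hε : ∀ n, ε n ∈ Ioc 0 (Real.pi / 2) := fun n => by
    refine ⟨by positivity, ?_⟩
    have : ε n ≤ 1 := by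
      rw [hεdef]; exact (div_le_one (by positivity)).2 (by linarith [n.cast_nonneg (α := ℝ)])
    linarith [Real.pi_gt_three]
  have hεmono : ∀ {n k}, n ≤ k → ε k ≤ ε n := fun h => by
    simp only [hεdef]
    gcongr
  have hεlim : Tendsto (fun n => tail b α (ε n)) atTop (𝓝 0) :=
    hb.tendsto_tail.comp (tendsto_nhdsWithin_of_tendsto_nhds_of_eventually_within _
      tendsto_one_div_add_atTop_nhds_zero_nat (.of_forall fun n => (hε n).1))
  have htail0 : ∀ n, 0 ≤ tail b α (ε n) := fun n => hb.tail_nonneg (hε n).2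
  have hker := fun n => hb.angularKernel_cut (hε n)
  choose f hf0 hfc hfd using fun n => (hker n).exists_solution hb.pos hψ₀
  set A := distR α ψ₀ (fun _ => 1) with hA
  have hA0 : 0 ≤ A := distR_nonneg _ _ _
  set M : ℝ → ℝ := fun T => Real.exp (rate b α * T) * A with hMdef
  have hM0 : ∀ T, 0 ≤ M T := fun T => by positivity
  have hrate : ∀ n {s T : ℝ}, 0 ≤ s → s ≤ T →
      Real.exp (rate (cut b (ε n)) α * s) ≤ Real.exp (rate b α * T) := fun n s T hs hsT => by
    have h1 := hb.rate_cut_le hα (hε n)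
    have h2 := (hker n).rate_nonneg hα
    have h3 := h2.trans h1
    gcongr
  have hone : ContinuousInK α (fun _ _ => 1) :=
    ⟨fun _ _ => one_mem_K α, fun _ _ => by simp [distK_self, tendsto_const_nhds]⟩
  -- Comparison with the stationary solution `1`; unlike the bound from the Wild sum, this one is
  -- uniform in the cutoff.
  have hfM : ∀ n T, ∀ t ∈ Icc 0 T, ∀ ξ, ‖f n t ξ - 1‖ ≤ M T * ‖ξ‖ ^ α := by
    intro n T t ht ξ
    have key := (hker n).distR_le_of_deriv ⟨hb.pos, hα⟩ (δ := 0) le_rfl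
      (fun s hs => (hfc n).1 s hs.1) (fun s _ => one_mem_K α)
      (((hfc n).continuousOn_distR hone).mono Icc_subset_Ici_self)
      (fun ξ s hs => hfd n ξ s hs.1) (q := fun _ _ => 0)
      (fun ξ s _ => hasDerivWithinAt_const s _ _) (fun ξ s _ => ?_) t ht
    · refine (norm_sub_le_distR ((hfc n).1 t ht.1) (one_mem_K α) ξ).trans ?_
      rw [hf0 n, zero_mul, add_zero] at key
      have := hrate n ht.1 ht.2
      gcongr
      exact key.trans (mul_le_mul_of_nonneg_right this hA0)
    · rw [(hker n).coll_one]
      simp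
  set D : ℝ → ℕ → ℝ := fun T n =>
    Real.exp (rate b α * T) * (5 * M T * tail b α (ε n) * T) with hDdef
  have hDlim : ∀ T, Tendsto (D T) atTop (𝓝 0) := fun T => by
    have := (((hεlim.const_mul (5 * M T)).mul_const T).const_mul (Real.exp (rate b α * T)))
    simpa [hDdef] using this
  -- The solution with the finer cutoff solves the coarser equation up to the tail at `ε n`, with
  -- the same initial datum.
  have hcau : ∀ T {n k}, n ≤ k → ∀ t ∈ Icc 0 T, ∀ ξ, ‖f k t ξ - f n t ξ‖ ≤ D T n * ‖ξ‖ ^ α := by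
    intro T n k hnk t ht ξ
    have hT : 0 ≤ T := ht.1.trans ht.2
    have key := (hker n).distR_le_of_deriv ⟨hb.pos, hα⟩ (δ := 5 * M T * tail b α (ε n))
      (mul_nonneg (mul_nonneg (by norm_num) (hM0 T)) (htail0 n))
      (fun s hs => (hfc k).1 s hs.1) (fun s hs => (hfc n).1 s hs.1)
      (((hfc k).continuousOn_distR (hfc n)).mono Icc_subset_Ici_self)
      (fun ξ s hs => hfd k ξ s hs.1) (fun ξ s hs => hfd n ξ s hs.1) (fun ξ s hs => ?_) t ht
    · refine (norm_sub_le_distR ((hfc k).1 t ht.1) ((hfc n).1 t ht.1) ξ).trans ?_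
      rw [hf0 n, hf0 k, show distR α ψ₀ ψ₀ = 0 by rw [distR, distK_self]; rfl, zero_add] at key
      have h1 := hrate n ht.1 ht.2
      have h2 := ht.2
      have h3 := ht.1
      have h4 := mul_nonneg (mul_nonneg (by norm_num : (0 : ℝ) ≤ 5) (hM0 T)) (htail0 n)
      gcongr
      exact key.trans (by simp only [hDdef]; gcongr)
    · rw [sub_sub_sub_cancel_right]
      refine (hb.norm_coll_cut_sub_le ((hfc k).1 s hs.1).1 (hM0 T) (hfM k T s hs) (hε k).1
        (hεmono hnk) (hε n).2 ξ).trans (le_of_eq ?_)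
      ring
  set ψ : ℝ → E3 → ℂ := fun t ξ => limUnder atTop fun n => f n t ξ with hψdef
  have hlim : ∀ t, 0 ≤ t → ∀ ξ, Tendsto (fun n => f n t ξ) atTop (𝓝 (ψ t ξ)) := by
    intro t ht ξ
    refine CauchySeq.tendsto_limUnder (cauchySeq_of_le_tendsto_0' (fun n => D t n * ‖ξ‖ ^ α)
      (fun n k hnk => ?_) (by simpa using (hDlim t).mul_const (‖ξ‖ ^ α)))
    rw [dist_comm, dist_eq_norm]
    exact hcau t hnk t ⟨ht, le_rfl⟩ ξ
  have hψM : ∀ T, ∀ t ∈ Icc 0 T, ∀ ξ, ‖ψ t ξ - 1‖ ≤ M T * ‖ξ‖ ^ α := fun T t ht ξ =>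
    le_of_tendsto ((hlim t ht.1 ξ).sub_const 1).norm (.of_forall fun n => hfM n T t ht ξ)
  have hψK : ∀ t, 0 ≤ t → ψ t ∈ K α := by
    intro t ht
    have hbound := hψM t t ⟨ht, le_rfl⟩
    refine mem_K_of_le (IsCharacteristic.of_tendsto (fun n => ((hfc n).1 t ht).1) (hlim t ht) ?_)
      hbound
    have h0 : ψ t 0 = 1 := by
      have := hbound 0
      rw [norm_zero, Real.zero_rpow hb.pos.ne', mul_zero] at this
      exact sub_eq_zero.1 (norm_le_zero_iff.1 this)
    rw [ContinuousAt, h0, tendsto_iff_norm_sub_tendsto_zero]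
    refine squeeze_zero (fun _ => norm_nonneg _) hbound ?_
    have : Continuous fun ξ : E3 => M t * ‖ξ‖ ^ α :=
      continuous_const.mul (continuous_norm.rpow_const fun _ => Or.inr hb.pos.le)
    simpa [Real.zero_rpow hb.pos.ne'] using this.tendsto 0
  have hfder : ∀ n T, ∀ t ∈ Icc 0 T, ∀ ξ,
      ‖coll (cut b (ε n)) (f n t) ξ‖ ≤ 5 * M T * moment b α * ‖ξ‖ ^ α := fun n T t ht ξ =>
    (hb.norm_coll_cut_le ((hfc n).1 t ht.1).1 (hM0 T) (hfM n T t ht) (hε n) ξ).trans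
      (le_of_eq (by ring))
  have hψc : ContinuousInK α ψ := by
    refine continuousInK_of_lipschitz hψK fun T => ⟨5 * M T * moment b α, fun s hs t ht ξ => ?_⟩
    refine le_of_tendsto ((hlim s hs.1 ξ).sub (hlim t ht.1 ξ)).norm (.of_forall fun n => ?_)
    have := (convex_Icc 0 T).norm_image_sub_le_of_norm_hasDerivWithin_le
      (f := fun s => f n s ξ) (f' := fun s => coll (cut b (ε n)) (f n s) ξ)
      (fun x hx => (hfd n ξ x hx.1).mono Icc_subset_Ici_self)
      (fun x hx => hfder n T x hx ξ) ht hs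
    rw [Real.norm_eq_abs] at this
    linarith
  have hex : ∀ t ξ, ∃ z, 0 ≤ t → HasCollisionIntegral b (ψ t) ξ z := by
    intro t ξ
    by_cases ht : 0 ≤ t
    · obtain ⟨z, hz⟩ := hb.exists_hasCollisionIntegral (hψK t ht).1 (hM0 t)
        (hψM t t ⟨ht, le_rfl⟩) ξ
      exact ⟨z, fun _ => hz⟩
    · exact ⟨0, fun h => absurd h ht⟩
  choose Q hQ' using hex
  have hQ : ∀ t, 0 ≤ t → ∀ ξ, HasCollisionIntegral b (ψ t) ξ (Q t ξ) := fun t ht ξ => hQ' t ξ ht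
  have hQc := hb.continuousOn_collision hα hψc hQ
  -- Both the kernel and the function vary with `n`. An intermediate cutoff `k` is fixed first to
  -- make the two tail errors small; then `n → ∞` uses the Lipschitz bound at that `k`.
  have hQlim : ∀ t, 0 ≤ t → ∀ ξ,
      Tendsto (fun n => coll (cut b (ε n)) (f n t) ξ) atTop (𝓝 (Q t ξ)) := by
    intro t ht ξ
    have htt : t ∈ Icc 0 t := ⟨ht, le_rfl⟩
    have hdist : Tendsto (fun n => distR α (ψ t) (f n t)) atTop (𝓝 0) := by
      refine squeeze_zero (fun _ => distR_nonneg _ _ _) (fun n => ?_) (hDlim t)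
      refine distR_le ?_ fun ζ => ?_
      · have := hM0 t
        have := htail0 n
        simp only [hDdef]
        positivity
      · refine le_of_tendsto ((hlim t ht ζ).sub_const _).norm ?_
        filter_upwards [eventually_ge_atTop n] with k hk
        exact hcau t hk t htt ζ
    rw [Metric.tendsto_atTop']
    intro r hr
    have hB : Tendsto (fun n => 10 * M t * ‖ξ‖ ^ α * tail b α (ε n)) atTop (𝓝 0) := by
      simpa using hεlim.const_mul (10 * M t * ‖ξ‖ ^ α)
    obtain ⟨k, hk⟩ := (hB.eventually (gt_mem_nhds (half_pos hr))).exists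
    have hC : Tendsto (fun n => (2 * mass (cut b (ε k)) + rate (cut b (ε k)) α) *
        (distR α (ψ t) (f n t) * ‖ξ‖ ^ α)) atTop (𝓝 0) := by
      simpa using (hdist.mul_const (‖ξ‖ ^ α)).const_mul
        (2 * mass (cut b (ε k)) + rate (cut b (ε k)) α)
    obtain ⟨N, hN⟩ := eventually_atTop.1 (hC.eventually (gt_mem_nhds (half_pos hr)))
    refine ⟨max N k, fun n hn => ?_⟩
    have hnN : N ≤ n := (le_max_left _ _).trans hn.le
    have hnk : k ≤ n := (le_max_right _ _).trans hn.le
    have h1 := hb.norm_sub_coll_cut_le (hψK t ht).1 (hM0 t) (hψM t t htt) (hQ t ht ξ) (hε k)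
    have h2 := (hker k).norm_coll_sub_le ⟨hb.pos, hα⟩ (hψK t ht) ((hfc n).1 t ht) ξ
    have h3 := hb.norm_coll_cut_sub_le ((hfc n).1 t ht).1 (hM0 t) (hfM n t t htt) (hε n).1
      (hεmono hnk) (hε k).2 ξ
    have h4 := hN n hnN
    have hdec : coll (cut b (ε n)) (f n t) ξ - Q t ξ
        = (coll (cut b (ε n)) (f n t) ξ - coll (cut b (ε k)) (f n t) ξ) -
          (coll (cut b (ε k)) (ψ t) ξ - coll (cut b (ε k)) (f n t) ξ) -
          (Q t ξ - coll (cut b (ε k)) (ψ t) ξ) := by ring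
    rw [dist_eq_norm, hdec]
    refine ((norm_sub_le _ _).trans (add_le_add_left (norm_sub_le _ _) _)).trans_lt ?_
    linarith
  -- Freezing `Q` for negative times gives a continuous integrand on `ℝ`, so the fundamental theorem
  -- also covers `t = 0`.
  have hQm : ∀ ξ, Continuous fun s => Q (max s 0) ξ := fun ξ => by
    refine hQc.comp_continuous (f := fun s : ℝ => (max s 0, ξ)) (by fun_prop) fun s => ?_
    exact ⟨(le_max_right s 0 : (0 : ℝ) ≤ max s 0), mem_univ _⟩
  -- The limit is taken in the integrated equation, dominated by the moment bound, which does not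
  -- depend on `n`.
  have hint : ∀ ξ t, 0 ≤ t → ψ t ξ = ψ₀ ξ + ∫ s in (0 : ℝ)..t, Q (max s 0) ξ := by
    intro ξ t ht
    have hcc : ∀ n, ContinuousOn (fun s => coll (cut b (ε n)) (f n s) ξ) (Icc 0 t) := fun n =>
      ((hker n).continuousOn_coll ⟨hb.pos, hα⟩ (hfc n)).comp (f := fun s : ℝ => (s, ξ))
        (by fun_prop) fun s hs => ⟨hs.1, mem_univ _⟩
    have hftc : ∀ n, ∫ s in (0 : ℝ)..t, coll (cut b (ε n)) (f n s) ξ = f n t ξ - ψ₀ ξ := by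
      intro n
      rw [intervalIntegral.integral_eq_sub_of_hasDeriv_right (f := fun s => f n s ξ), hf0]
      · rw [uIcc_of_le ht]
        exact fun s hs => ((hfd n ξ s hs.1).continuousWithinAt).mono Icc_subset_Ici_self
      · rw [min_eq_left ht, max_eq_right ht]
        exact fun s hs => (hfd n ξ s hs.1.le).mono (Ioi_subset_Ici hs.1.le)
      · refine ContinuousOn.intervalIntegrable ?_
        rw [uIcc_of_le ht]
        exact hcc n
    have hdom : Tendsto (fun n => ∫ s in (0 : ℝ)..t, coll (cut b (ε n)) (f n s) ξ) atTop
        (𝓝 (∫ s in (0 : ℝ)..t, Q (max s 0) ξ)) := by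
      refine intervalIntegral.tendsto_integral_filter_of_dominated_convergence
        (fun _ => 5 * M t * moment b α * ‖ξ‖ ^ α) (.of_forall fun n => ?_)
        (.of_forall fun n => .of_forall fun s hs => ?_) (by simp) (.of_forall fun s hs => ?_)
      · rw [uIoc_of_le ht]
        exact ((hcc n).mono Ioc_subset_Icc_self).aestronglyMeasurable measurableSet_Ioc
      · rw [uIoc_of_le ht] at hs
        exact hfder n t s (Ioc_subset_Icc_self hs) ξ
      · rw [uIoc_of_le ht] at hs
        rw [max_eq_left hs.1.le]
        exact hQlim s hs.1.le ξ
    have hrhs : Tendsto (fun n => f n t ξ - ψ₀ ξ) atTop (𝓝 (ψ t ξ - ψ₀ ξ)) :=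
      (hlim t ht ξ).sub_const _
    have := tendsto_nhds_unique hrhs (hdom.congr hftc)
    rw [← this]
    ring
  have hder : ∀ t, 0 ≤ t → ∀ ξ, HasDerivWithinAt (fun s => ψ s ξ) (Q t ξ) (Ici 0) t := by
    intro t ht ξ
    have h := (intervalIntegral.integral_hasDerivAt_right ((hQm ξ).intervalIntegrable 0 t)
      ((hQm ξ).stronglyMeasurableAtFilter _ _) (hQm ξ).continuousAt).const_add (ψ₀ ξ)
    rw [max_eq_left ht] at h
    exact h.hasDerivWithinAt.congr (fun s hs => hint ξ s hs) (hint ξ t ht)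
  refine ⟨ψ, ⟨?_, fun t ht ξ => ⟨(hder t ht ξ).differentiableWithinAt, ?_⟩⟩, hψc⟩
  · ext ξ
    simpa using hint ξ 0 le_rfl
  · rw [timeDeriv, (hder t ht ξ).derivWithin (uniqueDiffOn_Ici 0 t ht)]
    exact hQ t ht ξ

end CrossSection

end FourierBoltzmann

/-! ### The main theorem -/

theorem theorem3p1 (b : ℝ → ℝ) (hb_meas : Measurable b) (hb_nonneg : ∀ τ ∈ Ico (0 : ℝ) 1, 0 ≤ b τ)
    (α₀ : ℝ) (hα₀ : α₀ ∈ Ioc (0 : ℝ) 2)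
    (hb_int : IntegrableOn (fun θ : ℝ => Real.sin (θ / 2) ^ α₀ * b (Real.cos θ) * Real.sin θ)
      (Ioc 0 (Real.pi / 2))) :
    ∀ α ∈ Icc α₀ 2,
      -- existence, uniqueness, and continuity of the time derivative
      (∀ ψ₀ ∈ K α, ∃ ψ : ℝ → E3 → ℂ,
        IsClassicalSolution b ψ₀ ψ ∧ ContinuousInK α ψ ∧ ContinuousInK α₀ ψ ∧
        (∀ φ : ℝ → E3 → ℂ, IsClassicalSolution b ψ₀ φ → ContinuousInK α₀ φ →
          ∀ t, 0 ≤ t → φ t = ψ t) ∧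
        ContinuousOn (fun p : ℝ × E3 => timeDeriv ψ p.1 p.2) (Ici 0 ×ˢ univ)) ∧
      -- stability
      IntegrableOn (rateIntegrand b α) (Ioc 0 (Real.pi / 2)) ∧
      (∀ ψ₀ ∈ K α, ∀ φ₀ ∈ K α, ∀ ψ φ : ℝ → E3 → ℂ,
        IsClassicalSolution b ψ₀ ψ → ContinuousInK α ψ →
        IsClassicalSolution b φ₀ φ → ContinuousInK α φ →
        ∀ t, 0 < t →
          distK α (ψ t) (φ t) ≤ ENNReal.ofReal (Real.exp (rate b α * t)) * distK α ψ₀ φ₀) := by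
  intro α hα
  have hb₀ : CrossSection b α₀ := ⟨hb_meas, hb_nonneg, hα₀.1, by simpa only [mul_comm] using hb_int⟩
  have hb : CrossSection b α := ⟨hb_meas, hb_nonneg, hα₀.1.trans_le hα.1,
    integrableOn_moment_mono hb_meas hα.1 hb₀.integrable⟩
  refine ⟨fun ψ₀ hψ₀ => ?_, integrableOn_rateIntegrand hb_meas ⟨hb.pos.le, hα.2⟩ hb.integrable,
    fun ψ₀ hψ₀ φ₀ hφ₀ ψ φ hψ hψc hφ hφc t ht => ?_⟩
  · obtain ⟨ψ, hψ, hψc⟩ := hb.exists_isClassicalSolution hα.2 hψ₀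
    have hψc₀ := hψc.mono hα₀.1 hα.1
    refine ⟨ψ, hψ, hψc, hψc₀, fun φ hφ hφc t ht => ?_,
      hb.continuousOn_collision hα.2 hψc fun t ht ξ => (hψ.2 t ht ξ).2⟩
    -- The competitor is only known to lie in the larger space, so stability is applied with
    -- exponent `α₀`.
    have h := hb₀.distR_le_of_isClassicalSolution hα₀.2 hφ hφc hψ hψc₀ ht
    rw [show distR α₀ ψ₀ ψ₀ = 0 by rw [distR, distK_self]; rfl, mul_zero] at h
    ext ξ
    have h1 := norm_sub_le_distR (hφc.1 t ht) (hψc₀.1 t ht) ξ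
    have h2 := mul_nonpos_of_nonpos_of_nonneg h (Real.rpow_nonneg (norm_nonneg ξ) α₀)
    exact sub_eq_zero.1 (norm_le_zero_iff.1 (h1.trans h2))
  · have h := hb.distR_le_of_isClassicalSolution hα.2 hψ hψc hφ hφc ht.le
    rw [← ENNReal.ofReal_toReal (distK_lt_top (hψc.1 t ht.le) (hφc.1 t ht.le)).ne,
      ← ENNReal.ofReal_toReal (distK_lt_top hψ₀ hφ₀).ne,
      ← ENNReal.ofReal_mul (Real.exp_pos _).le]
    exact ENNReal.ofReal_le_ofReal h
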